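/- **Setting.** Let $E\subseteq\mathbb R$ be a nonempty open interval (finite, semi-infinite or infinite), let $f,g$ be real polynomials with $f>0$ on $E$, and let $V$ be differentiable on $E$ with $V'=g/f$. Put $\rho=e^{-V}$ and assume that $f\rho$ tends to $0$ at both endpoints of $E$. For $t=(t_1,t_2,\dots)$ a complex sequence with finitely many nonzero terms put $\rho_t(z)=\rho(z)e^{\sum t_iz^i}$ on $E$. Call $t$ *admissible* if $\int_E|z|^k|\rho_t(z)|\,dz<\infty$ for all $k\ge 0$. Let $$\langle\varphi,\psi\rangle^{sy}_t=\int_E\varphi\psi\,\rho_t\,dz,\qquad \mu_{ij}(t)=\langle z^i,z^j\rangle_t^{sy},\qquad m_n=(\mu_{ij})_{0\le i,j<n},\qquad m_\infty=(\mu_{ij})_{i,j\ge0},\qquad \tau_n(t)=\det m_n(t),$$ $${\Bbb n}_t=\sqrt{\tfrac{f}{\rho_t}}\,\frac{d}{dz}\sqrt{f\rho_t},\quad \sqrt{\rho_t}:=\sqrt\rho\,e^{\frac12\sum t_iz^i}.$$ $\Lambda$ is the shift, $\Lambda\chi(z)=z\chi(z)$ for $\chi(z)=(1,z,z^2,\dots)^\top$;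 $\partial$ is the matrix with $\chi'(z)=\partial\chi(z)$; $J$ is block diagonal with blocks $\begin{pmatrix}0&1\\-1&0\end{pmatrix}$. $\mathcal G_{\Bbb k}$ is the set of lower-triangular matrices whose $2\times2$ diagonal blocks are nonzero multiples of the identity; $\pi_{\Bbb k}$ is the projection onto the block lower-triangular matrices whose $2\times 2$ diagonal blocks are multiples of the identity, along $\{a: Ja^\top J=a\}$; $(\cdot)_{sk}$ is the projection onto skew-symmetric along lower-triangular matrices. If $S(t)$ is an invertible lower-triangular matrix with $m_\infty(t)=S^{-1}S^{\top-1}$, put $p(t,z)=S\chi(z)$ and $$L=S\Lambda S^{-1},\quad M=S\Bigl(\partial+\tfrac12\sum it_i\Lambda^{i-1}\Bigr)S^{-1},\quad \mathcal N=f(L)M-\tfrac{f'+g}{2}(L).$$ $\mathcal H_n$ is the space of Hermitian $n\times n$ matrices and $\mathcal T_{2n}$ that of self-dual Hermitian $n\times n$ quaternionic matrices in its complex $2n\times2n$ realization; integrals run over the matrices with spectrum in $E$. $dX$ is Haar (Lebesgue) measure, normalized so that $U(n)$, respectively $Sp(n)$, has volume one, i.e. $dX=\Delta(z)^{2}dz\,dU$,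 respectively $dX=\Delta(z)^4dz\,dU$, with $dU$ of mass one. On $\mathcal T_{2n}$, $\mathrm{Tr}$ is the trace of the $n\times n$ quaternionic matrix (half of the trace of the complex realization). $\mathrm{pf}$ is the Pfaffian, and $\{\varphi,\psi\}=\varphi'\psi-\varphi\psi'$. **(Toda lattice.)** Let $t$ be admissible. 1. For all $n\ge0$, $\displaystyle\tau_n(t)=\frac1{n!}\int_{\mathcal H_n}e^{\mathrm{Tr}(-V(X)+\sum t_iX^i)}dX$, absolutely convergent, and $\tau_n(t)>0$ if $t$ is real. 2. If all $\tau_n(t)\ne0$ then an $S(t)$ as above exists. For every such $S(t)$ the polynomials $p_n(t,z)$ are orthonormal for $\langle\,,\rangle_t^{sy}$, ${\Bbb n}_tp(t,z)=\mathcal N(t)p(t,z)$, and $\mathcal N(t)$ is skew-symmetric. 3. $\partial m_\infty/\partial t_j=\Lambda^jm_\infty$ and $\partial L/\partial t_j=\frac12[(L^j)_{sk},L]$. **(Map to the Pfaff lattice.)** Let $2t$ be admissible. Put $\tilde V=\frac12(V-\log f)$, $\tilde\rho_t(z)=e^{-\tilde V(z)+\sum t_iz^i}$, $\langle\varphi,\psi\rangle_t^{sk}=\langle\varphi,{\Bbb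 n}_{2t}\psi\rangle_{2t}^{sy}$, $\tilde\mu_{ij}(t)=\langle z^i,z^j\rangle_t^{sk}$, $\tilde m_{n}=(\tilde\mu_{ij})_{0\le i,j<n}$, $\tilde\tau_{2n}=\mathrm{pf}(\tilde m_{2n})$. 1. $\tilde\rho_t^2=\rho_{2t}f$ on $E$, and for all polynomials $\varphi,\psi$ $$\langle\varphi,\psi\rangle_t^{sk}=-\frac12\int_E\{\varphi,\psi\}\,\tilde\rho_t^2\,dz ,$$ where the integrals on both sides converge absolutely. 2. For all $n\ge0$, $$\tilde\tau_{2n}(t)=\mathrm{pf}(\tilde m_{2n}(t))=\frac1{2^n\,n!}\int_{\mathcal T_{2n}}e^{2\mathrm{Tr}(-\tilde V(X)+\sum t_iX^i)}dX,$$ absolutely convergent, and $\tilde\tau_{2n}(t)>0$ if $t$ is real. 3. Let $S(2t)$ be as above. If all $\tilde\tau_{2n}(t)\neq0$, there is a lower-triangular $O(2t)$ with $-\mathcal N(2t)=O^{-1}(2t)JO^{\top-1}(2t)$ and $O(2t)S(2t)\in\mathcal G_{\Bbb k}$; it is unique up to one sign for each consecutive pair of rows $2k,2k+1$. For every such $O(2t)$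 the polynomials $q(t,z)=O(2t)p(2t,z)$ are skew-orthonormal: $\langle q_i,q_j\rangle^{sk}_t=J_{ij}$. 4. $\partial\tilde m_\infty/\partial t_j=\Lambda^j\tilde m_\infty+\tilde m_\infty\Lambda^{\top j}$, and $\tilde L(t)=O(2t)L(2t)O(2t)^{-1}$ satisfies the Pfaff lattice $\partial\tilde L/\partial t_j=[-\pi_{\Bbb k}\tilde L^j,\tilde L]$. In the flow equations the derivative at $t$ is taken along any set of values of $t_j$ (the other times fixed) that contains the given one and on which the times concerned ($t$, respectively $2t$) are admissible. For the Lax equations, the factors $S$ and $O$ are assumed to exist at all these values, chosen with diagonal entries continuous at the given value. -/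

import Mathlib

open MeasureTheory Filter Topology

noncomputable section

namespace TodaPfaff

/-! ### Semi-infinite matrices -/

/-- Semi-infinite complex matrices, rows and columns indexed by `0, 1, 2, …`. -/
abbrev SMat := ℕ → ℕ → ℂ

/-- Matrix product. All products formed below have only finitely many nonzero terms
in each entry. -/
def mul (A B : SMat) : SMat := fun i j => ∑ᶠ k, A i k * B k j

/-- The identity matrix. -/
def one : SMat := fun i j => if i = j then 1 else 0

/-- Powers of a semi-infinite matrix. -/
def pow (A : SMat) : ℕ → SMat
  | 0 => one
  | n + 1 => mul (pow A n) A

/-- Transpose. -/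
def tr (A : SMat) : SMat := fun i j => A j i

/-- The commutator `[A, B]`. -/
def comm (A B : SMat) : SMat := mul A B - mul B A

/-- Lower-triangular matrices. -/
def IsLower (A : SMat) : Prop := ∀ i j, i < j → A i j = 0

/-- The inverse of a lower-triangular matrix with nonzero diagonal, by forward substitution. -/
def lowerInv (A : SMat) : ℕ → ℕ → ℂ
  | i, j => ((if i = j then 1 else 0) - ∑ k : Fin i, A i k * lowerInv A k j) / A i i
termination_by i => i
decreasing_by exact k.2

theorem lowerInv_isLower (A : SMat) : IsLower (lowerInv A) := by
  intro i
  induction i using Nat.strong_induction_on with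
  | _ i ih =>
    intro j hij
    rw [lowerInv]
    have h0 : ∑ k : Fin i, A i k * lowerInv A k j = 0 :=
      Finset.sum_eq_zero fun k _ => by rw [ih k k.2 j (k.2.trans hij), mul_zero]
    rw [h0]
    simp [hij.ne]

theorem mul_lowerInv {A : SMat} (hA : IsLower A) (hd : ∀ n, A n n ≠ 0) :
    mul A (lowerInv A) = one := by
  funext i j
  have hsub : (Function.support fun k => A i k * lowerInv A k j) ⊆
      ((Finset.range (i + 1) : Finset ℕ) : Set ℕ) := by
    intro k hk
    by_contra hk'
    have : i < k := by simpa using hk'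
    exact hk (by simp [hA i k this])
  unfold mul one
  rw [finsum_eq_sum_of_support_subset _ hsub, Finset.sum_range_succ]
  conv_lhs => enter [2]; rw [lowerInv]
  rw [mul_div_cancel₀ _ (hd i), Finset.sum_range fun k => A i k * lowerInv A k j]
  ring

/-- A polynomial with real coefficients evaluated at a semi-infinite matrix. -/
def evalMat (P : Polynomial ℝ) (A : SMat) : SMat :=
  fun i j => ∑ k ∈ Finset.range (P.natDegree + 1), (P.coeff k : ℂ) * pow A k i j

/-- The shift matrix `Λ`, with `Λ χ(z) = z χ(z)` for `χ(z) = (1, z, z², …)`. -/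
def shift : SMat := fun i j => if j = i + 1 then 1 else 0

/-- The matrix `∂` with `(d/dz) χ(z) = ∂ χ(z)`. -/
def derivMat : SMat := fun i j => if i = j + 1 then (i : ℂ) else 0

/-- The block-diagonal skew-symmetric matrix `J` with blocks `(0, 1; -1, 0)`. -/
def J : SMat := fun i j =>
  if Even i ∧ j = i + 1 then 1 else if Even j ∧ i = j + 1 then -1 else 0

/-- The involution `a ↦ J aᵀ J`. -/
def invol (A : SMat) : SMat := mul (mul J (tr A)) J

/-- Part of `A` strictly below the diagonal of `2 × 2` blocks. -/
def blockLower (A : SMat) : SMat := fun i j => if j / 2 < i / 2 then A i j else 0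

/-- Part of `A` on the diagonal of `2 × 2` blocks. -/
def blockDiag (A : SMat) : SMat := fun i j => if i / 2 = j / 2 then A i j else 0

/-- Part of `A` strictly above the diagonal of `2 × 2` blocks. -/
def blockUpper (A : SMat) : SMat := fun i j => if i / 2 < j / 2 then A i j else 0

/-- The projection of a matrix onto the algebra `𝕜` of block lower-triangular matrices whose
diagonal `2 × 2` blocks are multiples of the identity, along the fixed points of `invol`. -/
def projK (A : SMat) : SMat :=
  (blockLower A - invol (blockUpper A)) + (1 / 2 : ℂ) • (blockDiag A - invol (blockDiag A))

/-- The skew part of a matrix for the splitting into skew-symmetric and lower-triangular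
matrices. -/
def skewPart (A : SMat) : SMat :=
  fun i j => if i < j then A i j else if j < i then - A j i else 0

/-- The group `𝒢_𝕜`: lower-triangular matrices whose diagonal `2 × 2` blocks are nonzero multiples
of the identity. -/
def IsGk (Q : SMat) : Prop :=
  IsLower Q ∧ ∀ n, Q (2 * n) (2 * n) ≠ 0 ∧ Q (2 * n + 1) (2 * n + 1) = Q (2 * n) (2 * n) ∧
    Q (2 * n + 1) (2 * n) = 0

/-- The determinant of the leading `n × n` block. -/
def leadingDet (A : SMat) (n : ℕ) : ℂ := (Matrix.of fun i j : Fin n => A i j).det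

/-- The Pfaffian of a `2n × 2n` matrix. -/
def pfaffian {n : ℕ} (A : Matrix (Fin (2 * n)) (Fin (2 * n)) ℂ) : ℂ :=
  (1 / (2 ^ n * n.factorial : ℂ)) * ∑ σ : Equiv.Perm (Fin (2 * n)), ((Equiv.Perm.sign σ : ℤ) : ℂ) *
    ∏ k : Fin n, A (σ ⟨2 * k, by omega⟩) (σ ⟨2 * k + 1, by omega⟩)

/-- The Pfaffian of the leading `2n × 2n` block. -/
def leadingPf (A : SMat) (n : ℕ) : ℂ := pfaffian (Matrix.of fun i j : Fin (2 * n) => A i j)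

/-! ### Weights, inner products and polynomials -/

/-- The time variables `t = (t₁, t₂, …)`, finitely many of them nonzero. -/
abbrev Times := ℕ+ →₀ ℂ

/-- `∑ tᵢ zⁱ`. -/
def timeSum (t : Times) (z : ℂ) : ℂ := t.sum fun i c => c * z ^ (i : ℕ)

/-- The open interval with endpoints `a` and `b`, finite or infinite. -/
def interval (a b : EReal) : Set ℝ := {x : ℝ | a < (x : EReal) ∧ (x : EReal) < b}

/-- `ρ_t(z) = exp(-V(z) + ∑ tᵢ zⁱ)`. -/
def rho (V : ℝ → ℝ) (t : Times) (z : ℝ) : ℂ := Complex.exp (-(V z : ℂ) + timeSum t z)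

/-- `Ṽ = (V - log f) / 2`. -/
def Vtilde (f : Polynomial ℝ) (V : ℝ → ℝ) (z : ℝ) : ℝ := (V z - Real.log (f.eval z)) / 2

/-- All moments of the weight `ρ_t` on the interval `E` converge absolutely. -/
def Admissible (E : Set ℝ) (V : ℝ → ℝ) (t : Times) : Prop :=
  ∀ k : ℕ, IntegrableOn (fun z : ℝ => (z : ℂ) ^ k * rho V t z) E

/-- All the times are real. -/
def IsRealTimes (t : Times) : Prop := ∀ i, (t i).im = 0

/-- The inner product `⟨φ, ψ⟩_t^{sy} = ∫_E φ ψ ρ_t dz`. -/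
def symIP (E : Set ℝ) (V : ℝ → ℝ) (t : Times) (φ ψ : ℝ → ℂ) : ℂ :=
  ∫ z in E, φ z * ψ z * rho V t z

/-- The operator `𝕟_t = √(f / ρ_t) (d/dz) √(f ρ_t)`, where
`√ρ_t = √ρ exp(½ ∑ tᵢ zⁱ)`. -/
def nOp (f : Polynomial ℝ) (V : ℝ → ℝ) (t : Times) (φ : ℝ → ℂ) (z : ℝ) : ℂ :=
  (Real.sqrt (f.eval z / Real.exp (-V z)) : ℂ) * Complex.exp (-(timeSum t z / 2)) *
    deriv (fun x : ℝ => (Real.sqrt (f.eval x * Real.exp (-V x)) : ℂ) *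
      Complex.exp (timeSum t x / 2) * φ x) z

/-- The skew inner product `⟨φ, ψ⟩_t^{sk} = ⟨φ, 𝕟_{2t} ψ⟩_{2t}^{sy}`. -/
def skewIP (E : Set ℝ) (f : Polynomial ℝ) (V : ℝ → ℝ) (t : Times) (φ ψ : ℝ → ℂ) : ℂ :=
  symIP E V ((2 : ℂ) • t) φ (nOp f V ((2 : ℂ) • t) ψ)

/-- A polynomial as a function on the real line. -/
def pfun (P : Polynomial ℂ) : ℝ → ℂ := fun z => P.eval (z : ℂ)

/-- `{φ, ψ} = φ' ψ - φ ψ'`. -/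
def bracket (φ ψ : Polynomial ℂ) : Polynomial ℂ :=
  Polynomial.derivative φ * ψ - φ * Polynomial.derivative ψ

/-- The symmetric moment matrix `m_∞(t)`. -/
def moment (E : Set ℝ) (V : ℝ → ℝ) (t : Times) : SMat :=
  fun i j => symIP E V t (pfun (Polynomial.X ^ i)) (pfun (Polynomial.X ^ j))

/-- The skew-symmetric moment matrix `m̃_∞(t)`. -/
def skewMoment (E : Set ℝ) (f : Polynomial ℝ) (V : ℝ → ℝ) (t : Times) : SMat :=
  fun i j => skewIP E f V t (pfun (Polynomial.X ^ i)) (pfun (Polynomial.X ^ j))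

/-- `τ_n(t) = det m_n(t)`. -/
def tau (E : Set ℝ) (V : ℝ → ℝ) (t : Times) (n : ℕ) : ℂ := leadingDet (moment E V t) n

/-- `τ̃_{2n}(t) = pf m̃_{2n}(t)`. -/
def tauTilde (E : Set ℝ) (f : Polynomial ℝ) (V : ℝ → ℝ) (t : Times) (n : ℕ) : ℂ :=
  leadingPf (skewMoment E f V t) n

/-! ### The matrices of the Toda and Pfaff lattices -/

/-- `S` is a lower-triangular invertible matrix with `m_∞(t) = S⁻¹ (S⁻¹)ᵀ`. -/
def IsTodaFactor (E : Set ℝ) (V : ℝ → ℝ) (t : Times) (S : SMat) : Prop :=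
  IsLower S ∧ (∀ n, S n n ≠ 0) ∧ moment E V t = mul (lowerInv S) (tr (lowerInv S))

/-- The polynomials `p_n(z) = (S χ(z))_n`. -/
def polyP (S : SMat) (n : ℕ) : Polynomial ℂ :=
  ∑ k ∈ Finset.range (n + 1), Polynomial.C (S n k) * Polynomial.X ^ k

/-- The polynomials `q_n(z) = (O p(z))_n`. -/
def polyQ (S O : SMat) (n : ℕ) : Polynomial ℂ :=
  ∑ k ∈ Finset.range (n + 1), Polynomial.C (O n k) * polyP S k

/-- `L = S Λ S⁻¹`. -/
def matL (S : SMat) : SMat := mul (mul S shift) (lowerInv S)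

/-- `M = S (∂ + ½ ∑ i tᵢ Λ^{i-1}) S⁻¹`. -/
def matM (t : Times) (S : SMat) : SMat :=
  mul (mul S (derivMat + (1 / 2 : ℂ) •
    t.sum fun i c => ((i : ℕ) * c : ℂ) • pow shift ((i : ℕ) - 1))) (lowerInv S)

/-- `𝒩 = f(L) M - ((f' + g)/2)(L)`. -/
def matN (f g : Polynomial ℝ) (t : Times) (S : SMat) : SMat :=
  mul (evalMat f (matL S)) (matM t S) -
    evalMat (Polynomial.C (1 / 2) * (Polynomial.derivative f + g)) (matL S)

/-- With `S = S(t)`: the matrix `O` is lower-triangular, `-𝒩(t) = O⁻¹ J (O⁻¹)ᵀ`, and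
`O S` lies in `𝒢_𝕜`. -/
def IsPfaffMap (f g : Polynomial ℝ) (t : Times) (S O : SMat) : Prop :=
  IsLower O ∧ IsGk (mul O S) ∧
    -matN f g t S = mul (mul (lowerInv O) J) (tr (lowerInv O))

/-- `L̃ = O L O⁻¹`. -/
def matLtilde (S O : SMat) : SMat := mul (mul O (matL S)) (lowerInv O)

/-! ### Matrix integrals -/

/-- The index set of the entries above the diagonal. -/
abbrev Above (n : ℕ) := {p : Fin n × Fin n // p.1 < p.2}

/-- Real-linear coordinates on the space of Hermitian `n × n` matrices: the diagonal entries
and the entries above the diagonal. -/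
abbrev HermCoord (n : ℕ) := (Fin n → ℝ) × (Above n → ℂ)

/-- The Hermitian matrix with the given coordinates. -/
def hermMatrix {n : ℕ} (c : HermCoord n) : Matrix (Fin n) (Fin n) ℂ := fun i j =>
  if h : i < j then c.2 ⟨(i, j), h⟩
  else if h' : j < i then star (c.2 ⟨(j, i), h'⟩)
  else (c.1 i : ℂ)

/-- The complex `2 × 2` realization of a quaternion. -/
def quatBlock (x y : ℂ) : Matrix (Fin 2) (Fin 2) ℂ := !![x, y; -star y, star x]

/-- Real-linear coordinates on the space of self-dual Hermitian quaternionic `n × n` matrices: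
the (real) diagonal entries and the (quaternion) entries above the diagonal. -/
abbrev QuatCoord (n : ℕ) := (Fin n → ℝ) × (Above n → ℂ × ℂ)

/-- The complex `2n × 2n` realization of the self-dual quaternionic matrix with the given
coordinates. -/
def quatMatrix {n : ℕ} (c : QuatCoord n) : Matrix (Fin n × Fin 2) (Fin n × Fin 2) ℂ := fun p q =>
  if h : p.1 < q.1 then quatBlock (c.2 ⟨(p.1, q.1), h⟩).1 (c.2 ⟨(p.1, q.1), h⟩).2 p.2 q.2
  else if h' : q.1 < p.1 then
    (quatBlock (c.2 ⟨(q.1, p.1), h'⟩).1 (c.2 ⟨(q.1, p.1), h'⟩).2).conjTranspose p.2 q.2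
  else quatBlock (c.1 p.1 : ℂ) 0 p.2 q.2

/-- The space `𝒯_{2n}` of self-dual Hermitian quaternionic `n × n` matrices, in its
`2n × 2n` complex realization. -/
def selfDual (n : ℕ) : Set (Matrix (Fin n × Fin 2) (Fin n × Fin 2) ℂ) :=
  {X | X.IsHermitian ∧ ∀ k l : Fin n, ∃ x y : ℂ,
    (Matrix.of fun α β => X (k, α) (l, β)) = quatBlock x y}

theorem range_hermMatrix (n : ℕ) :
    Set.range (hermMatrix (n := n)) = {X | X.IsHermitian} := by
  ext X
  constructor
  · rintro ⟨c, rfl⟩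
    ext i j
    rcases lt_trichotomy i j with h | h | h
    · simp [hermMatrix, h, h.not_gt]
    · subst h; simp [hermMatrix]
    · simp [hermMatrix, h, h.not_gt]
  · intro hX
    refine ⟨(fun i => (X i i).re, fun p => X p.1.1 p.1.2), ?_⟩
    ext i j
    rcases lt_trichotomy i j with h | h | h
    · simp [hermMatrix, h]
    · subst h
      have := hX.apply i i
      simp only [hermMatrix, lt_irrefl, dite_false]
      exact Complex.conj_eq_iff_re.mp this
    · simpa [hermMatrix, h, h.not_gt] using hX.apply i j

theorem range_quatMatrix (n : ℕ) : Set.range (quatMatrix (n := n)) = selfDual n := by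
  ext X
  constructor
  · rintro ⟨c, rfl⟩
    refine ⟨?_, fun k l => ?_⟩
    · ext ⟨i, α⟩ ⟨j, β⟩
      rcases lt_trichotomy i j with h | h | h
      · simp [quatMatrix, h, h.not_gt]
      · subst h
        fin_cases α <;> fin_cases β <;> simp [quatMatrix, quatBlock]
      · simp [quatMatrix, h, h.not_gt]
    · rcases lt_trichotomy k l with h | h | h
      · exact ⟨(c.2 ⟨(k, l), h⟩).1, (c.2 ⟨(k, l), h⟩).2, by ext α β; simp [quatMatrix, h]⟩
      · subst h
        exact ⟨c.1 k, 0, by ext α β; simp [quatMatrix]⟩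
      · refine ⟨star (c.2 ⟨(l, k), h⟩).1, -(c.2 ⟨(l, k), h⟩).2, ?_⟩
        ext α β
        fin_cases α <;> fin_cases β <;> simp [quatMatrix, quatBlock, h, h.not_gt]
  · rintro ⟨hX, hB⟩
    refine ⟨(fun i => (X (i, 0) (i, 0)).re,
      fun p => (X (p.1.1, 0) (p.1.2, 0), X (p.1.1, 0) (p.1.2, 1))), ?_⟩
    have key : ∀ k l α β, X (k, α) (l, β) =
        quatBlock (X (k, 0) (l, 0)) (X (k, 0) (l, 1)) α β := by
      intro k l α β
      obtain ⟨x, y, hxy⟩ := hB k l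
      have e : ∀ α β, X (k, α) (l, β) = quatBlock x y α β := fun α β => congrFun₂ hxy α β
      rw [e α β, e 0 0, e 0 1]
      simp [quatBlock]
    ext ⟨i, α⟩ ⟨j, β⟩
    rcases lt_trichotomy i j with h | h | h
    · simp only [quatMatrix, h, dite_true]
      exact (key i j α β).symm
    · subst h
      have h00 : ((X (i, 0) (i, 0)).re : ℂ) = X (i, 0) (i, 0) :=
        Complex.conj_eq_iff_re.mp (hX.apply (i, 0) (i, 0))
      have h01 : X (i, 0) (i, 1) = 0 := by
        have a := hX.apply (i, 0) (i, 1)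
        rw [key i i 1 0] at a
        simp [quatBlock] at a
        have : (2 : ℂ) * X (i, 0) (i, 1) = 0 := by linear_combination -a
        simpa using this
      rw [key i i α β, h01]
      simp only [quatMatrix, lt_irrefl, dite_false]
      rw [h00]
    · simp only [quatMatrix, h.not_gt, h, dite_true, dite_false]
      rw [Matrix.conjTranspose_apply, ← key j i β α]
      exact hX.apply (i, α) (j, β)

/-- The trace of a self-dual quaternionic `n × n` matrix, that is the sum of its `n` real
diagonal entries: half the trace of the complex `2n × 2n` realization. -/
def quatTrace {n : ℕ} (X : Matrix (Fin n × Fin 2) (Fin n × Fin 2) ℂ) : ℂ := X.trace / 2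

/-- The Vandermonde determinant `∏_{i<j} (z_i - z_j)`. -/
def vandermonde {n : ℕ} (z : Fin n → ℝ) : ℝ := ∏ p : Above n, (z p.1.1 - z p.1.2)

/-- The Haar measure `dX` on Hermitian `n × n` matrices, normalized so that the volume of `U(n)`
is one, in other words so that `dX = Δ(z)² dz dU` with `dU` of total mass one. As the Haar measure
is unique up to a factor, this is fixed by the integral of `exp(-Tr X²)`. -/
def hermMeasure (n : ℕ) : Measure (HermCoord n) :=
  ENNReal.ofReal
    ((∫ z : Fin n → ℝ, vandermonde z ^ 2 * Real.exp (-∑ i, z i ^ 2)) /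
      (∫ c : HermCoord n, Real.exp (-((hermMatrix c ^ 2).trace.re)))) • volume

/-- The Haar measure `dX` on self-dual Hermitian quaternionic `n × n` matrices, normalized so that
the volume of `Sp(n)` is one, in other words so that `dX = Δ(z)⁴ dz dU` with `dU` of total mass
one. As the Haar measure is unique up to a factor, this is fixed by the integral of
`exp(-Tr X²)`. -/
def quatMeasure (n : ℕ) : Measure (QuatCoord n) :=
  ENNReal.ofReal
    ((∫ z : Fin n → ℝ, vandermonde z ^ 4 * Real.exp (-∑ i, z i ^ 2)) /
      (∫ c : QuatCoord n, Real.exp (-((quatTrace (quatMatrix c ^ 2)).re)))) • volume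

/-- `U(X) + ∑ tᵢ Xⁱ` for a Hermitian matrix `X`, with `U(X)` given by the functional calculus. -/
def potential {ι : Type} [Fintype ι] [DecidableEq ι] (U : ℝ → ℝ) (t : Times)
    (X : Matrix ι ι ℂ) : Matrix ι ι ℂ :=
  cfc U X + t.sum fun i c => c • X ^ (i : ℕ)

/-- `exp Tr(-V(X) + ∑ tᵢ Xⁱ)`. -/
def hermWeight (V : ℝ → ℝ) (t : Times) {n : ℕ} (c : HermCoord n) : ℂ :=
  Complex.exp (potential (fun z => -V z) t (hermMatrix c)).trace

/-- `exp 2 Tr(-U(X) + ∑ tᵢ Xⁱ)`. -/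
def quatWeight (U : ℝ → ℝ) (t : Times) {n : ℕ} (c : QuatCoord n) : ℂ :=
  Complex.exp (2 * quatTrace (potential (fun z => -U z) t (quatMatrix c)))

/-- The Hermitian matrices with spectrum in `E`. -/
def hermDomain (E : Set ℝ) (n : ℕ) : Set (HermCoord n) := {c | spectrum ℝ (hermMatrix c) ⊆ E}

/-- The self-dual quaternionic matrices with spectrum in `E`. -/
def quatDomain (E : Set ℝ) (n : ℕ) : Set (QuatCoord n) := {c | spectrum ℝ (quatMatrix c) ⊆ E}

end TodaPfaff

end

/-! Matrix integrals. Functions of the spectrum are integrated by the Weyl formula `weyl_integral`,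
proved without parametrizing orbits of the unitary or symplectic group. With a Gaussian weight,
integration by parts along the field `X ↦ Xᵏ` on the matrix space (`isLoop_matrix`) and along `∑ zᵢᵏ
∂ᵢ` on the eigenvalue space with density `Δ^(2d)` (`isLoop_vandermonde`) gives the same loop
equations for the power sums. These equations fix all moments up to normalization
(`IsLoop.eq_zero`). Both laws have exponential moments of every order, so equal moments force equal
symmetrized laws (`sum_map_perm_eq`). The Gaussian factor depends only on the spectrum and is then
divided out. Hermitian matrices are the case `d = 1`, self-dual quaternionic ones the case `d = 2`.
On the other side, Andréief's identity `andreief` writes `det m_n` as an integral against `Δ²`, and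
de Bruijn's identity `deBruijn`, through the confluent Vandermonde determinant, writes the Pfaffian
as an integral against `Δ⁴`. For real times the integrands are nonnegative, and positive on a
nonempty open set.

Skewness. On polynomials `𝕟_t` is the first-order operator `nPoly`. Since `fρ` vanishes at the ends
of the interval, the integral of `(f φ ψ ρ_t)'` is zero; this makes `𝕟_t` skew for the symmetric
inner product and yields the bracket formula (`momentLin_mul_nPoly`). Row-finite matrices act on
polynomials by `op`, which turns `L`, `M` into conjugates of multiplication by `z` and of `d/dz + ½
∑ i tᵢ zⁱ⁻¹`, and hence `𝒩` into a conjugate of `𝕟_t` (`op_matN`).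

Factorizations. Nonvanishing leading minors allow Gram–Schmidt, giving `S` (`exists_cholesky`).
Nonvanishing Pfaffians allow Gram–Schmidt in steps of two rows, giving `Q` in `𝒢_𝕜` with `Q m̃ Qᵀ =
J` (`exists_skew_cholesky`). As `S m̃ Sᵀ = -𝒩` (`IsWeight.congruence_toda`), the matrix `O` is `Q
S⁻¹`. Two choices of `Q` differ by a symplectic element of `𝒢_𝕜`, which is a diagonal sign matrix
(`IsGk.exists_sign`).

Flows. Moments are differentiated under the integral sign. Both Lax equations come from one
computation: for `m = Q⁻¹ C Q⁻ᵀ` with `C` constant, put `X = Q (Q⁻¹)'`. Then `L = Q Λ Q⁻¹` satisfies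
`L' = -[X, L]` (`hasD_matL`), while `Q m' Qᵀ = X C + C Xᵀ` (`congruence_deriv`) determines `X`. For
`C = 1` one gets `X + Xᵀ = Lʲ`, and for `C = J` one gets `X = π_𝕜 L̃ʲ` (`projK_eq`). -/

noncomputable section

namespace TodaPfaff

set_option linter.unusedSectionVars false

/-! ### Loop equations determine the moments of power sums -/

/-- The derivation of the ring of polynomials in the power sums `X m` given by
`X m ↦ m X (k + m - 1)`; it is induced by the vector field `∑ zᵢᵏ ∂ᵢ`. -/
def loopDer (k : ℕ) : Derivation ℂ (MvPolynomial ℕ ℂ) (MvPolynomial ℕ ℂ) :=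
  MvPolynomial.mkDerivation ℂ fun m => (m : ℂ) • MvPolynomial.X (k + m - 1)

/-- The loop equations for a functional on polynomials in the power sums. -/
structure IsLoop (α γ N : ℂ) (K : MvPolynomial ℕ ℂ →ₗ[ℂ] ℂ) : Prop where
  zero : ∀ q, K (MvPolynomial.X 0 * q) = N * K q
  succ : ∀ k q, 2 * K (MvPolynomial.X (k + 1) * q) =
    K ((∑ a ∈ Finset.range k, (MvPolynomial.X a * MvPolynomial.X (k - 1 - a) -
      α • MvPolynomial.X (k - 1))) * q) + γ * K (loopDer k q)

/-- The product of the power sums with indices in a list. -/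
def powProd (l : List ℕ) : MvPolynomial ℕ ℂ := (l.map MvPolynomial.X).prod

/-- Give `X m` the weight `m`; then `loopDer k` shifts weights by `k - 1`. The relation is written
with `+ 1` on the left because the shift is negative for `k = 0`. -/
theorem loopDer_powProd (k : ℕ) (l : List ℕ) :
    loopDer k (powProd l) ∈
      Submodule.span ℂ {q | ∃ l' : List ℕ, l'.sum + 1 = l.sum + k ∧ powProd l' = q} := by
  induction l with
  | nil => simp [powProd]
  | cons m l ih =>
    have h1 : powProd (m :: l) = MvPolynomial.X m * powProd l := by simp [powProd]
    rw [h1, Derivation.leibniz]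
    refine Submodule.add_mem _ ?_ ?_
    · refine Submodule.span_induction (p := fun x _ => MvPolynomial.X m • x ∈
        Submodule.span ℂ {q | ∃ l' : List ℕ, l'.sum + 1 = (m :: l).sum + k ∧ powProd l' = q})
        ?_ ?_ ?_ ?_ ih
      · rintro x ⟨l', hl', rfl⟩
        refine Submodule.subset_span ⟨m :: l', ?_, ?_⟩
        · simp only [List.sum_cons]; omega
        · simp [powProd]
      · simp
      · intro x y _ _ hx hy
        rw [smul_add]; exact Submodule.add_mem _ hx hy
      · intro c x _ hx
        rw [smul_comm]; exact Submodule.smul_mem _ _ hx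
    · rw [loopDer, MvPolynomial.mkDerivation_X, smul_eq_mul, mul_smul_comm]
      -- For `m = 0` the coefficient kills the term, so the truncated subtraction in `k + m - 1` is
      -- harmless.
      rcases Nat.eq_zero_or_pos m with rfl | hm
      · simp
      · refine Submodule.smul_mem _ _ (Submodule.subset_span ⟨(k + m - 1) :: l, ?_, ?_⟩)
        · simp only [List.sum_cons]; omega
        · simp [powProd, mul_comm]

/-- Every term on the right of `succ` has weight two less than the left side. Induction on the
weight therefore reduces every product of power sums to the value at `1`. -/
theorem IsLoop.eq_zero {α γ N : ℂ} {K : MvPolynomial ℕ ℂ →ₗ[ℂ] ℂ} (hK : IsLoop α γ N K)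
    (h1 : K 1 = 0) : K = 0 := by
  -- The inner induction on the list only strips factors `X 0`, which do not lower the weight.
  have key : ∀ l : List ℕ, (∀ l' : List ℕ, l'.sum < l.sum → K (powProd l') = 0) →
      K (powProd l) = 0 := by
    intro l hsum
    induction l with
    | nil => simpa [powProd] using h1
    | cons m l ih =>
      have e : powProd (m :: l) = MvPolynomial.X m * powProd l := by simp [powProd]
      rw [e]
      rcases m with _ | k
      · rw [hK.zero, ih (by simpa using hsum), mul_zero]
      · have h2 := hK.succ k (powProd l)
        have h3 : K (loopDer k (powProd l)) = 0 := by
          have : Submodule.span ℂ {q | ∃ l' : List ℕ, l'.sum + 1 = l.sum + k ∧ powProd l' = q} ≤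
              LinearMap.ker K := by
            rw [Submodule.span_le]
            rintro x ⟨l', hl', rfl⟩
            exact hsum l' (by simp only [List.sum_cons]; omega)
          exact this (loopDer_powProd k l)
        have h4 : K ((∑ a ∈ Finset.range k, (MvPolynomial.X a * MvPolynomial.X (k - 1 - a) -
            α • MvPolynomial.X (k - 1))) * powProd l) = 0 := by
          rw [Finset.sum_mul, map_sum]
          refine Finset.sum_eq_zero fun a ha => ?_
          have ha' := Finset.mem_range.1 ha
          rw [sub_mul, map_sub, smul_mul_assoc, map_smul]
          have e1 := hsum (a :: (k - 1 - a) :: l) (by simp only [List.sum_cons]; omega)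
          have e2 := hsum ((k - 1) :: l) (by simp only [List.sum_cons]; omega)
          simp only [powProd, List.map_cons, List.prod_cons] at e1 e2
          rw [mul_assoc, powProd, e1, e2]; simp
        rw [h3, h4] at h2
        simpa using h2
  have all : ∀ d (l : List ℕ), l.sum = d → K (powProd l) = 0 := by
    intro d
    induction d using Nat.strong_induction_on with
    | _ d ih =>
      intro l hl
      exact key l fun l' hl' => ih l'.sum (hl ▸ hl') l' rfl
  refine MvPolynomial.linearMap_ext fun s => ?_
  refine LinearMap.ext_ring ?_
  have : MvPolynomial.monomial s (1 : ℂ) = powProd s.toMultiset.toList := by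
    rw [powProd, ← Multiset.prod_coe, ← Multiset.map_coe, Multiset.coe_toList,
      MvPolynomial.monomial_eq, MvPolynomial.C_1, one_mul, Finsupp.toMultiset_map,
      Finsupp.prod_toMultiset]
    rw [Finsupp.prod_mapDomain_index] <;> simp [pow_add]
  simp [this, all _ _ rfl]

/-! ### Symmetric polynomials are polynomials in the power sums -/

/-- Newton's identities, divided by `k` in characteristic zero, put the elementary symmetric
polynomials into the algebra generated by the power sums; the fundamental theorem on symmetric
polynomials does the rest. -/
theorem exists_aeval_psum_eq {ι : Type} [Fintype ι] [DecidableEq ι] (h : MvPolynomial ι ℂ)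
    (hs : h.IsSymmetric) : ∃ q : MvPolynomial ℕ ℂ,
      MvPolynomial.aeval (fun m => MvPolynomial.psum ι ℂ m) q = h := by
  set A := (MvPolynomial.aeval (R := ℂ) (fun m => MvPolynomial.psum ι ℂ m)).range with hA
  have hp : ∀ m, MvPolynomial.psum ι ℂ m ∈ A := fun m => ⟨MvPolynomial.X m, by simp⟩
  have he : ∀ k, MvPolynomial.esymm ι ℂ k ∈ A := by
    intro k
    induction k using Nat.strong_induction_on with
    | _ k ih =>
      rcases Nat.eq_zero_or_pos k with rfl | hk
      · rw [MvPolynomial.esymm_zero]; exact A.one_mem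
      · have h2 := MvPolynomial.mul_esymm_eq_sum ι ℂ k
        have h3 : (k : MvPolynomial ι ℂ) * MvPolynomial.esymm ι ℂ k ∈ A := by
          rw [h2]
          refine A.mul_mem (A.pow_mem (A.neg_mem A.one_mem) _) (A.sum_mem fun a ha => ?_)
          refine A.mul_mem (A.mul_mem (A.pow_mem (A.neg_mem A.one_mem) _) (ih _ ?_)) (hp _)
          exact (Finset.mem_filter.1 ha).2
        have h4 : MvPolynomial.esymm ι ℂ k =
            (k : ℂ)⁻¹ • ((k : MvPolynomial ι ℂ) * MvPolynomial.esymm ι ℂ k) := by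
          have : (k : MvPolynomial ι ℂ) = MvPolynomial.C (k : ℂ) := by simp
          rw [this, ← MvPolynomial.smul_eq_C_mul, smul_smul, inv_mul_cancel₀, one_smul]
          exact_mod_cast hk.ne'
        rw [h4]
        exact A.smul_mem h3 _
  obtain ⟨r, hr⟩ := MvPolynomial.esymmAlgHom_surjective (σ := ι) (R := ℂ)
    (n := Fintype.card ι) le_rfl ⟨h, hs⟩
  have hr' : MvPolynomial.aeval (fun i : Fin (Fintype.card ι) => MvPolynomial.esymm ι ℂ (i + 1)) r
      = h := by
    have := congrArg Subtype.val hr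
    rwa [MvPolynomial.esymmAlgHom_apply] at this
  have : h ∈ A := by
    rw [← hr']
    have h5 : Algebra.adjoin ℂ (Set.range fun i : Fin (Fintype.card ι) =>
        MvPolynomial.esymm ι ℂ (i + 1)) ≤ A :=
      Algebra.adjoin_le (by rintro _ ⟨i, rfl⟩; exact he _)
    rw [Algebra.adjoin_range_eq_range_aeval] at h5
    exact h5 ⟨r, rfl⟩
  exact this

/-! ### Measures with equal moments of power sums -/

/-- The functional of the moments of power sums. -/
def powSum {ι : Type} [Fintype ι] (z : ι → ℝ) (m : ℕ) : ℂ := ∑ i, (z i : ℂ) ^ m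

theorem lintegral_comp_perm_sum {ι : Type} [Fintype ι] [DecidableEq ι] (μ : Measure (ι → ℝ))
    (F : (ι → ℝ) → ENNReal) (hF : Measurable F)
    (hsym : ∀ (σ : Equiv.Perm ι) z, F (z ∘ σ) = F z) :
    ∫⁻ z, F z ∂(∑ σ : Equiv.Perm ι, μ.map (fun z => z ∘ σ)) =
      (Fintype.card (Equiv.Perm ι) : ENNReal) * ∫⁻ z, F z ∂μ := by
  have hm : ∀ σ : Equiv.Perm ι, Measurable (fun z : ι → ℝ => z ∘ σ) := fun σ =>
    measurable_pi_lambda _ fun i => measurable_pi_apply _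
  rw [lintegral_finsetSum_measure]
  simp_rw [lintegral_map hF (hm _), hsym]
  simp

/-- Moments of power sums only see symmetric polynomials, so the measures are compared after
symmetrization. The characteristic function of a symmetrized measure at `L` is a series whose `k`-th
term integrates `∑_σ (i L(z ∘ σ))ᵏ / k!`, a symmetric polynomial. The exponential moments permit
termwise integration. -/
theorem sum_map_perm_eq {ι : Type} [Fintype ι] [DecidableEq ι] {μ ν : Measure (ι → ℝ)}
    [IsFiniteMeasure μ] [IsFiniteMeasure ν]
    (hμ : ∀ s : ℝ, Integrable (fun z => Real.exp (s * ∑ i, |z i|)) μ)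
    (hν : ∀ s : ℝ, Integrable (fun z => Real.exp (s * ∑ i, |z i|)) ν)
    (h : ∀ q : MvPolynomial ℕ ℂ, ∫ z, MvPolynomial.aeval (powSum z) q ∂μ =
      ∫ z, MvPolynomial.aeval (powSum z) q ∂ν) :
    ∑ σ : Equiv.Perm ι, μ.map (fun z => z ∘ σ) = ∑ σ : Equiv.Perm ι, ν.map (fun z => z ∘ σ) := by
  have hm : ∀ σ : Equiv.Perm ι, Measurable (fun z : ι → ℝ => z ∘ σ) := fun σ =>
    measurable_pi_lambda _ fun i => measurable_pi_apply _
  have hps : ∀ (z : ι → ℝ) (q : MvPolynomial ℕ ℂ),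
      MvPolynomial.aeval (fun i => (z i : ℂ)) (MvPolynomial.aeval (fun m => MvPolynomial.psum ι ℂ m) q)
        = MvPolynomial.aeval (powSum z) q := by
    intro z q
    rw [← AlgHom.comp_apply, MvPolynomial.comp_aeval]
    congr 2
    funext m
    simp [MvPolynomial.psum, powSum]
  have hsymm : ∀ r : MvPolynomial ι ℂ, r.IsSymmetric →
      ∫ z, MvPolynomial.aeval (fun i => (z i : ℂ)) r ∂μ =
        ∫ z, MvPolynomial.aeval (fun i => (z i : ℂ)) r ∂ν := by
    intro r hr
    obtain ⟨q, rfl⟩ := exists_aeval_psum_eq r hr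
    simp_rw [hps]
    exact h q
  refine Measure.ext_of_charFunDual ?_
  funext L
  set u : ι → ℝ := fun i => L (Pi.single i 1) with hu
  have hL : ∀ z : ι → ℝ, L z = ∑ i, u i * z i := by
    intro z
    conv_lhs => rw [← Finset.univ_sum_single z]
    rw [map_sum]
    refine Finset.sum_congr rfl fun i _ => ?_
    have : (Pi.single i (z i) : ι → ℝ) = z i • Pi.single i 1 := by
      rw [← Pi.single_smul]; simp
    rw [this, map_smul, smul_eq_mul, mul_comm]
  set C : ℝ := ∑ i, |u i| with hC
  have hb : ∀ (σ : Equiv.Perm ι) z, |L (z ∘ σ)| ≤ C * ∑ i, |z i| := by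
    intro σ z
    rw [hL, hC, Finset.sum_mul]
    refine (Finset.abs_sum_le_sum_abs _ _).trans (Finset.sum_le_sum fun i _ => ?_)
    rw [abs_mul]
    gcongr
    exact Finset.single_le_sum (f := fun i => |z i|) (fun i _ => abs_nonneg _) (Finset.mem_univ (σ i))
  have hser : ∀ η : Measure (ι → ℝ), IsFiniteMeasure η →
      (∀ s : ℝ, Integrable (fun z => Real.exp (s * ∑ i, |z i|)) η) →
      HasSum (fun k : ℕ => ∫ z, MvPolynomial.aeval (fun i => (z i : ℂ))
        (∑ σ : Equiv.Perm ι, ((k.factorial : ℂ)⁻¹ * Complex.I ^ k) •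
          (∑ i, (u i : ℂ) • MvPolynomial.X (σ i)) ^ k : MvPolynomial ι ℂ) ∂η)
        (charFunDual (∑ σ : Equiv.Perm ι, η.map (fun z => z ∘ σ)) L) := by
    intro η _ hη
    have hI : ∀ σ : Equiv.Perm ι, Integrable (fun z => Complex.exp (L (z ∘ σ) * Complex.I)) η := by
      intro σ
      refine Integrable.mono' (integrable_const (1 : ℝ)) ?_ (ae_of_all _ fun z => ?_)
      · exact (Complex.measurable_exp.comp ((Complex.measurable_ofReal.comp
          (L.continuous.measurable.comp (hm σ))).mul_const _)).aestronglyMeasurable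
      · rw [Complex.norm_exp_ofReal_mul_I]
    have e1 : charFunDual (∑ σ : Equiv.Perm ι, η.map (fun z => z ∘ σ)) L =
        ∫ z, ∑ σ : Equiv.Perm ι, Complex.exp (L (z ∘ σ) * Complex.I) ∂η := by
      have hc : Continuous fun v : ι → ℝ => Complex.exp (L v * Complex.I) := by fun_prop
      rw [charFunDual_apply, integral_finsetSum_measure, integral_finsetSum _ fun σ _ => hI σ]
      · refine Finset.sum_congr rfl fun σ _ => ?_
        rw [integral_map (hm σ).aemeasurable hc.aestronglyMeasurable]
      · intro σ _
        rw [integrable_map_measure hc.aestronglyMeasurable (hm σ).aemeasurable]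
        exact hI σ
    rw [e1]
    have hval : ∀ k (z : ι → ℝ), MvPolynomial.aeval (fun i => (z i : ℂ))
        (∑ σ : Equiv.Perm ι, ((k.factorial : ℂ)⁻¹ * Complex.I ^ k) •
          (∑ i, (u i : ℂ) • MvPolynomial.X (σ i)) ^ k : MvPolynomial ι ℂ) =
        ∑ σ : Equiv.Perm ι, (L (z ∘ σ) * Complex.I) ^ k / k.factorial := by
      intro k z
      rw [map_sum]
      refine Finset.sum_congr rfl fun σ _ => ?_
      rw [map_smul, map_pow, map_sum, hL]
      simp only [map_smul, MvPolynomial.aeval_X, smul_eq_mul]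
      push_cast
      simp only [Function.comp_apply]
      rw [mul_pow]; ring
    simp_rw [hval]
    -- The majorants sum to a multiple of `exp (C ∑ |zᵢ|)`, with `C` the `ℓ¹` norm of the
    -- coefficients of `L`.
    refine hasSum_integral_of_dominated_convergence
      (fun k z => ∑ σ : Equiv.Perm ι, (C * ∑ i, |z i|) ^ k / k.factorial) ?_ ?_ ?_ ?_ ?_
    · intro k
      refine Measurable.aestronglyMeasurable ?_
      refine Finset.measurable_sum _ fun σ _ => ?_
      exact (((Complex.measurable_ofReal.comp
          (L.continuous.measurable.comp (hm σ))).mul_const _).pow_const _).div_const _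
    · intro k
      refine ae_of_all _ fun z => (norm_sum_le _ _).trans (Finset.sum_le_sum fun σ _ => ?_)
      rw [norm_div, norm_pow, norm_mul, Complex.norm_I, mul_one, Complex.norm_natCast,
        Complex.norm_real, Real.norm_eq_abs]
      gcongr
      exact hb σ z
    · refine ae_of_all _ fun z => summable_sum fun σ _ => Real.summable_pow_div_factorial _
    · have : (fun z : ι → ℝ => ∑' k : ℕ, ∑ σ : Equiv.Perm ι, (C * ∑ i, |z i|) ^ k / k.factorial) =
          fun z => (Fintype.card (Equiv.Perm ι) : ℝ) * Real.exp (C * ∑ i, |z i|) := by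
        funext z
        simp only [Finset.sum_const, Finset.card_univ, nsmul_eq_mul]
        rw [tsum_mul_left, Real.exp_eq_exp_ℝ, NormedSpace.exp_eq_tsum_div]
      rw [this]
      exact (hη C).const_mul _
    · refine ae_of_all _ fun z => hasSum_sum fun σ _ => ?_
      rw [Complex.exp_eq_exp_ℂ]
      exact NormedSpace.expSeries_div_hasSum_exp _
  refine (hser μ inferInstance hμ).unique ?_
  convert hser ν inferInstance hν using 1
  funext k
  refine hsymm _ ?_
  intro τ
  simp only [map_sum, map_smul, map_pow, MvPolynomial.rename_X]
  refine Fintype.sum_equiv (Equiv.mulLeft τ) _ _ fun σ => ?_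
  simp

/-- Two measures on `ℝ^ι` with exponential moments and equal moments of power sums integrate
symmetric functions in the same way. -/
theorem lintegral_symmetric_eq {ι : Type} [Fintype ι] [DecidableEq ι] {μ ν : Measure (ι → ℝ)}
    [IsFiniteMeasure μ] [IsFiniteMeasure ν]
    (hμ : ∀ s : ℝ, Integrable (fun z => Real.exp (s * ∑ i, |z i|)) μ)
    (hν : ∀ s : ℝ, Integrable (fun z => Real.exp (s * ∑ i, |z i|)) ν)
    (h : ∀ q : MvPolynomial ℕ ℂ, ∫ z, MvPolynomial.aeval (powSum z) q ∂μ =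
      ∫ z, MvPolynomial.aeval (powSum z) q ∂ν)
    {F : (ι → ℝ) → ENNReal} (hF : Measurable F)
    (hsym : ∀ (σ : Equiv.Perm ι) z, F (z ∘ σ) = F z) : ∫⁻ z, F z ∂μ = ∫⁻ z, F z ∂ν := by
  have h1 := lintegral_comp_perm_sum μ F hF hsym
  rw [sum_map_perm_eq hμ hν h, lintegral_comp_perm_sum ν F hF hsym] at h1
  refine ((ENNReal.mul_right_inj ?_ ?_).1 h1).symm
  · simp
  · simp

/-! ### Functions of exponential growth and Gaussian integrals -/

/-- Continuous functions of at most exponential growth. -/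
def ExpBdd {W : Type} [NormedAddCommGroup W] (φ : W → ℂ) : Prop :=
  Continuous φ ∧ ∃ C K : ℝ, 0 ≤ C ∧ 0 ≤ K ∧ ∀ x, ‖φ x‖ ≤ C * Real.exp (K * ‖x‖)

namespace ExpBdd

variable {W : Type} [NormedAddCommGroup W]

theorem const (c : ℂ) : ExpBdd (fun _ : W => c) :=
  ⟨continuous_const, ‖c‖, 0, norm_nonneg _, le_rfl, fun x => by simp⟩

theorem add {φ ψ : W → ℂ} (h1 : ExpBdd φ) (h2 : ExpBdd ψ) : ExpBdd (fun x => φ x + ψ x) := by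
  obtain ⟨c1, C1, K1, hC1, hK1, h1⟩ := h1
  obtain ⟨c2, C2, K2, hC2, hK2, h2⟩ := h2
  refine ⟨c1.add c2, C1 + C2, K1 + K2, by positivity, by positivity, fun x => ?_⟩
  refine (norm_add_le _ _).trans ?_
  rw [add_mul]
  have hx := norm_nonneg x
  refine add_le_add ((h1 x).trans ?_) ((h2 x).trans ?_)
  · gcongr; linarith
  · gcongr; linarith

theorem mul {φ ψ : W → ℂ} (h1 : ExpBdd φ) (h2 : ExpBdd ψ) : ExpBdd (fun x => φ x * ψ x) := by
  obtain ⟨c1, C1, K1, hC1, hK1, h1⟩ := h1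
  obtain ⟨c2, C2, K2, hC2, hK2, h2⟩ := h2
  refine ⟨c1.mul c2, C1 * C2, K1 + K2, by positivity, by positivity, fun x => ?_⟩
  rw [norm_mul, add_mul, Real.exp_add]
  calc ‖φ x‖ * ‖ψ x‖ ≤ (C1 * Real.exp (K1 * ‖x‖)) * (C2 * Real.exp (K2 * ‖x‖)) :=
        mul_le_mul (h1 x) (h2 x) (norm_nonneg _) (by positivity)
    _ = _ := by ring

theorem sub {φ ψ : W → ℂ} (h1 : ExpBdd φ) (h2 : ExpBdd ψ) : ExpBdd (fun x => φ x - ψ x) := by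
  have := h1.add ((const (-1)).mul h2)
  simpa [sub_eq_add_neg] using this

theorem sum {κ : Type} (s : Finset κ) {φ : κ → W → ℂ} (h : ∀ i ∈ s, ExpBdd (φ i)) :
    ExpBdd (fun x => ∑ i ∈ s, φ i x) := by
  classical
  induction s using Finset.induction_on with
  | empty => simpa using const 0
  | insert a s ha ih =>
    simp_rw [Finset.sum_insert ha]
    exact (h a (by simp)).add (ih fun i hi => h i (by simp [hi]))

theorem prod {κ : Type} (s : Finset κ) {φ : κ → W → ℂ} (h : ∀ i ∈ s, ExpBdd (φ i)) :
    ExpBdd (fun x => ∏ i ∈ s, φ i x) := by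
  classical
  induction s using Finset.induction_on with
  | empty => simpa using const 1
  | insert a s ha ih =>
    simp_rw [Finset.prod_insert ha]
    exact (h a (by simp)).mul (ih fun i hi => h i (by simp [hi]))

theorem pow {φ : W → ℂ} (h : ExpBdd φ) (n : ℕ) : ExpBdd (fun x => φ x ^ n) := by
  simpa using prod (Finset.range n) (φ := fun _ => φ) fun _ _ => h

theorem of_linear [NormedSpace ℝ W] [FiniteDimensional ℝ W] (L : W →ₗ[ℝ] ℂ) :
    ExpBdd (fun x => L x) := by
  set L' := LinearMap.toContinuousLinearMap L
  refine ⟨L'.continuous, ‖L'‖, 1, norm_nonneg _, zero_le_one, fun x => ?_⟩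
  refine (L'.le_opNorm x).trans ?_
  gcongr
  rw [one_mul]
  linarith [Real.add_one_le_exp ‖x‖]

theorem aeval {κ : Type} {P : W → κ → ℂ} (h : ∀ m, ExpBdd (fun x => P x m))
    (q : MvPolynomial κ ℂ) : ExpBdd (fun x => MvPolynomial.aeval (P x) q) := by
  induction q using MvPolynomial.induction_on with
  | C c => simpa using const c
  | add p q hp hq => simpa using hp.add hq
  | mul_X p i hp => simpa using hp.mul (h i)

theorem matrix_pow {ι : Type} [Fintype ι] [DecidableEq ι] {X : W → Matrix ι ι ℂ}
    (h : ∀ i j, ExpBdd (fun x => X x i j)) (k : ℕ) : ∀ i j, ExpBdd (fun x => (X x ^ k) i j) := by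
  induction k with
  | zero => intro i j; simpa using const _
  | succ k ih =>
    intro i j
    simp_rw [pow_succ, Matrix.mul_apply]
    exact sum _ fun l _ => (ih i l).mul (h l j)

end ExpBdd

/-- Completing the square bounds the function by a multiple of `(1 + ‖x‖)^(-r)`, which is integrable
because `r` exceeds the dimension. -/
theorem integrable_of_norm_le_exp_sub_sq {W E : Type} [NormedAddCommGroup W] [NormedSpace ℝ W]
    [FiniteDimensional ℝ W] [MeasurableSpace W] [BorelSpace W] (μ : Measure W) [μ.IsAddHaarMeasure]
    [NormedAddCommGroup E] {φ : W → E} (hφ : AEStronglyMeasurable φ μ) {C K δ : ℝ} (hδ : 0 < δ)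
    (hC : 0 ≤ C) (h : ∀ x, ‖φ x‖ ≤ C * Real.exp (K * ‖x‖ - δ * ‖x‖ ^ 2)) : Integrable φ μ := by
  set r : ℝ := Module.finrank ℝ W + 1 with hr
  have hr0 : 0 ≤ r := by positivity
  have hI : Integrable (fun x : W => (1 + ‖x‖) ^ (-r)) μ :=
    integrable_one_add_norm (by rw [hr]; linarith)
  refine (hI.const_mul (C * Real.exp ((K + r) ^ 2 / (4 * δ)))).mono' hφ (ae_of_all _ fun x => ?_)
  refine (h x).trans ?_
  rw [mul_assoc]
  refine mul_le_mul_of_nonneg_left ?_ hC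
  have hx := norm_nonneg x
  have h1 : (1 + ‖x‖) ^ r ≤ Real.exp (r * ‖x‖) := by
    rw [mul_comm, Real.exp_mul]
    exact Real.rpow_le_rpow (by positivity) (by linarith [Real.add_one_le_exp ‖x‖]) hr0
  have h2 : K * ‖x‖ - δ * ‖x‖ ^ 2 + r * ‖x‖ ≤ (K + r) ^ 2 / (4 * δ) := by
    rw [le_div_iff₀ (by positivity)]
    nlinarith [sq_nonneg (2 * δ * ‖x‖ - (K + r))]
  rw [Real.rpow_neg (by positivity), ← div_eq_mul_inv, le_div_iff₀ (by positivity)]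
  calc _ ≤ Real.exp (K * ‖x‖ - δ * ‖x‖ ^ 2) * Real.exp (r * ‖x‖) := by gcongr
    _ = Real.exp (K * ‖x‖ - δ * ‖x‖ ^ 2 + r * ‖x‖) := (Real.exp_add _ _).symm
    _ ≤ _ := Real.exp_le_exp.2 h2

theorem ExpBdd.integrable_mul_gauss {W : Type} [NormedAddCommGroup W] [NormedSpace ℝ W]
    [FiniteDimensional ℝ W] [MeasurableSpace W] [BorelSpace W] (μ : Measure W) [μ.IsAddHaarMeasure]
    {φ : W → ℂ} (hφ : ExpBdd φ) {Q : W → ℝ} (hQ : Continuous Q) {δ : ℝ} (hδ : 0 < δ)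
    (h : ∀ x, δ * ‖x‖ ^ 2 ≤ Q x) : Integrable (fun x => φ x * (Real.exp (-Q x) : ℂ)) μ := by
  obtain ⟨hc, C, K, hC, hK, hb⟩ := hφ
  refine integrable_of_norm_le_exp_sub_sq (C := C) (K := K) μ
    (Continuous.aestronglyMeasurable (by fun_prop)) hδ hC fun x => ?_
  rw [norm_mul, Complex.norm_real, Real.norm_eq_abs, abs_of_pos (Real.exp_pos _), sub_eq_add_neg,
    Real.exp_add, ← mul_assoc]
  gcongr
  · exact hb x
  · exact h x

/-- Integration by parts against a Gaussian weight. -/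
theorem integral_lineDeriv_gauss {W : Type} [NormedAddCommGroup W] [NormedSpace ℝ W]
    [FiniteDimensional ℝ W] [MeasurableSpace W] [BorelSpace W] (μ : Measure W) [μ.IsAddHaarMeasure]
    {φ φ' : W → ℂ} (hφ : ExpBdd φ) (hφ' : ExpBdd φ') {Q : W → ℝ} {Q' : W → ℂ} (hQ : Continuous Q)
    (hQ' : ExpBdd Q')
    {δ : ℝ} (hδ : 0 < δ) (h : ∀ x, δ * ‖x‖ ^ 2 ≤ Q x) (v : W)
    (d1 : ∀ x, HasLineDerivAt ℝ φ (φ' x) x v)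
    (d2 : ∀ x, HasLineDerivAt ℝ (fun x => (Q x : ℂ)) (Q' x) x v) :
    ∫ x, (φ' x - φ x * Q' x) * (Real.exp (-Q x) : ℂ) ∂μ = 0 := by
  have i1 := hφ'.integrable_mul_gauss μ hQ hδ h
  have i2 := ((hφ.mul hQ').mul (ExpBdd.const (-1))).integrable_mul_gauss μ hQ hδ h
  have i3 := hφ.integrable_mul_gauss μ hQ hδ h
  have d3 : ∀ x, HasLineDerivAt ℝ (fun x => (Real.exp (-Q x) : ℂ))
      (-Q' x * (Real.exp (-Q x) : ℂ)) x v := by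
    intro x
    have h3 : HasDerivAt (fun t : ℝ => (Q (x + t • v) : ℂ)) (Q' x) 0 := d2 x
    have h4 := h3.fun_neg.cexp
    change HasDerivAt (fun t : ℝ => (Real.exp (-Q (x + t • v)) : ℂ)) _ 0
    push_cast
    convert h4 using 1
    simp
    ring
  have key := integral_bilinear_hasLineDerivAt_right_eq_neg_left_of_integrable
    (B := ContinuousLinearMap.mul ℝ ℂ) (μ := μ) (f := φ) (f' := φ')
    (g := fun x => (Real.exp (-Q x) : ℂ)) (g' := fun x => -Q' x * (Real.exp (-Q x) : ℂ)) (v := v)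
    (by simpa using i1) (by
      refine i2.congr (ae_of_all _ fun x => ?_)
      simp only [ContinuousLinearMap.mul_apply']; ring) (by simpa using i3)
    (fun x _ => d1 x) (fun x _ => d3 x)
  simp only [ContinuousLinearMap.mul_apply'] at key
  have e : ∀ x, (φ' x - φ x * Q' x) * (Real.exp (-Q x) : ℂ) =
      φ' x * (Real.exp (-Q x) : ℂ) + φ x * (-Q' x * (Real.exp (-Q x) : ℂ)) := fun x => by ring
  simp_rw [e]
  rw [integral_add i1, key]
  · ring
  · refine i2.congr (ae_of_all _ fun x => ?_)
    ring

/-! ### Directional derivatives of polynomials in the power sums -/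

/-- The derivative of a polynomial at the point `P` in the direction `v`. -/
def dirDer (P : ℕ → ℂ) (q : MvPolynomial ℕ ℂ) (v : ℕ → ℂ) : ℂ :=
  MvPolynomial.aeval P (MvPolynomial.mkDerivation ℂ (fun m => MvPolynomial.C (v m)) q)

@[simp] theorem dirDer_C (P : ℕ → ℂ) (c : ℂ) (v : ℕ → ℂ) : dirDer P (MvPolynomial.C c) v = 0 := by
  simp [dirDer]

@[simp] theorem dirDer_add (P : ℕ → ℂ) (p q : MvPolynomial ℕ ℂ) (v : ℕ → ℂ) :
    dirDer P (p + q) v = dirDer P p v + dirDer P q v := by simp [dirDer]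

@[simp] theorem dirDer_mul_X (P : ℕ → ℂ) (p : MvPolynomial ℕ ℂ) (m : ℕ) (v : ℕ → ℂ) :
    dirDer P (p * MvPolynomial.X m) v =
      dirDer P p v * P m + MvPolynomial.aeval P p * v m := by
  simp [dirDer]; ring

theorem dirDer_sum {κ : Type} (s : Finset κ) (P : ℕ → ℂ) (q : MvPolynomial ℕ ℂ) (c : κ → ℂ)
    (v : κ → ℕ → ℂ) :
    ∑ i ∈ s, c i * dirDer P q (v i) = dirDer P q (fun m => ∑ i ∈ s, c i * v i m) := by
  induction q using MvPolynomial.induction_on with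
  | C c => simp
  | add p q hp hq => simp [mul_add, Finset.sum_add_distrib, hp, hq]
  | mul_X p m hp =>
    simp only [dirDer_mul_X, ← hp, mul_add, Finset.sum_add_distrib, Finset.sum_mul,
      Finset.mul_sum]
    congr 1 <;> exact Finset.sum_congr rfl fun i _ => by ring

theorem dirDer_smul (P : ℕ → ℂ) (q : MvPolynomial ℕ ℂ) (c : ℂ) (v : ℕ → ℂ) :
    dirDer P q (fun m => c * v m) = c * dirDer P q v := by
  simpa using (dirDer_sum {()} P q (fun _ => c) fun _ => v).symm

theorem dirDer_add_right (P : ℕ → ℂ) (q : MvPolynomial ℕ ℂ) (v w : ℕ → ℂ) :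
    dirDer P q (fun m => v m + w m) = dirDer P q v + dirDer P q w := by
  induction q using MvPolynomial.induction_on with
  | C c => simp
  | add p q hp hq => simp only [dirDer_add, hp, hq]; ring
  | mul_X p m hp => simp only [dirDer_mul_X, hp]; ring

theorem aeval_loopDer (P : ℕ → ℂ) (k : ℕ) (q : MvPolynomial ℕ ℂ) :
    MvPolynomial.aeval P (loopDer k q) = dirDer P q (fun m => m * P (k + m - 1)) := by
  induction q using MvPolynomial.induction_on with
  | C c => simp [loopDer]
  | add p q hp hq => rw [map_add, map_add, hp, hq, dirDer_add]
  | mul_X p m hp =>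
    rw [dirDer_mul_X, ← hp, Derivation.leibniz, map_add]
    simp [loopDer]
    ring

theorem hasDerivAt_aeval {P : ℝ → ℕ → ℂ} {v : ℕ → ℂ} {x : ℝ}
    (h : ∀ m, HasDerivAt (fun t => P t m) (v m) x) (q : MvPolynomial ℕ ℂ) :
    HasDerivAt (fun t => MvPolynomial.aeval (P t) q) (dirDer (P x) q v) x := by
  induction q using MvPolynomial.induction_on with
  | C c => simpa using hasDerivAt_const x c
  | add p q hp hq => simpa using hp.fun_add hq
  | mul_X p m hp => simpa using hp.fun_mul (h m)

theorem ExpBdd.dirDer {W : Type} [NormedAddCommGroup W] {P v : W → ℕ → ℂ}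
    (hP : ∀ m, ExpBdd (fun x => P x m)) (hv : ∀ m, ExpBdd (fun x => v x m))
    (q : MvPolynomial ℕ ℂ) : ExpBdd (fun x => dirDer (P x) q (v x)) := by
  induction q using MvPolynomial.induction_on with
  | C c => simpa using ExpBdd.const 0
  | add p q hp hq => simpa using hp.add hq
  | mul_X p m hp => simpa using (hp.mul (hP m)).add ((ExpBdd.aeval hP p).mul (hv m))

/-- The functional `q ↦ ∫ D q(P) e^{-Q}` on polynomials in the power sums. -/
def gaussMoment {W : Type} [MeasurableSpace W] (μ : Measure W) (D : W → ℂ) (P : W → ℕ → ℂ)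
    (Q : W → ℝ)
    (h : ∀ q : MvPolynomial ℕ ℂ, Integrable (fun x => D x * MvPolynomial.aeval (P x) q * (Real.exp (-Q x) : ℂ)) μ) :
    MvPolynomial ℕ ℂ →ₗ[ℂ] ℂ where
  toFun q := ∫ x, D x * MvPolynomial.aeval (P x) q * (Real.exp (-Q x) : ℂ) ∂μ
  map_add' p q := by
    rw [← integral_add (h p) (h q)]
    congr 1; funext x; rw [map_add]; ring
  map_smul' c q := by
    rw [RingHom.id_apply, smul_eq_mul, ← integral_const_mul]
    congr 1; funext x; rw [map_smul, smul_eq_mul]; ring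

theorem gaussMoment_apply {W : Type} [MeasurableSpace W] (μ : Measure W) (D : W → ℂ)
    (P : W → ℕ → ℂ) (Q : W → ℝ) (h) (q : MvPolynomial ℕ ℂ) : gaussMoment μ D P Q h q =
      ∫ x, D x * MvPolynomial.aeval (P x) q * (Real.exp (-Q x) : ℂ) ∂μ := rfl

/-! ### Loop equations for a linear space of Hermitian matrices -/

theorem hasDerivAt_matrix_pow {ι : Type} [Fintype ι] [DecidableEq ι] (A B : Matrix ι ι ℂ) (k : ℕ) :
    ∀ i j, HasDerivAt (fun t : ℝ => ((A + t • B) ^ k) i j)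
      ((∑ a ∈ Finset.range k, A ^ a * B * A ^ (k - 1 - a)) i j) 0 := by
  induction k with
  | zero => intro i j; simpa using hasDerivAt_const _ _
  | succ k ih =>
    intro i j
    simp_rw [pow_succ, Matrix.mul_apply]
    have h1 : ∀ l, HasDerivAt (fun t : ℝ => (A + t • B) l j) (B l j) 0 := by
      intro l
      have : HasDerivAt (fun t : ℝ => A l j + (t : ℂ) * B l j) (B l j) 0 := by
        simpa using ((Complex.ofRealCLM.hasDerivAt (x := 0)).mul_const (B l j)).const_add (A l j)
      simpa using this
    have h2 := HasDerivAt.fun_sum (u := (Finset.univ : Finset ι)) fun l _ => (ih i l).fun_mul (h1 l)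
    refine h2.congr_deriv ?_
    simp only [zero_smul, add_zero]
    rw [Finset.sum_add_distrib, ← Matrix.mul_apply, ← Matrix.mul_apply, Finset.sum_range_succ,
      Finset.sum_mul, Matrix.add_apply]
    refine congrArg₂ (· + ·) (congrFun (congrFun (Finset.sum_congr rfl fun a ha => ?_) i) j)
      (by simp)
    have ha' := Finset.mem_range.1 ha
    rw [Matrix.mul_assoc, ← pow_succ, show k - 1 - a + 1 = k + 1 - 1 - a by omega]

theorem hasDerivAt_trace_pow {ι : Type} [Fintype ι] [DecidableEq ι] (A B : Matrix ι ι ℂ) (k : ℕ) :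
    HasDerivAt (fun t : ℝ => ((A + t • B) ^ k).trace) (k * (A ^ (k - 1) * B).trace) 0 := by
  have h := HasDerivAt.fun_sum (u := (Finset.univ : Finset ι)) fun i _ => hasDerivAt_matrix_pow A B k i i
  refine h.congr_deriv ?_
  symm
  change _ = Matrix.trace (∑ a ∈ Finset.range k, A ^ a * B * A ^ (k - 1 - a))
  rw [Matrix.trace_sum]
  have : ∀ a ∈ Finset.range k, (A ^ a * B * A ^ (k - 1 - a)).trace = (A ^ (k - 1) * B).trace := by
    intro a ha
    have ha' := Finset.mem_range.1 ha
    rw [Matrix.trace_mul_comm, ← mul_assoc, ← pow_add, show k - 1 - a + a = k - 1 by omega]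
  rw [Finset.sum_congr rfl this]
  simp

section MatrixModel

variable {W ι : Type} [NormedAddCommGroup W] [NormedSpace ℝ W] [FiniteDimensional ℝ W]
  [Fintype ι] [DecidableEq ι]

theorem expBdd_entry (X : W →ₗ[ℝ] Matrix ι ι ℂ) (i j : ι) : ExpBdd (fun c => X c i j) :=
  ExpBdd.of_linear ((Matrix.entryLinearMap ℝ ℂ i j).comp X)

theorem expBdd_trace_pow (X : W →ₗ[ℝ] Matrix ι ι ℂ) (m : ℕ) :
    ExpBdd (fun c => ((X c) ^ m).trace) :=
  ExpBdd.sum _ fun i _ => ExpBdd.matrix_pow (expBdd_entry X) m i i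

theorem expBdd_mul_apply {A B : W → Matrix ι ι ℂ} (hA : ∀ i j, ExpBdd fun c => A c i j)
    (hB : ∀ i j, ExpBdd fun c => B c i j) (i j : ι) : ExpBdd fun c => (A c * B c) i j := by
  simp_rw [Matrix.mul_apply]
  exact ExpBdd.sum _ fun l _ => (hA i l).mul (hB l j)

variable [MeasurableSpace W] [BorelSpace W] (μ : Measure W) [μ.IsAddHaarMeasure]

/-- The integrand of the loop equation of a matrix model, in the direction `E`. -/
def loopIntegrand (X : W →ₗ[ℝ] Matrix ι ι ℂ) (d : ℕ) (k : ℕ) (q : MvPolynomial ℕ ℂ)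
    (E : Matrix ι ι ℂ) (i j : ι) (c : W) : ℂ :=
  (∑ a ∈ Finset.range k, X c ^ a * E * X c ^ (k - 1 - a)) i j *
      MvPolynomial.aeval (fun m => ((X c) ^ m).trace) q +
    (X c ^ k) i j * dirDer (fun m => ((X c) ^ m).trace) q (fun m => m * (X c ^ (m - 1) * E).trace) -
    (X c ^ k) i j * MvPolynomial.aeval (fun m => ((X c) ^ m).trace) q *
      ((2 / d : ℂ) * (X c * E).trace)

theorem expBdd_loopIntegrand (X : W →ₗ[ℝ] Matrix ι ι ℂ) (d k : ℕ) (q : MvPolynomial ℕ ℂ)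
    (E : Matrix ι ι ℂ) (i j : ι) : ExpBdd (loopIntegrand X d k q E i j) := by
  have hp := ExpBdd.matrix_pow (expBdd_entry X)
  have hE : ∀ i j, ExpBdd (fun _ : W => E i j) := fun i j => ExpBdd.const _
  have ht := expBdd_trace_pow X
  have hq := ExpBdd.aeval (P := fun c m => ((X c) ^ m).trace) ht q
  refine ExpBdd.sub (ExpBdd.add (ExpBdd.mul ?_ hq) ((hp k i j).mul
    (ExpBdd.dirDer ht (fun m => (ExpBdd.const _).mul ?_) q))) (((hp k i j).mul hq).mul
      ((ExpBdd.const _).mul ?_))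
  · simp_rw [Matrix.sum_apply]
    exact ExpBdd.sum _ fun a _ => expBdd_mul_apply (expBdd_mul_apply (hp _) hE) (hp _) i j
  · exact ExpBdd.sum _ fun l _ => expBdd_mul_apply (hp _) hE l l
  · exact ExpBdd.sum _ fun l _ => expBdd_mul_apply (expBdd_entry X) hE l l

theorem loopIntegrand_add (X : W →ₗ[ℝ] Matrix ι ι ℂ) (d k : ℕ) (q : MvPolynomial ℕ ℂ)
    (E F : Matrix ι ι ℂ) (i j : ι) (c : W) : loopIntegrand X d k q (E + F) i j c =
      loopIntegrand X d k q E i j c + loopIntegrand X d k q F i j c := by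
  simp only [loopIntegrand, mul_add, add_mul, Finset.sum_add_distrib, Matrix.add_apply,
    Matrix.trace_add, dirDer_add_right]
  ring

theorem loopIntegrand_smul (X : W →ₗ[ℝ] Matrix ι ι ℂ) (d k : ℕ) (q : MvPolynomial ℕ ℂ)
    (E : Matrix ι ι ℂ) (s : ℂ) (i j : ι) (c : W) : loopIntegrand X d k q (s • E) i j c =
      s * loopIntegrand X d k q E i j c := by
  have h : (fun m : ℕ => (m : ℂ) * (s * (X c ^ (m - 1) * E).trace)) =
      fun m : ℕ => s * ((m : ℂ) * (X c ^ (m - 1) * E).trace) := by funext m; ring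
  simp only [loopIntegrand, Matrix.mul_smul, Matrix.smul_mul, ← Finset.smul_sum, Matrix.smul_apply,
    Matrix.trace_smul, smul_eq_mul, h, dirDer_smul]
  ring

/-- For a direction in the range of `X` this is integration by parts for `(Xᵏ)ᵢⱼ q` against
`e^{-Q}`. The integrand is complex linear in the direction, so the identity extends to the complex
span, where the matrices `E i j` of the loop equations live although they need not be Hermitian. -/
theorem integral_loopIntegrand (X : W →ₗ[ℝ] Matrix ι ι ℂ) (d k : ℕ)
    {Q : W → ℝ} (hQ : ∀ c, (Q c : ℂ) = (1 / d : ℂ) * ((X c) ^ 2).trace)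
    {δ : ℝ} (hδ : 0 < δ) (h : ∀ x, δ * ‖x‖ ^ 2 ≤ Q x) (q : MvPolynomial ℕ ℂ)
    {E : Matrix ι ι ℂ} (hE : E ∈ Submodule.span ℂ (Set.range X)) (i j : ι) :
    ∫ c, loopIntegrand X d k q E i j c * (Real.exp (-Q c) : ℂ) ∂μ = 0 := by
  have hQc : Continuous Q := by
    have h1 : Continuous fun c => (1 / d : ℂ) * ((X c) ^ 2).trace :=
      continuous_const.mul (expBdd_trace_pow X 2).1
    have h2 : Q = fun c => ((1 / d : ℂ) * ((X c) ^ 2).trace).re := by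
      funext c; rw [← hQ, Complex.ofReal_re]
    rw [h2]; exact Complex.continuous_re.comp h1
  have hint : ∀ E, Integrable (fun c => loopIntegrand X d k q E i j c * (Real.exp (-Q c) : ℂ)) μ :=
    fun E => (expBdd_loopIntegrand X d k q E i j).integrable_mul_gauss μ hQc hδ h
  induction hE using Submodule.span_induction with
  | mem E hE =>
    obtain ⟨H, rfl⟩ := hE
    have hp := ExpBdd.matrix_pow (expBdd_entry X)
    have hE : ∀ i j, ExpBdd (fun _ : W => X H i j) := fun i j => ExpBdd.const _
    have ht := expBdd_trace_pow X
    have hq := ExpBdd.aeval (P := fun c m => ((X c) ^ m).trace) ht q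
    refine integral_lineDeriv_gauss μ (φ := fun c => (X c ^ k) i j *
      MvPolynomial.aeval (fun m => ((X c) ^ m).trace) q)
      (Q' := fun c => (2 / d : ℂ) * (X c * X H).trace) ((hp k i j).mul hq)
      (ExpBdd.add (ExpBdd.mul ?_ hq) ((hp k i j).mul
        (ExpBdd.dirDer ht (fun m => (ExpBdd.const _).mul ?_) q))) hQc
      ((ExpBdd.const _).mul ?_) hδ h H ?_ ?_
    · simp_rw [Matrix.sum_apply]
      exact ExpBdd.sum _ fun a _ => expBdd_mul_apply (expBdd_mul_apply (hp _) hE) (hp _) i j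
    · exact ExpBdd.sum _ fun l _ => expBdd_mul_apply (hp _) hE l l
    · exact ExpBdd.sum _ fun l _ => expBdd_mul_apply (expBdd_entry X) hE l l
    · intro c
      have h1 := hasDerivAt_aeval (fun m => hasDerivAt_trace_pow (X c) (X H) m) q
      have h2 := (hasDerivAt_matrix_pow (X c) (X H) k i j).fun_mul h1
      simp only [zero_smul, add_zero] at h2
      simpa only [HasLineDerivAt, map_add, map_smul] using h2
    · intro c
      simp_rw [hQ]
      have h1 := (hasDerivAt_trace_pow (X c) (X H) 2).const_mul (1 / d : ℂ)
      have e : (1 / d : ℂ) * (((2 : ℕ) : ℂ) * (X c ^ (2 - 1) * X H).trace) =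
          (2 / d : ℂ) * (X c * X H).trace := by
        simp; ring
      rw [e] at h1
      simpa only [HasLineDerivAt, map_add, map_smul] using h1
  | zero =>
    have : ∀ c, loopIntegrand X d k q 0 i j c = 0 := fun c => by
      simpa using loopIntegrand_smul X d k q 0 0 i j c
    simp [this]
  | add E F _ _ h1 h2 =>
    simp_rw [loopIntegrand_add, add_mul]
    rw [integral_add (hint E) (hint F), h1, h2, add_zero]
  | smul s E _ h1 =>
    simp_rw [loopIntegrand_smul, mul_assoc]
    rw [integral_const_mul, h1, mul_zero]

/-- Summing the integrations by parts over `(i, j)` amounts to using the vector field `∑ (Xᵏ)ᵢⱼ E i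
j`, which is `d Xᵏ` in both applications. `hE1` computes its divergence, the correction `d - 1`
being the effect of self-duality; `hE2` gives its action on traces and on `Q`. -/
theorem isLoop_matrix (X : W →ₗ[ℝ] Matrix ι ι ℂ) {d : ℕ} (hd : 0 < d)
    {Q : W → ℝ} (hQ : ∀ c, (Q c : ℂ) = (1 / d : ℂ) * ((X c) ^ 2).trace)
    {δ : ℝ} (hδ : 0 < δ) (h : ∀ x, δ * ‖x‖ ^ 2 ≤ Q x) (hQc : Continuous Q)
    (E : ι → ι → Matrix ι ι ℂ) (hE : ∀ i j, E i j ∈ Submodule.span ℂ (Set.range X))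
    (hE1 : ∀ c a b, ∑ i, ∑ j, (X c ^ a * E i j * X c ^ b) i j =
      (X c ^ a).trace * (X c ^ b).trace - (d - 1 : ℂ) * (X c ^ (a + b)).trace)
    (hE2 : ∀ c a b, ∑ i, ∑ j, (X c ^ a) i j * (X c ^ b * E i j).trace =
      d * (X c ^ (a + b)).trace) (hint) :
    IsLoop (d - 1) d (Fintype.card ι)
      (gaussMoment μ (fun _ => 1) (fun c m => ((X c) ^ m).trace) Q hint) := by
  constructor
  · intro q
    simp only [gaussMoment_apply, map_mul, MvPolynomial.aeval_X, pow_zero, Matrix.trace_one]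
    rw [← integral_const_mul]
    congr 1; funext c; ring
  · intro k q
    have h0 : ∫ c, (∑ i, ∑ j, loopIntegrand X d k q (E i j) i j c * (Real.exp (-Q c) : ℂ)) ∂μ
        = 0 := by
      have hI : ∀ i j, Integrable
          (fun c => loopIntegrand X d k q (E i j) i j c * (Real.exp (-Q c) : ℂ)) μ :=
        fun i j => (expBdd_loopIntegrand X d k q _ i j).integrable_mul_gauss μ hQc hδ h
      rw [integral_finsetSum _ fun i _ => integrable_finsetSum _ fun j _ => hI i j]
      refine Finset.sum_eq_zero fun i _ => ?_
      rw [integral_finsetSum _ fun j _ => hI i j]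
      exact Finset.sum_eq_zero fun j _ => integral_loopIntegrand μ X d k hQ hδ h q (hE i j) i j
    have hd' : (d : ℂ) ≠ 0 := by exact_mod_cast hd.ne'
    -- Pointwise, the three parts of the integrand give the double sum of traces, the term with
    -- `loopDer` and the term with `X (k + 1)`.
    have hpt : ∀ c, ∑ i, ∑ j, loopIntegrand X d k q (E i j) i j c =
        MvPolynomial.aeval (fun m => ((X c) ^ m).trace)
          ((∑ a ∈ Finset.range k, (MvPolynomial.X a * MvPolynomial.X (k - 1 - a) -
            (d - 1 : ℂ) • MvPolynomial.X (k - 1))) * q + (d : ℂ) • loopDer k q -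
              (2 : ℂ) • (MvPolynomial.X (k + 1) * q)) := by
      intro c
      simp only [loopIntegrand, Finset.sum_add_distrib, Finset.sum_sub_distrib, ← Finset.sum_mul,
        map_add, map_sub, map_mul, map_smul, map_sum, MvPolynomial.aeval_X, aeval_loopDer]
      congr 2
      · congr 1
        simp only [Matrix.sum_apply]
        calc _ = ∑ a ∈ Finset.range k, ∑ i, ∑ j, (X c ^ a * E i j * X c ^ (k - 1 - a)) i j := by
              rw [Finset.sum_congr rfl fun i _ => Finset.sum_comm, Finset.sum_comm]
          _ = _ := by
              rw [← Finset.sum_sub_distrib]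
              refine Finset.sum_congr rfl fun a ha => ?_
              have ha' := Finset.mem_range.1 ha
              rw [hE1, show a + (k - 1 - a) = k - 1 by omega, smul_eq_mul]
      · rw [← Fintype.sum_prod_type', dirDer_sum, smul_eq_mul, ← dirDer_smul]
        congr 1
        funext m
        rw [Fintype.sum_prod_type]
        rcases m with _ | m
        · simp
        · rw [Nat.add_sub_cancel, show k + (m + 1) - 1 = k + m by omega]
          have := congrArg (fun x => ((m + 1 : ℕ) : ℂ) * x) (hE2 c k m)
          simp only [Finset.mul_sum] at this
          rw [← mul_assoc, mul_comm (d : ℂ), mul_assoc, ← this]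
          exact Finset.sum_congr rfl fun i _ => Finset.sum_congr rfl fun j _ => by ring
      · have h2 := hE2 c k 1
        simp only [pow_one] at h2
        have h3 : ∀ i j, (X c ^ k) i j * MvPolynomial.aeval (fun m => ((X c) ^ m).trace) q *
            ((2 / d : ℂ) * (X c * E i j).trace) = ((X c ^ k) i j * (X c * E i j).trace) *
              (2 / d * MvPolynomial.aeval (fun m => ((X c) ^ m).trace) q) := fun i j => by ring
        simp_rw [h3, ← Finset.sum_mul, h2]
        rw [smul_eq_mul]
        field_simp
    simp_rw [← Finset.sum_mul, hpt] at h0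
    have h1 : gaussMoment μ (fun _ => 1) (fun c m => ((X c) ^ m).trace) Q hint
        ((∑ a ∈ Finset.range k, (MvPolynomial.X a * MvPolynomial.X (k - 1 - a) -
            (d - 1 : ℂ) • MvPolynomial.X (k - 1))) * q + (d : ℂ) • loopDer k q -
              (2 : ℂ) • (MvPolynomial.X (k + 1) * q)) = 0 := by
      rw [gaussMoment_apply]
      simpa only [one_mul] using h0
    rw [map_sub, map_add, map_smul, map_smul, smul_eq_mul, smul_eq_mul] at h1
    linear_combination -h1

end MatrixModel

/-! ### Loop equations for the eigenvalue ensembles -/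

theorem sum_above {n : ℕ} (h : Fin n → Fin n → ℂ) (hs : ∀ i j, h i j = h j i) :
    2 * ∑ p : Above n, h p.1.1 p.1.2 = (∑ i, ∑ j, h i j) - ∑ i, h i i := by
  have e1 : ∑ p : Above n, h p.1.1 p.1.2 = ∑ i, ∑ j, if i < j then h i j else 0 := by
    rw [← Fintype.sum_prod_type' (f := fun i j => if i < j then h i j else 0),
      ← Finset.sum_filter, Finset.sum_subtype (p := fun p : Fin n × Fin n => p.1 < p.2)]
    intro x; simp
  have e2 : ∑ i, ∑ j, (if i < j then h i j else 0) = ∑ i, ∑ j, if j < i then h i j else 0 := by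
    rw [Finset.sum_comm]
    exact Finset.sum_congr rfl fun i _ => Finset.sum_congr rfl fun j _ => by rw [hs]
  have e3 : ∑ i, h i i = ∑ i, ∑ j, if i = j then h i j else 0 := by simp
  rw [two_mul, e1]
  conv_lhs => rw [e2]
  nth_rewrite 2 [← e2]
  rw [e3, ← Finset.sum_sub_distrib, ← Finset.sum_add_distrib]
  refine Finset.sum_congr rfl fun i _ => ?_
  rw [← Finset.sum_sub_distrib, ← Finset.sum_add_distrib]
  refine Finset.sum_congr rfl fun j _ => ?_
  rcases lt_trichotomy i j with h' | h' | h'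
  · simp [h', h'.not_gt, h'.ne]
  · simp [h']
  · simp [h', h'.not_gt, h'.ne']

theorem expBdd_coord {n : ℕ} (i : Fin n) : ExpBdd (fun z : Fin n → ℝ => (z i : ℂ)) := by
  refine ⟨by fun_prop, 1, 1, zero_le_one, zero_le_one, fun z => ?_⟩
  rw [Complex.norm_real, one_mul, one_mul]
  exact (norm_le_pi_norm z i).trans (by linarith [Real.add_one_le_exp ‖z‖])

theorem expBdd_vandermonde (n : ℕ) : ExpBdd (fun z : Fin n → ℝ => (vandermonde z : ℂ)) := by
  unfold vandermonde
  push_cast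
  exact ExpBdd.prod _ fun p _ => (expBdd_coord _).sub (expBdd_coord _)

theorem expBdd_powSum (n m : ℕ) : ExpBdd (fun z : Fin n → ℝ => powSum z m) := by
  exact ExpBdd.sum _ fun i _ => (expBdd_coord i).pow m

theorem norm_sq_le_sum_sq {n : ℕ} (z : Fin n → ℝ) : 1 * ‖z‖ ^ 2 ≤ ∑ i, z i ^ 2 := by
  have hS : 0 ≤ ∑ i, z i ^ 2 := Finset.sum_nonneg fun i _ => sq_nonneg _
  rw [one_mul]
  have : ‖z‖ ≤ √(∑ i, z i ^ 2) := by
    refine (pi_norm_le_iff_of_nonneg (Real.sqrt_nonneg _)).2 fun i => ?_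
    rw [Real.norm_eq_abs]
    exact Real.abs_le_sqrt (Finset.single_le_sum (f := fun i => z i ^ 2)
      (fun i _ => sq_nonneg _) (Finset.mem_univ i))
  calc ‖z‖ ^ 2 ≤ √(∑ i, z i ^ 2) ^ 2 := by gcongr
    _ = _ := Real.sq_sqrt hS

theorem integrable_vandermonde_gauss (n d : ℕ) {φ : (Fin n → ℝ) → ℂ} (hφ : ExpBdd φ) :
    Integrable (fun z : Fin n → ℝ => (vandermonde z : ℂ) ^ d * φ z *
      (Real.exp (-∑ i, z i ^ 2) : ℂ)) :=
  (((expBdd_vandermonde n).pow d).mul hφ).integrable_mul_gauss volume (by fun_prop) zero_lt_one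
    norm_sq_le_sum_sq

theorem expBdd_mul_powSum (n d : ℕ) (q : MvPolynomial ℕ ℂ) :
    ExpBdd (fun z : Fin n → ℝ => MvPolynomial.aeval (fun m => (d : ℂ) * powSum z m) q) :=
  ExpBdd.aeval (P := fun z m => (d : ℂ) * powSum z m)
    (fun m => (ExpBdd.const _).mul (expBdd_powSum n m)) q

theorem hasDerivAt_coord {n : ℕ} (z : Fin n → ℝ) (i j : Fin n) :
    HasDerivAt (fun t : ℝ => (((z + t • (Pi.single i (1 : ℝ) : Fin n → ℝ)) j : ℝ) : ℂ))
      ((Pi.single i (1 : ℂ) : Fin n → ℂ) j) 0 := by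
  have h : HasDerivAt (fun t : ℝ => (z j : ℂ) + (t : ℂ) * (Pi.single i (1 : ℂ) : Fin n → ℂ) j)
      ((Pi.single i (1 : ℂ) : Fin n → ℂ) j) 0 := by
    simpa using ((Complex.ofRealCLM.hasDerivAt (x := 0)).mul_const
      ((Pi.single i (1 : ℂ) : Fin n → ℂ) j)).const_add (z j : ℂ)
  convert h using 2 with t
  rcases eq_or_ne j i with rfl | hij
  · simp
  · simp [hij]

/-- The derivative of the Vandermonde product in the direction of the `i`-th coordinate. -/
def vandermondeDer {n : ℕ} (z : Fin n → ℝ) (i : Fin n) : ℂ :=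
  ∑ p : Above n, (∏ r ∈ Finset.univ.erase p, ((z r.1.1 : ℂ) - z r.1.2)) *
    ((Pi.single i (1 : ℂ) : Fin n → ℂ) p.1.1 - (Pi.single i (1 : ℂ) : Fin n → ℂ) p.1.2)

theorem hasDerivAt_vandermonde {n : ℕ} (z : Fin n → ℝ) (i : Fin n) :
    HasDerivAt (fun t : ℝ => (vandermonde (z + t • (Pi.single i (1 : ℝ) : Fin n → ℝ)) : ℂ))
      (vandermondeDer z i) 0 := by
  have h := HasDerivAt.fun_finsetProd (u := (Finset.univ : Finset (Above n))) (x := (0 : ℝ))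
    fun p _ => (hasDerivAt_coord z i p.1.1).fun_sub (hasDerivAt_coord z i p.1.2)
  unfold vandermonde
  push_cast
  refine h.congr_deriv ?_
  simp [vandermondeDer]

/-- The field `∑ zᵢᵏ ∂ᵢ` multiplies the factor `z_p - z_q` by `(z_pᵏ - z_qᵏ) / (z_p - z_q)`, a sum
of monomials symmetric in both variables. Completing the sum over pairs to all index pairs adds the
diagonal, which is subtracted as `k p_{k-1}`. -/
theorem sum_mul_vandermondeDer {n : ℕ} (z : Fin n → ℝ) (k : ℕ) :
    2 * ∑ i, (z i : ℂ) ^ k * vandermondeDer z i = vandermonde z *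
      ((∑ a ∈ Finset.range k, powSum z a * powSum z (k - 1 - a)) - k * powSum z (k - 1)) := by
  have h1 : ∑ i, (z i : ℂ) ^ k * vandermondeDer z i =
      vandermonde z * ∑ p : Above n, ∑ a ∈ Finset.range k,
        (z p.1.1 : ℂ) ^ a * (z p.1.2 : ℂ) ^ (k - 1 - a) := by
    simp only [vandermondeDer, Finset.mul_sum]
    rw [Finset.sum_comm]
    refine Finset.sum_congr rfl fun p _ => ?_
    have h2 : ∑ i, (z i : ℂ) ^ k * ((∏ r ∈ Finset.univ.erase p, ((z r.1.1 : ℂ) - z r.1.2)) *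
        ((Pi.single i (1 : ℂ) : Fin n → ℂ) p.1.1 - (Pi.single i (1 : ℂ) : Fin n → ℂ) p.1.2)) =
        (∏ r ∈ Finset.univ.erase p, ((z r.1.1 : ℂ) - z r.1.2)) *
          ((z p.1.1 : ℂ) ^ k - (z p.1.2 : ℂ) ^ k) := by
      simp only [Pi.single_apply, mul_sub, Finset.sum_sub_distrib]
      simp [mul_comm]
    rw [h2, ← Finset.mul_sum, ← (Commute.all (z p.1.1 : ℂ) (z p.1.2 : ℂ)).geom_sum₂_mul]
    have h3 : (vandermonde z : ℂ) = (∏ r ∈ Finset.univ.erase p, ((z r.1.1 : ℂ) - z r.1.2)) *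
        ((z p.1.1 : ℂ) - z p.1.2) := by
      unfold vandermonde
      push_cast
      exact (Finset.prod_erase_mul _ _ (Finset.mem_univ p)).symm
    rw [h3]; ring
  rw [h1, mul_left_comm, sum_above fun i j => ∑ a ∈ Finset.range k, (z i : ℂ) ^ a * (z j : ℂ) ^ (k - 1 - a)]
  · congr 2
    · calc _ = ∑ a ∈ Finset.range k, ∑ i, ∑ j, (z i : ℂ) ^ a * (z j : ℂ) ^ (k - 1 - a) := by
            rw [Finset.sum_congr rfl fun i _ => Finset.sum_comm, Finset.sum_comm]
        _ = _ := by
            refine Finset.sum_congr rfl fun a _ => ?_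
            rw [powSum, powSum, Finset.sum_mul_sum]
    · rw [powSum, Finset.mul_sum]
      refine Finset.sum_congr rfl fun i _ => ?_
      rw [Finset.sum_congr rfl fun a ha => by
        have ha' := Finset.mem_range.1 ha
        rw [← pow_add, show a + (k - 1 - a) = k - 1 by omega]]
      simp
  · intro i j
    rw [← Finset.sum_range_reflect]
    refine Finset.sum_congr rfl fun a ha => ?_
    have ha' := Finset.mem_range.1 ha
    rw [mul_comm, show k - 1 - (k - 1 - a) = a by omega]

/-- Integration by parts along `∑ zᵢᵏ ∂ᵢ`. The power sums carry a factor `d` because each eigenvalue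
has multiplicity `d`. The constants agree with those of `isLoop_matrix` exactly for the exponent `2
* d`, which is what singles out this density. -/
theorem isLoop_vandermonde (n : ℕ) {d : ℕ} (hd : 0 < d) :
    IsLoop (d - 1) d (d * n) (gaussMoment (volume : Measure (Fin n → ℝ))
      (fun z => (vandermonde z : ℂ) ^ (2 * d)) (fun z m => (d : ℂ) * powSum z m)
      (fun z => ∑ i, z i ^ 2)
      (fun q => integrable_vandermonde_gauss n (2 * d) (expBdd_mul_powSum n d q))) := by
  have hc := expBdd_coord (n := n)
  constructor
  · intro q
    simp only [gaussMoment_apply, map_mul, MvPolynomial.aeval_X]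
    rw [← integral_const_mul]
    congr 1; funext z; simp [powSum]; ring
  · intro k q
    set P : (Fin n → ℝ) → ℕ → ℂ := fun z m => (d : ℂ) * powSum z m with hP
    set A : (Fin n → ℝ) → ℂ := fun z => MvPolynomial.aeval (P z) q with hA
    have hAe : ExpBdd A := expBdd_mul_powSum n d q
    set v : (Fin n → ℝ) → Fin n → ℕ → ℂ := fun z i m => d * (m * (z i : ℂ) ^ (m - 1)) with hv
    set φ' : Fin n → (Fin n → ℝ) → ℂ := fun i z =>
      (k * (z i : ℂ) ^ (k - 1)) * ((vandermonde z : ℂ) ^ (2 * d) * A z) + (z i : ℂ) ^ k *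
        (((2 * d : ℕ) * (vandermonde z : ℂ) ^ (2 * d - 1) * vandermondeDer z i) * A z +
          (vandermonde z : ℂ) ^ (2 * d) * dirDer (P z) q (v z i)) with hφ'
    have hφe : ∀ i, ExpBdd (φ' i) := by
      intro i
      have hV := expBdd_vandermonde n
      have hVd : ExpBdd (fun z => vandermondeDer z i) :=
        ExpBdd.sum _ fun p _ => (ExpBdd.prod _ fun r _ => (hc _).sub (hc _)).mul (ExpBdd.const _)
      have hdd : ExpBdd (fun z => dirDer (P z) q (v z i)) :=
        ExpBdd.dirDer (fun m => (ExpBdd.const _).mul (expBdd_powSum n m))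
          (fun m => (ExpBdd.const _).mul ((ExpBdd.const _).mul ((hc i).pow _))) q
      exact (((ExpBdd.const _).mul ((hc i).pow _)).mul ((hV.pow _).mul hAe)).add
        (((hc i).pow k).mul (((((ExpBdd.const _).mul (hV.pow _)).mul hVd).mul hAe).add
          ((hV.pow _).mul hdd)))
    have hψe : ∀ i, ExpBdd (fun z : Fin n → ℝ => (z i : ℂ) ^ k * ((vandermonde z : ℂ) ^ (2 * d) * A z)) :=
      fun i => ((hc i).pow k).mul (((expBdd_vandermonde n).pow _).mul hAe)
    have hQe : ∀ i, ExpBdd (fun z : Fin n → ℝ => 2 * (z i : ℂ)) := fun i => (ExpBdd.const _).mul (hc i)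
    have hQc : Continuous fun z : Fin n → ℝ => ∑ i, z i ^ 2 := by fun_prop
    have h0 : ∀ i, ∫ z : Fin n → ℝ, (φ' i z - (z i : ℂ) ^ k * ((vandermonde z : ℂ) ^ (2 * d) * A z) *
        (2 * (z i : ℂ))) * (Real.exp (-∑ i, z i ^ 2) : ℂ) = 0 := by
      intro i
      refine integral_lineDeriv_gauss volume (hψe i) (hφe i) hQc (hQe i) zero_lt_one
        norm_sq_le_sum_sq (Pi.single i 1) ?_ ?_
      · intro z
        have h1 := (hasDerivAt_coord z i i).fun_pow k
        have h2 := (hasDerivAt_vandermonde z i).fun_pow (2 * d)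
        have h3 : ∀ m, HasDerivAt (fun t : ℝ => P (z + t • (Pi.single i (1 : ℝ) : Fin n → ℝ)) m) (v z i m) 0 := by
          intro m
          have h4 := (HasDerivAt.fun_sum (u := (Finset.univ : Finset (Fin n))) fun j _ =>
            (hasDerivAt_coord z i j).fun_pow m).const_mul (d : ℂ)
          refine h4.congr_deriv ?_
          simp [Pi.single_apply, hv]
        have h5 := h1.fun_mul (h2.fun_mul (hasDerivAt_aeval h3 q))
        refine h5.congr_deriv ?_
        simp [hφ', hA]
      · intro z
        have h4 := (HasDerivAt.fun_sum (u := (Finset.univ : Finset (Fin n))) fun j _ =>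
            (hasDerivAt_coord z i j).fun_pow 2)
        have h5 : HasDerivAt (fun t : ℝ => ((∑ j, (z + t • (Pi.single i (1 : ℝ) : Fin n → ℝ)) j ^ 2 : ℝ) : ℂ))
            (2 * (z i : ℂ)) 0 := by
          push_cast
          refine h4.congr_deriv ?_
          simp [Pi.single_apply]
        exact h5
    have hI : ∀ i, Integrable (fun z : Fin n → ℝ => (φ' i z - (z i : ℂ) ^ k *
        ((vandermonde z : ℂ) ^ (2 * d) * A z) * (2 * (z i : ℂ))) *
          (Real.exp (-∑ i, z i ^ 2) : ℂ)) := fun i =>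
      ((hφe i).sub ((hψe i).mul (hQe i))).integrable_mul_gauss volume hQc zero_lt_one
        norm_sq_le_sum_sq
    have h1 : ∫ z : Fin n → ℝ, (∑ i, (φ' i z - (z i : ℂ) ^ k * ((vandermonde z : ℂ) ^ (2 * d) * A z) *
        (2 * (z i : ℂ)))) * (Real.exp (-∑ i, z i ^ 2) : ℂ) = 0 := by
      simp_rw [Finset.sum_mul]
      rw [integral_finsetSum _ fun i _ => hI i]
      exact Finset.sum_eq_zero fun i _ => h0 i
    -- After multiplication by `d`, the divergence term `k p_{k-1}` and the diagonal correction `-d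
    -- k p_{k-1}` from the Vandermonde factor combine into `-(d - 1) k (d p_{k-1})`.
    have hpt : ∀ z : Fin n → ℝ, (d : ℂ) * ∑ i, (φ' i z - (z i : ℂ) ^ k *
        ((vandermonde z : ℂ) ^ (2 * d) * A z) * (2 * (z i : ℂ))) =
        (vandermonde z : ℂ) ^ (2 * d) * MvPolynomial.aeval (P z)
          ((∑ a ∈ Finset.range k, (MvPolynomial.X a * MvPolynomial.X (k - 1 - a) -
            (d - 1 : ℂ) • MvPolynomial.X (k - 1))) * q + (d : ℂ) • loopDer k q -
              (2 : ℂ) • (MvPolynomial.X (k + 1) * q)) := by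
      intro z
      have e1 := sum_mul_vandermondeDer z k
      have e2 : ∑ i, (z i : ℂ) ^ k * dirDer (P z) q (v z i) =
          dirDer (P z) q (fun m => m * P z (k + m - 1)) := by
        rw [dirDer_sum]
        congr 1
        funext m
        rcases m with _ | m
        · simp [hv]
        · simp only [hv, hP, powSum, Finset.mul_sum]
          refine Finset.sum_congr rfl fun i _ => ?_
          rw [Nat.add_sub_cancel, show k + (m + 1) - 1 = k + m by omega, pow_add]
          ring
      have e3 : (vandermonde z : ℂ) ^ (2 * d) =
          (vandermonde z : ℂ) ^ (2 * d - 1) * vandermonde z := by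
        rw [← pow_succ]; congr 1; omega
      have e4 : ∑ i, (φ' i z - (z i : ℂ) ^ k * ((vandermonde z : ℂ) ^ (2 * d) * A z) *
          (2 * (z i : ℂ))) = k * powSum z (k - 1) * ((vandermonde z : ℂ) ^ (2 * d) * A z) +
            (d * (vandermonde z : ℂ) ^ (2 * d - 1) * A z) *
              (2 * ∑ i, (z i : ℂ) ^ k * vandermondeDer z i) +
            (vandermonde z : ℂ) ^ (2 * d) * (∑ i, (z i : ℂ) ^ k * dirDer (P z) q (v z i)) -
            2 * powSum z (k + 1) * ((vandermonde z : ℂ) ^ (2 * d) * A z) := by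
        simp only [hφ', powSum, Finset.mul_sum, Finset.sum_mul, ← Finset.sum_add_distrib,
          ← Finset.sum_sub_distrib]
        refine Finset.sum_congr rfl fun i _ => ?_
        push_cast
        ring
      rw [e4, e1, e2]
      simp only [map_add, map_sub, map_mul, map_smul, map_sum, MvPolynomial.aeval_X, aeval_loopDer,
        smul_eq_mul]
      simp only [Finset.sum_sub_distrib, Finset.sum_const, Finset.card_range, nsmul_eq_mul]
      have e5 : ∑ a ∈ Finset.range k, P z a * P z (k - 1 - a) =
          d ^ 2 * ∑ a ∈ Finset.range k, powSum z a * powSum z (k - 1 - a) := by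
        rw [Finset.mul_sum]
        exact Finset.sum_congr rfl fun a _ => by simp only [hP]; ring
      rw [e5]
      simp only [hP, e3]
      rw [show MvPolynomial.aeval (fun m => (d : ℂ) * powSum z m) q = A z from rfl]
      ring
    have h2 : gaussMoment (volume : Measure (Fin n → ℝ))
      (fun z => (vandermonde z : ℂ) ^ (2 * d)) P (fun z => ∑ i, z i ^ 2)
      (fun q => integrable_vandermonde_gauss n (2 * d) (expBdd_mul_powSum n d q))
        ((∑ a ∈ Finset.range k, (MvPolynomial.X a * MvPolynomial.X (k - 1 - a) -
            (d - 1 : ℂ) • MvPolynomial.X (k - 1))) * q + (d : ℂ) • loopDer k q -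
              (2 : ℂ) • (MvPolynomial.X (k + 1) * q)) = 0 := by
      rw [gaussMoment_apply]
      simp_rw [← hpt, mul_assoc (d : ℂ)]
      rw [integral_const_mul, h1, mul_zero]
    rw [map_sub, map_add, map_smul, map_smul, smul_eq_mul, smul_eq_mul] at h2
    linear_combination -h2

/-! ### Measurability of the ordered eigenvalues -/

/-- A polynomial is determined by its values at infinitely many points, and a sorted tuple by its
multiset of roots. -/
theorem antitone_eq_of_prod_eq {N : ℕ} {v w : Fin N → ℝ} (hv : Antitone v) (hw : Antitone w)
    (h : ∀ m : ℕ, ∏ i, ((m : ℝ) - v i) = ∏ i, ((m : ℝ) - w i)) : v = w := by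
  have hp : ∏ i, (Polynomial.X - Polynomial.C (v i)) = ∏ i, (Polynomial.X - Polynomial.C (w i)) := by
    refine Polynomial.eq_of_infinite_eval_eq _ _
      ((Set.infinite_range_of_injective (Nat.cast_injective (R := ℝ))).mono ?_)
    rintro _ ⟨m, rfl⟩
    simpa [Polynomial.eval_prod] using h m
  have hr : ∀ u : Fin N → ℝ, (∏ i, (Polynomial.X - Polynomial.C (u i))).roots =
      (List.ofFn u : Multiset ℝ) := by
    intro u
    rw [Polynomial.roots_prod _ _ (by simp [Finset.prod_ne_zero_iff, Polynomial.X_sub_C_ne_zero])]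
    simp [Fin.univ_val_map]
  have hl : List.ofFn v = List.ofFn w := by
    refine List.Perm.eq_of_sortedGE hv.sortedGE_ofFn hw.sortedGE_ofFn (Multiset.coe_eq_coe.1 ?_)
    rw [← hr, ← hr, hp]
  exact List.ofFn_inj.1 hl

/-- Sorted tuples form a closed set, hence a standard Borel space. The values of the products at all
naturals are an injective measurable map on it, so a measurable embedding, and measurability can be
tested after composing with it. -/
theorem measurable_of_measurable_prod {Ω : Type} [MeasurableSpace Ω] {N : ℕ} {v : Ω → Fin N → ℝ}
    (hv : ∀ c, Antitone (v c)) (h : ∀ m : ℕ, Measurable fun c => ∏ i, ((m : ℝ) - v c i)) :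
    Measurable v := by
  have hclosed : IsClosed {w : Fin N → ℝ | Antitone w} := by
    simp only [Antitone, Set.ofPred_forall]
    exact isClosed_iInter fun i => isClosed_iInter fun j => isClosed_iInter fun _ =>
      isClosed_le (continuous_apply j) (continuous_apply i)
  have : StandardBorelSpace {w : Fin N → ℝ | Antitone w} := hclosed.measurableSet.standardBorel
  have hT : MeasurableEmbedding (fun (w : {w : Fin N → ℝ | Antitone w}) (m : ℕ) =>
      ∏ i, ((m : ℝ) - w.1 i)) := by
    refine Measurable.measurableEmbedding ?_ ?_
    · refine measurable_pi_lambda _ fun m => Finset.measurable_prod _ fun i _ => ?_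
      exact measurable_const.sub ((measurable_pi_apply i).comp measurable_subtype_coe)
    · intro v w hvw
      exact Subtype.ext (antitone_eq_of_prod_eq v.2 w.2 fun m => congrFun hvw m)
  have h1 : Measurable fun c => (⟨v c, hv c⟩ : {w : Fin N → ℝ | Antitone w}) := by
    rw [← hT.measurable_comp_iff]
    exact measurable_pi_lambda _ h
  exact measurable_subtype_coe.comp h1

/-- The products to be tested are values of the characteristic polynomial, which are polynomial in
the matrix entries. -/
theorem measurable_eigenvalues {Ω ι : Type} [MeasurableSpace Ω] [Fintype ι] [DecidableEq ι]
    {X : Ω → Matrix ι ι ℂ} (hX : ∀ i j, Measurable fun c => X c i j) (hH : ∀ c, (X c).IsHermitian) :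
    Measurable fun c => (hH c).eigenvalues := by
  have h0 : Measurable fun c => (hH c).eigenvalues₀ := by
    refine measurable_of_measurable_prod (fun c => (hH c).eigenvalues₀_antitone) fun m => ?_
    have e : ∀ c, ∏ i, ((m : ℝ) - (hH c).eigenvalues₀ i) =
        ((Matrix.scalar ι (m : ℂ) - X c).det).re := by
      intro c
      rw [← Matrix.eval_charpoly, (hH c).charpoly_eq, Polynomial.eval_prod]
      have : ∀ i, ((m : ℂ) - ((hH c).eigenvalues i : ℂ)) = (((m : ℝ) - (hH c).eigenvalues i : ℝ) : ℂ) :=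
        fun i => by push_cast; rfl
      simp only [Polynomial.eval_sub, Polynomial.eval_X, Polynomial.eval_C]
      erw [Finset.prod_congr rfl fun i _ => this i]
      rw [← Complex.ofReal_prod, Complex.ofReal_re]
      exact (Fintype.prod_equiv (Fintype.equivOfCardEq (Fintype.card_fin _)).symm _ _ fun i => rfl).symm
    simp_rw [e]
    refine Complex.measurable_re.comp ?_
    simp_rw [Matrix.det_apply]
    refine Finset.measurable_sum _ fun σ _ => (Finset.measurable_prod _ fun i _ => ?_).const_smul _
    exact measurable_const.sub (hX _ _)
  exact measurable_pi_lambda _ fun i => (measurable_pi_apply _).comp h0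

theorem trace_pow_eq_powSum {ι : Type} [Fintype ι] [DecidableEq ι] {A : Matrix ι ι ℂ}
    (hA : A.IsHermitian) (m : ℕ) : (A ^ m).trace = powSum hA.eigenvalues m := by
  conv_lhs => rw [hA.spectral_theorem, ← map_pow, Matrix.diagonal_pow]
  rw [Unitary.conjStarAlgAut_apply, Matrix.trace_mul_cycle]
  simp [powSum, Matrix.trace_diagonal]

/-! ### Transfer of integrals of symmetric functions -/

section Model

variable {W ι : Type} [NormedAddCommGroup W] [NormedSpace ℝ W] [FiniteDimensional ℝ W]
  [MeasurableSpace W] [BorelSpace W] (μ : Measure W) [μ.IsAddHaarMeasure] [Fintype ι]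
  [DecidableEq ι]

/-- The law of `y` under the measure with density `D e^{-Q}`. -/
def gaussLaw (D Q : W → ℝ) (y : W → ι → ℝ) : Measure (ι → ℝ) :=
  (μ.withDensity fun c => ENNReal.ofReal (D c * Real.exp (-Q c))).map y

variable {μ} {D Q : W → ℝ} {y : W → ι → ℝ} {δ : ℝ} {d : ℕ}

/-- Half of `Q` is spent on absorbing the exponential moment; the other half still dominates the
growth of `D`. -/
theorem integrable_exp_gaussLaw (hD : ExpBdd fun c => (D c : ℂ))
    (hQc : Continuous Q) (hδ : 0 < δ) (hQ : ∀ x, δ * ‖x‖ ^ 2 ≤ Q x) (hy : Measurable y)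
    (hyQ : ∀ c, ∑ i, y c i ^ 2 = d * Q c) (s : ℝ) :
    Integrable (fun c => Real.exp (s * ∑ i, |y c i|) * (D c * Real.exp (-Q c))) μ := by
  set N : ℝ := Fintype.card ι * d with hN
  have hN0 : 0 ≤ N := by positivity
  -- Cauchy–Schwarz gives `(∑ |yᵢ|)² ≤ N Q`, and then the inequality of the arithmetic and geometric
  -- means applies to `s² N` and `Q`.
  have hb : ∀ c, s * ∑ i, |y c i| ≤ s ^ 2 * N / 2 + Q c / 2 := by
    intro c
    have h1 : (∑ i, |y c i|) ^ 2 ≤ N * Q c := by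
      have := sq_sum_le_card_mul_sum_sq (s := Finset.univ) (f := fun i => |y c i|)
      simp only [sq_abs, hyQ, Finset.card_univ] at this
      rw [hN]; linarith
    have hQ0 : 0 ≤ Q c := le_trans (by positivity) (hQ c)
    have hS : 0 ≤ ∑ i, |y c i| := Finset.sum_nonneg fun i _ => abs_nonneg _
    refine (le_abs_self _).trans (abs_le_of_sq_le_sq ?_ (by positivity))
    rw [mul_pow]
    nlinarith [mul_le_mul_of_nonneg_left h1 (sq_nonneg s), sq_nonneg (s ^ 2 * N / 2 - Q c / 2)]
  obtain ⟨hDc, C, K, hC, hK, hDb⟩ := hD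
  have hDc' : Continuous D := Complex.continuous_re.comp hDc
  have hm : Measurable fun c => Real.exp (s * ∑ i, |y c i|) * (D c * Real.exp (-Q c)) := by
    have h1 : Measurable fun c => ∑ i, |y c i| :=
      Finset.measurable_sum _ fun i _ => ((measurable_pi_apply i).comp hy).abs
    have h2 := hDc'.measurable
    have h3 := hQc.measurable
    fun_prop
  refine integrable_of_norm_le_exp_sub_sq (C := C * Real.exp (s ^ 2 * N / 2)) (K := K) (δ := δ / 2) μ
    hm.aestronglyMeasurable (by positivity) (by positivity) fun c => ?_
  have h1 := hDb c
  rw [Complex.norm_real] at h1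
  rw [norm_mul, norm_mul, Real.norm_of_nonneg (Real.exp_pos _).le,
    Real.norm_of_nonneg (Real.exp_pos _).le]
  calc Real.exp (s * ∑ i, |y c i|) * (‖D c‖ * Real.exp (-Q c)) ≤
      Real.exp (s ^ 2 * N / 2 + Q c / 2) * ((C * Real.exp (K * ‖c‖)) * Real.exp (-Q c)) := by
        gcongr
        exact hb c
    _ = C * Real.exp (s ^ 2 * N / 2) * Real.exp (K * ‖c‖ - Q c / 2) := by
        have : Real.exp (K * ‖c‖ - Q c / 2) = Real.exp (K * ‖c‖) * (Real.exp (Q c / 2) *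
          Real.exp (- Q c)) := by
          rw [← Real.exp_add, ← Real.exp_add]; congr 1; ring
        rw [this, Real.exp_add]; ring
    _ ≤ _ := by
        gcongr
        linarith [hQ c]

theorem isFiniteMeasure_gaussLaw (hD : ExpBdd fun c => (D c : ℂ))
    (hQc : Continuous Q) (hδ : 0 < δ) (hQ : ∀ x, δ * ‖x‖ ^ 2 ≤ Q x) (hy : Measurable y)
    (hyQ : ∀ c, ∑ i, y c i ^ 2 = d * Q c) : IsFiniteMeasure (gaussLaw μ D Q y) := by
  have h := integrable_exp_gaussLaw (μ := μ) hD hQc hδ hQ hy hyQ 0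
  simp only [zero_mul, Real.exp_zero, one_mul] at h
  have := isFiniteMeasure_withDensity_ofReal h.2
  exact Measure.isFiniteMeasure_map _ _

theorem integral_gaussLaw {E : Type} [NormedAddCommGroup E] [NormedSpace ℝ E]
    (hD : ExpBdd fun c => (D c : ℂ)) (hD0 : ∀ c, 0 ≤ D c)
    (hQc : Continuous Q) (hy : Measurable y) {φ : (ι → ℝ) → E} (hφ : Continuous φ) 
    [SecondCountableTopology E] [MeasurableSpace E] [BorelSpace E] :
    ∫ z, φ z ∂(gaussLaw μ D Q y) = ∫ c, (D c * Real.exp (-Q c)) • φ (y c) ∂μ := by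
  have hDc' : Continuous D := Complex.continuous_re.comp hD.1
  rw [gaussLaw, integral_map hy.aemeasurable hφ.measurable.aestronglyMeasurable,
    integral_withDensity_eq_integral_toReal_smul (by fun_prop)
      (ae_of_all _ fun _ => ENNReal.ofReal_lt_top)]
  refine integral_congr_ae (ae_of_all _ fun c => ?_)
  simp only
  rw [ENNReal.toReal_ofReal (mul_nonneg (hD0 c) (Real.exp_pos _).le)]

theorem integrable_gaussLaw (hD : ExpBdd fun c => (D c : ℂ)) (hD0 : ∀ c, 0 ≤ D c)
    (hQc : Continuous Q) (hδ : 0 < δ) (hQ : ∀ x, δ * ‖x‖ ^ 2 ≤ Q x) (hy : Measurable y)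
    (hyQ : ∀ c, ∑ i, y c i ^ 2 = d * Q c) (s : ℝ) :
    Integrable (fun z => Real.exp (s * ∑ i, |z i|)) (gaussLaw μ D Q y) := by
  have hDc' : Continuous D := Complex.continuous_re.comp hD.1
  have hc : Continuous fun z : ι → ℝ => Real.exp (s * ∑ i, |z i|) := by fun_prop
  rw [gaussLaw, integrable_map_measure hc.measurable.aestronglyMeasurable hy.aemeasurable,
    integrable_withDensity_iff_integrable_smul' (by fun_prop)
      (ae_of_all _ fun _ => ENNReal.ofReal_lt_top)]
  refine (integrable_exp_gaussLaw hD hQc hδ hQ hy hyQ s).congr (ae_of_all _ fun c => ?_)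
  simp only [Function.comp_apply]
  rw [ENNReal.toReal_ofReal (mul_nonneg (hD0 c) (Real.exp_pos _).le), smul_eq_mul, mul_comm]

/-- Because `∑ yᵢ² = d Q`, the Gaussian factor is a function of `y` and can be divided out. An
identity between Gaussian laws thereby extends to every nonnegative symmetric integrand. -/
theorem lintegral_gaussLaw (hD : ExpBdd fun c => (D c : ℂ)) (hD0 : ∀ c, 0 ≤ D c)
    (hQc : Continuous Q) (hd : 0 < d) (hy : Measurable y)
    (hyQ : ∀ c, ∑ i, y c i ^ 2 = d * Q c) {G : (ι → ℝ) → ENNReal} (hG : Measurable G) :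
    ∫⁻ z, G z * ENNReal.ofReal (Real.exp ((1 / d) * ∑ i, z i ^ 2)) ∂(gaussLaw μ D Q y) =
      ∫⁻ c, ENNReal.ofReal (D c) * G (y c) ∂μ := by
  have hDc' : Continuous D := Complex.continuous_re.comp hD.1
  have hE : Measurable fun z : ι → ℝ => ENNReal.ofReal (Real.exp ((1 / d) * ∑ i, z i ^ 2)) := by
    fun_prop
  rw [gaussLaw, lintegral_map (f := fun z => G z * ENNReal.ofReal (Real.exp ((1 / d) * ∑ i, z i ^ 2)))
    (hG.mul hE) hy, lintegral_withDensity_eq_lintegral_mul _ (by fun_prop)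
    (g := fun c => G (y c) * ENNReal.ofReal (Real.exp ((1 / d) * ∑ i, y c i ^ 2)))
    ((hG.comp hy).mul (hE.comp hy))]
  refine lintegral_congr fun c => ?_
  simp only [Pi.mul_apply]
  have hd' : (d : ℝ) ≠ 0 := by exact_mod_cast hd.ne'
  rw [hyQ, one_div, inv_mul_cancel_left₀ hd', ENNReal.ofReal_mul (hD0 c), mul_comm (G _), ← mul_assoc,
    mul_assoc (ENNReal.ofReal (D c)), ← ENNReal.ofReal_mul (Real.exp_pos _).le, ← Real.exp_add]
  simp

end Model

/-! ### The Weyl integration formula -/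

theorem IsLoop.sub {α γ N : ℂ} {K L : MvPolynomial ℕ ℂ →ₗ[ℂ] ℂ} (hK : IsLoop α γ N K)
    (hL : IsLoop α γ N L) (x y : ℂ) : IsLoop α γ N (x • K - y • L) := by
  constructor
  · intro q
    simp only [LinearMap.sub_apply, LinearMap.smul_apply, smul_eq_mul, hK.zero, hL.zero]
    ring
  · intro k q
    have h1 := hK.succ k q
    have h2 := hL.succ k q
    simp only [LinearMap.sub_apply, LinearMap.smul_apply, smul_eq_mul]
    linear_combination x * h1 - y * h2

theorem isOpen_vandermonde_ne_zero {E : Set ℝ} (hE : IsOpen E) (n : ℕ) :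
    IsOpen {z : Fin n → ℝ | (∀ i, z i ∈ E) ∧ vandermonde z ≠ 0} := by
  have h1 : IsOpen {z : Fin n → ℝ | ∀ i, z i ∈ E} := by
    have := isOpen_set_pi (i := (Set.univ : Set (Fin n))) (s := fun _ => E) Set.finite_univ
      fun _ _ => hE
    convert this using 1
    ext z; simp
  have h2 : Continuous fun z : Fin n → ℝ => vandermonde z := by
    unfold vandermonde; fun_prop
  exact h1.inter (isOpen_ne.preimage h2)

theorem nonempty_vandermonde_ne_zero {E : Set ℝ} (hE : IsOpen E) (hne : E.Nonempty) (n : ℕ) :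
    {z : Fin n → ℝ | (∀ i, z i ∈ E) ∧ vandermonde z ≠ 0}.Nonempty := by
  have hinf : E.Infinite := infinite_of_mem_nhds hne.some (hE.mem_nhds hne.some_mem)
  refine ⟨fun i => hinf.natEmbedding E i, fun i => (hinf.natEmbedding E i).2, ?_⟩
  refine Finset.prod_ne_zero_iff.2 fun p _ => sub_ne_zero.2 fun h => ?_
  have := (hinf.natEmbedding E).injective (Subtype.ext h)
  exact p.2.ne (Fin.ext this)

/-- An integral against an even power of the Vandermonde determinant is positive. -/
theorem integral_vandermonde_pos {E : Set ℝ} (hE : IsOpen E) (hne : E.Nonempty) (n d : ℕ)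
    {w : (Fin n → ℝ) → ℝ} (hw : ∀ z, 0 ≤ w z) (hw' : ∀ z, (∀ i, z i ∈ E) → 0 < w z)
    (hint : Integrable fun z => vandermonde z ^ (2 * d) * w z) :
    0 < ∫ z, vandermonde z ^ (2 * d) * w z := by
  have hev : Even (2 * d) := even_two_mul d
  rw [integral_pos_iff_support_of_nonneg (fun z => mul_nonneg (hev.pow_nonneg _) (hw z)) hint]
  refine lt_of_lt_of_le ((isOpen_vandermonde_ne_zero hE n).measure_pos volume
    (nonempty_vandermonde_ne_zero hE hne n)) (measure_mono ?_)
  rintro z ⟨hz, hz'⟩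
  exact mul_ne_zero (pow_ne_zero _ hz') (hw' z hz).ne'

theorem integrable_vandermonde_gauss_real (n d : ℕ) :
    Integrable fun z : Fin n → ℝ => vandermonde z ^ d * Real.exp (-∑ i, z i ^ 2) := by
  have h := (integrable_vandermonde_gauss n d (ExpBdd.const 1)).re
  refine h.congr (ae_of_all _ fun z => ?_)
  simp only [mul_one]
  norm_cast

section Weyl

variable {W ι : Type} [NormedAddCommGroup W] [NormedSpace ℝ W] [FiniteDimensional ℝ W]
  [MeasurableSpace W] [BorelSpace W] (μ : Measure W) [μ.IsAddHaarMeasure] [Fintype ι]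
  [DecidableEq ι]

theorem sum_comp_fiber {n d : ℕ} {M : Type} [AddCommMonoid M] (e : ι → Fin n)
    (he : ∀ i, (Finset.univ.filter fun p => e p = i).card = d) (h : Fin n → M) :
    ∑ p, h (e p) = d • ∑ i, h i := by
  rw [← Finset.sum_fiberwise_of_maps_to (s := Finset.univ) (t := Finset.univ) (g := e)
    (fun _ _ => Finset.mem_univ _), Finset.smul_sum]
  refine Finset.sum_congr rfl fun i _ => ?_
  rw [Finset.sum_congr rfl fun p hp => by rw [(Finset.mem_filter.1 hp).2], Finset.sum_const, he]

/-- The Weyl integration formula for symmetric nonnegative functions of the eigenvalues. -/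
theorem weyl_lintegral (X : W →ₗ[ℝ] Matrix ι ι ℂ) (hX : ∀ c, (X c).IsHermitian) {n d : ℕ}
    (hd : 0 < d) (e : ι → Fin n) (he : ∀ i, (Finset.univ.filter fun p => e p = i).card = d)
    {Q : W → ℝ} (hQ : ∀ c, (Q c : ℂ) = (1 / d : ℂ) * ((X c) ^ 2).trace)
    {δ : ℝ} (hδ : 0 < δ) (hQδ : ∀ x, δ * ‖x‖ ^ 2 ≤ Q x)
    (E : ι → ι → Matrix ι ι ℂ) (hE : ∀ i j, E i j ∈ Submodule.span ℂ (Set.range X))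
    (hE1 : ∀ c a b, ∑ i, ∑ j, (X c ^ a * E i j * X c ^ b) i j =
      (X c ^ a).trace * (X c ^ b).trace - (d - 1 : ℂ) * (X c ^ (a + b)).trace)
    (hE2 : ∀ c a b, ∑ i, ∑ j, (X c ^ a) i j * (X c ^ b * E i j).trace =
      d * (X c ^ (a + b)).trace) 
    {G : (ι → ℝ) → ENNReal} (hG : Measurable G)
    (hsym : ∀ (σ : Equiv.Perm ι) z, G (z ∘ σ) = G z) :
    ∫⁻ c, G ((hX c).eigenvalues) ∂((ENNReal.ofReal
      ((∫ z : Fin n → ℝ, vandermonde z ^ (2 * d) * Real.exp (-∑ i, z i ^ 2)) /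
        (∫ c, Real.exp (-Q c) ∂μ))) • μ) =
      ∫⁻ z, ENNReal.ofReal (vandermonde z ^ (2 * d)) * G (z ∘ e) := by
  set Z1 := ∫ c, Real.exp (-Q c) ∂μ with hZ1
  set Z2 := ∫ z : Fin n → ℝ, vandermonde z ^ (2 * d) * Real.exp (-∑ i, z i ^ 2) with hZ2
  have hd' : (d : ℝ) ≠ 0 := by exact_mod_cast hd.ne'
  have hQc : Continuous Q := by
    have h1 : Continuous fun c => (1 / d : ℂ) * ((X c) ^ 2).trace :=
      continuous_const.mul (expBdd_trace_pow X 2).1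
    have h2 : Q = fun c => ((1 / d : ℂ) * ((X c) ^ 2).trace).re := by
      funext c; rw [← hQ, Complex.ofReal_re]
    rw [h2]; exact Complex.continuous_re.comp h1
  have hI1 : Integrable (fun c => Real.exp (-Q c)) μ := by
    have h := ((ExpBdd.const 1).integrable_mul_gauss μ hQc hδ hQδ).re
    refine h.congr (ae_of_all _ fun c => ?_)
    simp only [one_mul]
    exact Complex.ofReal_re _
  have hZ1p : 0 < Z1 := integral_exp_pos hI1
  have hZ2p : 0 < Z2 := integral_vandermonde_pos isOpen_univ Set.univ_nonempty n d
    (fun z => (Real.exp_pos _).le) (fun z _ => Real.exp_pos _)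
    (integrable_vandermonde_gauss_real n (2 * d))
  have hD1 : ExpBdd fun _ : W => ((1 : ℝ) : ℂ) := ExpBdd.const _
  have hD2 : ExpBdd fun z : Fin n → ℝ => ((vandermonde z ^ (2 * d) : ℝ) : ℂ) := by
    push_cast; exact (expBdd_vandermonde n).pow _
  have hD20 : ∀ z : Fin n → ℝ, 0 ≤ vandermonde z ^ (2 * d) :=
    fun z => (even_two_mul d).pow_nonneg _
  have hQ2c : Continuous fun z : Fin n → ℝ => ∑ i, z i ^ 2 := by fun_prop
  have hy1 : Measurable fun c => (hX c).eigenvalues :=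
    measurable_eigenvalues (fun i j => (expBdd_entry X i j).1.measurable) hX
  have hy2 : Measurable fun z : Fin n → ℝ => z ∘ e :=
    measurable_pi_lambda _ fun p => measurable_pi_apply _
  have hyQ1 : ∀ c, ∑ i, (hX c).eigenvalues i ^ 2 = d * Q c := by
    intro c
    have h1 := hQ c
    rw [trace_pow_eq_powSum (hX c)] at h1
    have h2 : Q c = 1 / d * ∑ i, (hX c).eigenvalues i ^ 2 := by
      refine Complex.ofReal_injective (h1.trans ?_)
      rw [powSum]
      push_cast
      rfl
    rw [h2]; field_simp
  have hyQ2 : ∀ z : Fin n → ℝ, ∑ p, (z ∘ e) p ^ 2 = d * ∑ i, z i ^ 2 := by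
    intro z
    rw [← nsmul_eq_mul, ← sum_comp_fiber e he]
    rfl
  have hN : (Fintype.card ι : ℂ) = d * n := by
    have := sum_comp_fiber e he (fun _ => (1 : ℂ))
    simpa using this
  have hint1 : ∀ q : MvPolynomial ℕ ℂ, Integrable (fun c => 1 * MvPolynomial.aeval
      (fun m => ((X c) ^ m).trace) q * (Real.exp (-Q c) : ℂ)) μ := fun q =>
    ((ExpBdd.const 1).mul (ExpBdd.aeval (P := fun c m => ((X c) ^ m).trace)
      (expBdd_trace_pow X) q)).integrable_mul_gauss μ hQc hδ hQδ
  have hL1 := isLoop_matrix μ X hd hQ hδ hQδ hQc E hE hE1 hE2 hint1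
  have hL2 := isLoop_vandermonde n hd
  rw [hN] at hL1
  -- The combination of the two functionals with coefficients `Z2` and `-Z1` satisfies the loop
  -- equations and vanishes at `1`, since their values at `1` are `Z1` and `Z2`.
  have hm : ∀ q : MvPolynomial ℕ ℂ, (Z2 : ℂ) * gaussMoment μ (fun _ => 1)
      (fun c m => ((X c) ^ m).trace) Q hint1 q = (Z1 : ℂ) *
      gaussMoment (volume : Measure (Fin n → ℝ)) (fun z => (vandermonde z : ℂ) ^ (2 * d))
        (fun z m => (d : ℂ) * powSum z m) (fun z => ∑ i, z i ^ 2)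
        (fun q => integrable_vandermonde_gauss n (2 * d) (expBdd_mul_powSum n d q)) q := by
    intro q
    have h := (hL1.sub hL2 Z2 Z1).eq_zero (by
      simp only [LinearMap.sub_apply, LinearMap.smul_apply, smul_eq_mul, gaussMoment_apply, map_one,
        one_mul, mul_one]
      have : ∀ z : Fin n → ℝ, (vandermonde z : ℂ) ^ (2 * d) * (Real.exp (-∑ i, z i ^ 2) : ℂ) =
        ((vandermonde z ^ (2 * d) * Real.exp (-∑ i, z i ^ 2) : ℝ) : ℂ) := fun z => by push_cast; rfl
      simp_rw [this]
      rw [integral_complex_ofReal, integral_complex_ofReal, ← hZ1, ← hZ2]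
      ring)
    have h2 := congrArg (fun K => K q) h
    simpa [sub_eq_zero] using h2
  set μ1 := gaussLaw μ (fun _ => 1) Q (fun c => (hX c).eigenvalues) with hμ1
  set μ2 := gaussLaw (volume : Measure (Fin n → ℝ)) (fun z => vandermonde z ^ (2 * d))
    (fun z => ∑ i, z i ^ 2) (fun z => z ∘ e) with hμ2
  have hf1 : IsFiniteMeasure μ1 := isFiniteMeasure_gaussLaw hD1 hQc hδ hQδ hy1 hyQ1
  have hf2 : IsFiniteMeasure μ2 :=
    isFiniteMeasure_gaussLaw hD2 hQ2c zero_lt_one norm_sq_le_sum_sq hy2 hyQ2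
  have hi1 : ∀ s : ℝ, Integrable (fun z => Real.exp (s * ∑ i, |z i|)) μ1 := fun s =>
    integrable_gaussLaw hD1 (fun _ => zero_le_one) hQc hδ hQδ hy1 hyQ1 s
  have hi2 : ∀ s : ℝ, Integrable (fun z => Real.exp (s * ∑ i, |z i|)) μ2 := fun s =>
    integrable_gaussLaw hD2 hD20 hQ2c zero_lt_one norm_sq_le_sum_sq hy2 hyQ2 s
  have hfs : ∀ (η : Measure (ι → ℝ)) [IsFiniteMeasure η] (x : ℝ),
      IsFiniteMeasure (ENNReal.ofReal x • η) := fun η _ x => by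
    exact Measure.smul_finite _ ENNReal.ofReal_ne_top
  have := hfs μ1 Z2
  have := hfs μ2 Z1
  have hpc : ∀ q : MvPolynomial ℕ ℂ, Continuous fun z : ι → ℝ => MvPolynomial.aeval (powSum z) q := by
    intro q
    induction q using MvPolynomial.induction_on with
    | C c => simpa using continuous_const
    | add p q hp hq => simpa using hp.fun_add hq
    | mul_X p i hp =>
      have : Continuous fun z : ι → ℝ => powSum z i := by unfold powSum; fun_prop
      simpa using hp.fun_mul this
  -- After cross-multiplying by the normalizations, the two laws have equal moments of power sums
  -- and hence equal integrals of symmetric functions.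
  have key : ∀ F : (ι → ℝ) → ENNReal, Measurable F → (∀ (σ : Equiv.Perm ι) z, F (z ∘ σ) = F z) →
      ENNReal.ofReal Z2 * ∫⁻ z, F z ∂μ1 = ENNReal.ofReal Z1 * ∫⁻ z, F z ∂μ2 := by
    intro F hF hFs
    have h := lintegral_symmetric_eq (μ := ENNReal.ofReal Z2 • μ1) (ν := ENNReal.ofReal Z1 • μ2)
      (fun s => (hi1 s).smul_measure ENNReal.ofReal_ne_top)
      (fun s => (hi2 s).smul_measure ENNReal.ofReal_ne_top) ?_ hF hFs
    · simpa only [lintegral_smul_measure, smul_eq_mul] using h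
    · intro q
      have h1 : ∫ z, MvPolynomial.aeval (powSum z) q ∂μ1 = gaussMoment μ (fun _ => 1)
          (fun c m => ((X c) ^ m).trace) Q hint1 q := by
        rw [hμ1, integral_gaussLaw hD1 (fun _ => zero_le_one) hQc hy1 (hpc q), gaussMoment_apply]
        refine integral_congr_ae (ae_of_all _ fun c => ?_)
        have : powSum (hX c).eigenvalues = fun m => ((X c) ^ m).trace := by
          funext m; exact (trace_pow_eq_powSum (hX c) m).symm
        simp only [this, one_mul, Complex.real_smul]
        ring
      have h2 : ∫ z, MvPolynomial.aeval (powSum z) q ∂μ2 =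
          gaussMoment (volume : Measure (Fin n → ℝ)) (fun z => (vandermonde z : ℂ) ^ (2 * d))
            (fun z m => (d : ℂ) * powSum z m) (fun z => ∑ i, z i ^ 2)
            (fun q => integrable_vandermonde_gauss n (2 * d) (expBdd_mul_powSum n d q)) q := by
        rw [hμ2, integral_gaussLaw hD2 hD20 hQ2c hy2 (hpc q), gaussMoment_apply]
        refine integral_congr_ae (ae_of_all _ fun z => ?_)
        have : powSum (z ∘ e) = fun m => (d : ℂ) * powSum z m := by
          funext m
          rw [powSum, powSum, ← nsmul_eq_mul, ← sum_comp_fiber e he]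
          rfl
        simp only [this, Complex.real_smul]
        push_cast
        ring
      rw [integral_smul_measure, integral_smul_measure, h1, h2,
        ENNReal.toReal_ofReal hZ2p.le, ENNReal.toReal_ofReal hZ1p.le, Complex.real_smul,
        Complex.real_smul, hm]
  -- The inverse Gaussian factor is itself symmetric, so it may be included in the test function.
  have hK := key (fun z => G z * ENNReal.ofReal (Real.exp ((1 / d) * ∑ i, z i ^ 2)))
    (hG.mul (by fun_prop)) (by
      intro σ z
      have : ∑ i, (z ∘ σ) i ^ 2 = ∑ i, z i ^ 2 := Equiv.sum_comp σ fun i => z i ^ 2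
      simp only [hsym, this])
  rw [lintegral_gaussLaw hD1 (fun _ => zero_le_one) hQc hd hy1 hyQ1 hG,
    lintegral_gaussLaw hD2 hD20 hQ2c hd hy2 hyQ2 hG] at hK
  simp only [ENNReal.ofReal_one, one_mul] at hK
  rw [lintegral_smul_measure, smul_eq_mul, ENNReal.ofReal_div_of_pos hZ1p, ENNReal.div_eq_inv_mul,
    mul_assoc, hK, ← mul_assoc, ENNReal.inv_mul_cancel (by simpa using hZ1p) ENNReal.ofReal_ne_top,
    one_mul]

/-- The Weyl integration formula for symmetric functions of the eigenvalues. -/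
theorem weyl_integral (X : W →ₗ[ℝ] Matrix ι ι ℂ) (hX : ∀ c, (X c).IsHermitian) {n d : ℕ}
    (hd : 0 < d) (e : ι → Fin n) (he : ∀ i, (Finset.univ.filter fun p => e p = i).card = d)
    {Q : W → ℝ} (hQ : ∀ c, (Q c : ℂ) = (1 / d : ℂ) * ((X c) ^ 2).trace)
    {δ : ℝ} (hδ : 0 < δ) (hQδ : ∀ x, δ * ‖x‖ ^ 2 ≤ Q x)
    (E : ι → ι → Matrix ι ι ℂ) (hE : ∀ i j, E i j ∈ Submodule.span ℂ (Set.range X))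
    (hE1 : ∀ c a b, ∑ i, ∑ j, (X c ^ a * E i j * X c ^ b) i j =
      (X c ^ a).trace * (X c ^ b).trace - (d - 1 : ℂ) * (X c ^ (a + b)).trace)
    (hE2 : ∀ c a b, ∑ i, ∑ j, (X c ^ a) i j * (X c ^ b * E i j).trace =
      d * (X c ^ (a + b)).trace) 
    {F : (ι → ℝ) → ℂ} (hF : Measurable F)
    (hsym : ∀ (σ : Equiv.Perm ι) z, F (z ∘ σ) = F z)
    (hint : Integrable fun z : Fin n → ℝ => (vandermonde z : ℂ) ^ (2 * d) * F (z ∘ e)) :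
    Integrable (fun c => F ((hX c).eigenvalues)) ((ENNReal.ofReal
      ((∫ z : Fin n → ℝ, vandermonde z ^ (2 * d) * Real.exp (-∑ i, z i ^ 2)) /
        (∫ c, Real.exp (-Q c) ∂μ))) • μ) ∧
    ∫ c, F ((hX c).eigenvalues) ∂((ENNReal.ofReal
      ((∫ z : Fin n → ℝ, vandermonde z ^ (2 * d) * Real.exp (-∑ i, z i ^ 2)) /
        (∫ c, Real.exp (-Q c) ∂μ))) • μ) =
      ∫ z, (vandermonde z : ℂ) ^ (2 * d) * F (z ∘ e) := by
  set ν := (ENNReal.ofReal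
      ((∫ z : Fin n → ℝ, vandermonde z ^ (2 * d) * Real.exp (-∑ i, z i ^ 2)) /
        (∫ c, Real.exp (-Q c) ∂μ))) • μ with hν
  have hy1 : Measurable fun c => (hX c).eigenvalues :=
    measurable_eigenvalues (fun i j => (expBdd_entry X i j).1.measurable) hX
  have hy2 : Measurable fun z : Fin n → ℝ => z ∘ e :=
    measurable_pi_lambda _ fun p => measurable_pi_apply _
  have hm1 : Measurable fun c => F ((hX c).eigenvalues) := hF.comp hy1
  have hm2 : Measurable fun z : Fin n → ℝ => F (z ∘ e) := hF.comp hy2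
  have hV : Measurable fun z : Fin n → ℝ => ENNReal.ofReal (vandermonde z ^ (2 * d)) := by
    unfold vandermonde; fun_prop
  -- Testing the formula on indicators identifies the laws of `F` under the two measures. This
  -- transfers integrability and the complex integral together.
  have hmap : ν.map (fun c => F ((hX c).eigenvalues)) =
      ((volume : Measure (Fin n → ℝ)).withDensity
        fun z => ENNReal.ofReal (vandermonde z ^ (2 * d))).map (fun z => F (z ∘ e)) := by
    refine Measure.ext fun s hs => ?_
    have hi : Measurable (s.indicator (1 : ℂ → ENNReal)) := measurable_one.indicator hs
    rw [← lintegral_indicator_one hs, ← lintegral_indicator_one hs,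
      lintegral_map hi hm1, lintegral_map hi hm2,
      weyl_lintegral μ X hX hd e he hQ hδ hQδ E hE hE1 hE2
        (G := fun z => s.indicator 1 (F z)) (hi.comp hF)
        (fun σ z => by rw [hsym])]
    exact (lintegral_withDensity_eq_lintegral_mul _ hV
      (g := fun z => s.indicator 1 (F (z ∘ e)))
      (hi.comp hm2)).symm
  have hD20 : ∀ z : Fin n → ℝ, 0 ≤ vandermonde z ^ (2 * d) :=
    fun z => (even_two_mul d).pow_nonneg _
  have hid : ∀ η : Measure ℂ, AEStronglyMeasurable (fun x : ℂ => x) η := fun η =>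
    measurable_id.aestronglyMeasurable
  have hsm : ∀ z : Fin n → ℝ, (ENNReal.ofReal (vandermonde z ^ (2 * d))).toReal • F (z ∘ e) =
      (vandermonde z : ℂ) ^ (2 * d) * F (z ∘ e) := by
    intro z
    rw [ENNReal.toReal_ofReal (hD20 z), Complex.real_smul]
    push_cast; rfl
  constructor
  · have h1 : Integrable (fun x : ℂ => x) (ν.map (fun c => F ((hX c).eigenvalues))) := by
      rw [hmap, integrable_map_measure (hid _) hm2.aemeasurable,
        integrable_withDensity_iff_integrable_smul' hV (ae_of_all _ fun _ => ENNReal.ofReal_lt_top)]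
      simpa only [Function.comp_apply, hsm] using hint
    rwa [integrable_map_measure (hid _) hm1.aemeasurable] at h1
  · rw [← integral_map (φ := fun c => F ((hX c).eigenvalues)) (f := fun x : ℂ => x)
      hm1.aemeasurable (hid _), hmap,
      integral_map hm2.aemeasurable (hid _),
      integral_withDensity_eq_integral_toReal_smul hV
        (ae_of_all _ fun _ => ENNReal.ofReal_lt_top)]
    simp only [hsm]

end Weyl

/-! ### Hermitian matrices -/

theorem trace_sq_of_isHermitian {ι : Type} [Fintype ι] [DecidableEq ι] {A : Matrix ι ι ℂ}
    (hA : A.IsHermitian) : (A ^ 2).trace = ((∑ i, ∑ j, ‖A i j‖ ^ 2 : ℝ) : ℂ) := by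
  rw [pow_two, Matrix.trace]
  push_cast
  refine Finset.sum_congr rfl fun i _ => ?_
  rw [Matrix.diag_apply, Matrix.mul_apply]
  refine Finset.sum_congr rfl fun j _ => ?_
  rw [← hA.apply j i]
  exact Complex.mul_conj' _

theorem norm_sq_entry_le {ι : Type} [Fintype ι] (A : Matrix ι ι ℂ) (i j : ι) :
    ‖A i j‖ ^ 2 ≤ ∑ i, ∑ j, ‖A i j‖ ^ 2 :=
  (Finset.single_le_sum (f := fun j => ‖A i j‖ ^ 2) (fun _ _ => sq_nonneg _)
    (Finset.mem_univ j)).trans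
    (Finset.single_le_sum (f := fun i => ∑ j, ‖A i j‖ ^ 2)
      (fun _ _ => Finset.sum_nonneg fun _ _ => sq_nonneg _) (Finset.mem_univ i))

theorem exists_hermitian_add {ι : Type} [Fintype ι] [DecidableEq ι] (A : Matrix ι ι ℂ) :
    ∃ H K : Matrix ι ι ℂ, H.IsHermitian ∧ K.IsHermitian ∧ A = H + Complex.I • K :=
  ⟨realPart A, imaginaryPart A, (realPart A).2, (imaginaryPart A).2,
    (realPart_add_I_smul_imaginaryPart A).symm⟩

theorem isHermitian_hermMatrix {n : ℕ} (c : HermCoord n) : (hermMatrix c).IsHermitian := by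
  have : hermMatrix c ∈ Set.range (hermMatrix (n := n)) := ⟨c, rfl⟩
  rwa [range_hermMatrix] at this

instance isAddHaarMeasure_hermCoord (n : ℕ) : (volume : Measure (HermCoord n)).IsAddHaarMeasure :=
  Measure.prod.instIsAddHaarMeasure (volume : Measure (Fin n → ℝ)) (volume : Measure (Above n → ℂ))

instance isAddHaarMeasure_quatCoord (n : ℕ) :
    (volume : Measure (QuatCoord n)).IsAddHaarMeasure := by
  have h1 : (volume : Measure (ℂ × ℂ)).IsAddHaarMeasure :=
    Measure.prod.instIsAddHaarMeasure (volume : Measure ℂ) (volume : Measure ℂ)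
  have h2 : (volume : Measure (Above n → ℂ × ℂ)).IsAddHaarMeasure :=
    Measure.pi.isAddHaarMeasure fun _ => (volume : Measure (ℂ × ℂ))
  exact Measure.prod.instIsAddHaarMeasure (volume : Measure (Fin n → ℝ))
    (volume : Measure (Above n → ℂ × ℂ))

/-- `hermMatrix` as a linear map. -/
def hermLin (n : ℕ) : HermCoord n →ₗ[ℝ] Matrix (Fin n) (Fin n) ℂ where
  toFun := hermMatrix
  map_add' c c' := by
    ext i j
    rcases lt_trichotomy i j with h | h | h
    · simp [hermMatrix, h]
    · subst h; simp [hermMatrix]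
    · simp [hermMatrix, h, h.not_gt]
  map_smul' s c := by
    ext i j
    rcases lt_trichotomy i j with h | h | h
    · simp [hermMatrix, h]
    · subst h; simp [hermMatrix]
    · simp [hermMatrix, h, h.not_gt]

/-- Coercivity of the Gaussian exponent: the trace of the square is the sum of the squared absolute
values of all entries, among which the coordinates occur. -/
theorem norm_sq_le_hermMatrix {n : ℕ} (c : HermCoord n) :
    1 * ‖c‖ ^ 2 ≤ ((hermMatrix c) ^ 2).trace.re := by
  rw [trace_sq_of_isHermitian (isHermitian_hermMatrix c), Complex.ofReal_re, one_mul]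
  set S := ∑ i, ∑ j, ‖hermMatrix c i j‖ ^ 2 with hS
  have hS0 : 0 ≤ S := Finset.sum_nonneg fun _ _ => Finset.sum_nonneg fun _ _ => sq_nonneg _
  have hn : ‖c‖ ≤ √S := by
    refine max_le ((pi_norm_le_iff_of_nonneg (Real.sqrt_nonneg _)).2 fun i => ?_)
      ((pi_norm_le_iff_of_nonneg (Real.sqrt_nonneg _)).2 fun p => ?_)
    · have h := norm_sq_entry_le (hermMatrix c) i i
      rw [show hermMatrix c i i = (c.1 i : ℂ) by simp [hermMatrix], Complex.norm_real] at h
      exact Real.le_sqrt_of_sq_le h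
    · have h := norm_sq_entry_le (hermMatrix c) p.1.1 p.1.2
      rw [show hermMatrix c p.1.1 p.1.2 = c.2 p by simp [hermMatrix, p.2]] at h
      exact Real.le_sqrt_of_sq_le h
  calc ‖c‖ ^ 2 ≤ √S ^ 2 := by gcongr
    _ = S := Real.sq_sqrt hS0

/-- The case `d = 1`, with the matrix units as directions. A unit is not Hermitian in general, but
it has the form `H + iK` with `H`, `K` Hermitian, which is all that the complex span requires. -/
theorem herm_weyl (n : ℕ) {F : (Fin n → ℝ) → ℂ} (hF : Measurable F)
    (hsym : ∀ (σ : Equiv.Perm (Fin n)) z, F (z ∘ σ) = F z)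
    (hint : Integrable fun z : Fin n → ℝ => (vandermonde z : ℂ) ^ 2 * F z) :
    Integrable (fun c => F ((isHermitian_hermMatrix c).eigenvalues)) (hermMeasure n) ∧
    ∫ c, F ((isHermitian_hermMatrix c).eigenvalues) ∂(hermMeasure n) =
      ∫ z, (vandermonde z : ℂ) ^ 2 * F z := by
  have h := weyl_integral (volume : Measure (HermCoord n)) (hermLin n)
    (fun c => isHermitian_hermMatrix c) (n := n) (d := 1) one_pos id (fun i => by simp [Finset.filter_eq'])
    (Q := fun c => ((hermMatrix c) ^ 2).trace.re) (fun c => ?_) (δ := 1) one_pos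
    norm_sq_le_hermMatrix (fun i j => Matrix.single i j 1) ?_ ?_ ?_ hF hsym
    (by simpa using hint)
  · simp only [mul_one] at h
    exact h
  · change _ = _ * ((hermMatrix c) ^ 2).trace
    rw [trace_sq_of_isHermitian (isHermitian_hermMatrix c), Complex.ofReal_re, Nat.cast_one,
      div_one, one_mul]
  · intro i j
    obtain ⟨H, K, hH, hK, e⟩ := exists_hermitian_add (Matrix.single i j (1 : ℂ))
    rw [e]
    have hr : ∀ H : Matrix (Fin n) (Fin n) ℂ, H.IsHermitian → H ∈ Set.range (hermLin n) := by
      intro H hH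
      have : H ∈ Set.range (hermMatrix (n := n)) := by rw [range_hermMatrix]; exact hH
      exact this
    exact Submodule.add_mem _ (Submodule.subset_span (hr H hH))
      (Submodule.smul_mem _ _ (Submodule.subset_span (hr K hK)))
  · intro c a b
    simp only [Nat.cast_one, sub_self, zero_mul, sub_zero]
    rw [Matrix.trace, Matrix.trace, Finset.sum_mul_sum]
    refine Finset.sum_congr rfl fun i _ => Finset.sum_congr rfl fun j _ => ?_
    simp [Matrix.mul_apply, Matrix.single_apply, Finset.sum_ite_eq, ite_and]
  · intro c a b
    rw [Nat.cast_one, one_mul, pow_add, Matrix.trace]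
    refine Finset.sum_congr rfl fun i _ => ?_
    rw [Matrix.diag_apply, Matrix.mul_apply]
    refine Finset.sum_congr rfl fun j _ => ?_
    rw [Matrix.trace_mul_single]
    simp

/-! ### Self-dual quaternionic matrices -/

/-- The matrix of the symplectic form. -/
def symplJ (n : ℕ) : Matrix (Fin n × Fin 2) (Fin n × Fin 2) ℂ :=
  fun p q => if p.1 = q.1 then !![0, 1; -1, 0] p.2 q.2 else 0

theorem symplJ_transpose (n : ℕ) : (symplJ n).transpose = -symplJ n := by
  ext ⟨i, α⟩ ⟨j, β⟩
  by_cases h : i = j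
  · subst h
    fin_cases α <;> fin_cases β <;> simp [symplJ]
  · simp [symplJ, h, Ne.symm h]

theorem symplJ_mul_self (n : ℕ) : symplJ n * symplJ n = -1 := by
  ext ⟨i, α⟩ ⟨j, β⟩
  rw [Matrix.mul_apply, Fintype.sum_prod_type]
  by_cases h : i = j
  · subst h
    rw [Finset.sum_eq_single i]
    · fin_cases α <;> fin_cases β <;> simp [symplJ]
    · intro b _ hb; simp [symplJ, Ne.symm hb]
    · simp
  · have : ∀ k, ∑ γ, symplJ n (i, α) (k, γ) * symplJ n (k, γ) (j, β) = 0 := by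
      intro k
      by_cases hk : i = k
      · subst hk; simp [symplJ, h]
      · simp [symplJ, hk]
    simp [this, h]

/-- The dual of a matrix. -/
def dual {n : ℕ} (A : Matrix (Fin n × Fin 2) (Fin n × Fin 2) ℂ) :
    Matrix (Fin n × Fin 2) (Fin n × Fin 2) ℂ :=
  -(symplJ n * A.transpose * symplJ n)

theorem dual_apply {n : ℕ} (A : Matrix (Fin n × Fin 2) (Fin n × Fin 2) ℂ) (i j : Fin n)
    (α β : Fin 2) : dual A (i, α) (j, β) = (if α = β then 1 else -1) * A (j, 1 - β) (i, 1 - α) := by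
  rw [dual, Matrix.neg_apply, Matrix.mul_apply, Fintype.sum_prod_type]
  have h1 : ∀ k γ, (symplJ n * A.transpose) (i, α) (k, γ) =
      (if α = 0 then 1 else -1) * A (k, γ) (i, 1 - α) := by
    intro k γ
    rw [Matrix.mul_apply, Fintype.sum_prod_type, Finset.sum_eq_single i]
    · fin_cases α <;> simp [symplJ]
    · intro b _ hb; simp [symplJ, Ne.symm hb]
    · simp
  simp_rw [h1]
  rw [Finset.sum_eq_single j]
  · fin_cases α <;> fin_cases β <;> simp [symplJ]
  · intro b _ hb; simp [symplJ, hb]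
  · simp

theorem dual_add {n : ℕ} (A B : Matrix (Fin n × Fin 2) (Fin n × Fin 2) ℂ) :
    dual (A + B) = dual A + dual B := by
  simp only [dual, Matrix.transpose_add, mul_add, add_mul, neg_add]

theorem dual_smul {n : ℕ} (s : ℂ) (A : Matrix (Fin n × Fin 2) (Fin n × Fin 2) ℂ) :
    dual (s • A) = s • dual A := by
  simp only [dual, Matrix.transpose_smul, Matrix.mul_smul, Matrix.smul_mul, smul_neg]

theorem dual_dual {n : ℕ} (A : Matrix (Fin n × Fin 2) (Fin n × Fin 2) ℂ) : dual (dual A) = A := by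
  ext ⟨i, α⟩ ⟨j, β⟩
  rw [dual_apply, dual_apply]
  fin_cases α <;> fin_cases β <;> simp

theorem dual_isHermitian {n : ℕ} {A : Matrix (Fin n × Fin 2) (Fin n × Fin 2) ℂ}
    (hA : A.IsHermitian) : (dual A).IsHermitian := by
  ext ⟨i, α⟩ ⟨j, β⟩
  rw [Matrix.conjTranspose_apply, dual_apply, dual_apply, ← hA.apply (j, 1 - β)]
  fin_cases α <;> fin_cases β <;> simp

/-- The quaternionic block condition becomes a fixed-point condition for an anti-automorphism. So
powers remain self-dual, and `H + dual H` is self-dual for every Hermitian `H`. -/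
theorem mem_selfDual_iff {n : ℕ} {A : Matrix (Fin n × Fin 2) (Fin n × Fin 2) ℂ}
    (hA : A.IsHermitian) : A ∈ selfDual n ↔ dual A = A := by
  constructor
  · rintro ⟨_, hB⟩
    ext ⟨i, α⟩ ⟨j, β⟩
    obtain ⟨x, y, hxy⟩ := hB i j
    have e : ∀ α β, A (i, α) (j, β) = quatBlock x y α β := fun α β => congrFun₂ hxy α β
    rw [dual_apply, ← hA.apply, e, e]
    fin_cases α <;> fin_cases β <;> simp [quatBlock]
  · intro h
    refine ⟨hA, fun k l => ⟨A (k, 0) (l, 0), A (k, 0) (l, 1), ?_⟩⟩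
    ext α β
    have e : ∀ α β, A (k, α) (l, β) = (if α = β then 1 else -1) * star (A (k, 1 - α) (l, 1 - β)) := by
      intro α β
      conv_lhs => rw [← h, dual_apply, ← hA.apply]
    fin_cases α <;> fin_cases β
    · simp [quatBlock]
    · simp [quatBlock]
    · simpa [quatBlock] using e 1 0
    · simpa [quatBlock] using e 1 1

theorem isHermitian_quatMatrix {n : ℕ} (c : QuatCoord n) : (quatMatrix c).IsHermitian := by
  have : quatMatrix c ∈ Set.range (quatMatrix (n := n)) := ⟨c, rfl⟩
  rw [range_quatMatrix] at this
  exact this.1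

theorem dual_quatMatrix {n : ℕ} (c : QuatCoord n) : dual (quatMatrix c) = quatMatrix c := by
  have : quatMatrix c ∈ Set.range (quatMatrix (n := n)) := ⟨c, rfl⟩
  rw [range_quatMatrix] at this
  exact (mem_selfDual_iff this.1).1 this

theorem dual_mul {n : ℕ} (B C : Matrix (Fin n × Fin 2) (Fin n × Fin 2) ℂ) :
    dual (B * C) = dual C * dual B := by
  have : dual C * dual B = symplJ n * C.transpose * (symplJ n * symplJ n) *
      B.transpose * symplJ n := by
    simp only [dual, neg_mul_neg, mul_assoc]
  rw [this, symplJ_mul_self, dual, Matrix.transpose_mul]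
  simp only [mul_neg, mul_one, neg_mul, mul_assoc]

theorem trace_dual {n : ℕ} (B : Matrix (Fin n × Fin 2) (Fin n × Fin 2) ℂ) :
    (dual B).trace = B.trace := by
  rw [dual, Matrix.trace_neg, Matrix.trace_mul_comm, ← mul_assoc, symplJ_mul_self, neg_one_mul,
    Matrix.trace_neg, neg_neg, Matrix.trace_transpose]

theorem dual_pow {n : ℕ} {A : Matrix (Fin n × Fin 2) (Fin n × Fin 2) ℂ} (hA : dual A = A) (b : ℕ) :
    dual (A ^ b) = A ^ b := by
  induction b with
  | zero =>
    rw [pow_zero, dual, Matrix.transpose_one, mul_one, symplJ_mul_self, neg_neg]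
  | succ b ih => rw [pow_succ, dual_mul, ih, hA, ← pow_succ', pow_succ]

/-- `quatMatrix` as a linear map. -/
def quatLin (n : ℕ) : QuatCoord n →ₗ[ℝ] Matrix (Fin n × Fin 2) (Fin n × Fin 2) ℂ where
  toFun := quatMatrix
  map_add' c c' := by
    ext ⟨i, α⟩ ⟨j, β⟩
    rcases lt_trichotomy i j with h | h | h
    · fin_cases α <;> fin_cases β <;> simp [quatMatrix, quatBlock, h, add_comm]
    · subst h; fin_cases α <;> fin_cases β <;> simp [quatMatrix, quatBlock]
    · fin_cases α <;> fin_cases β <;> simp [quatMatrix, quatBlock, h, h.not_gt, add_comm]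
  map_smul' s c := by
    ext ⟨i, α⟩ ⟨j, β⟩
    rcases lt_trichotomy i j with h | h | h
    · fin_cases α <;> fin_cases β <;> simp [quatMatrix, quatBlock, h]
    · subst h; fin_cases α <;> fin_cases β <;> simp [quatMatrix, quatBlock]
    · fin_cases α <;> fin_cases β <;> simp [quatMatrix, quatBlock, h, h.not_gt]

theorem norm_sq_le_quatMatrix {n : ℕ} (c : QuatCoord n) :
    (1 / 2) * ‖c‖ ^ 2 ≤ (quatTrace ((quatMatrix c) ^ 2)).re := by
  rw [quatTrace, trace_sq_of_isHermitian (isHermitian_quatMatrix c)]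
  set S := ∑ i, ∑ j, ‖quatMatrix c i j‖ ^ 2 with hS
  have hS0 : 0 ≤ S := Finset.sum_nonneg fun _ _ => Finset.sum_nonneg fun _ _ => sq_nonneg _
  have hn : ‖c‖ ≤ √S := by
    refine max_le ((pi_norm_le_iff_of_nonneg (Real.sqrt_nonneg _)).2 fun i => ?_)
      ((pi_norm_le_iff_of_nonneg (Real.sqrt_nonneg _)).2 fun p => max_le ?_ ?_)
    · have h := norm_sq_entry_le (quatMatrix c) (i, 0) (i, 0)
      rw [show quatMatrix c (i, 0) (i, 0) = (c.1 i : ℂ) by simp [quatMatrix, quatBlock],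
        Complex.norm_real] at h
      exact Real.le_sqrt_of_sq_le h
    · have h := norm_sq_entry_le (quatMatrix c) (p.1.1, 0) (p.1.2, 0)
      rw [show quatMatrix c (p.1.1, 0) (p.1.2, 0) = (c.2 p).1 by
        simp [quatMatrix, quatBlock, p.2]] at h
      exact Real.le_sqrt_of_sq_le h
    · have h := norm_sq_entry_le (quatMatrix c) (p.1.1, 0) (p.1.2, 1)
      rw [show quatMatrix c (p.1.1, 0) (p.1.2, 1) = (c.2 p).2 by
        simp [quatMatrix, quatBlock, p.2]] at h
      exact Real.le_sqrt_of_sq_le h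
  have h2 : ‖c‖ ^ 2 ≤ S := by
    calc ‖c‖ ^ 2 ≤ √S ^ 2 := by gcongr
      _ = S := Real.sq_sqrt hS0
  have h3 : ((S : ℂ) / 2).re = S / 2 := by
    rw [show (S : ℂ) / 2 = ((S / 2 : ℝ) : ℂ) by push_cast; rfl, Complex.ofReal_re]
  rw [h3]
  linarith

theorem sum_mul_apply_eq_trace {ι : Type} [Fintype ι] (A B : Matrix ι ι ℂ) :
    ∑ i, ∑ j, A i j * B i j = (A * B.transpose).trace := by
  simp [Matrix.trace, Matrix.mul_apply]

theorem mul_single_mul_apply {ι : Type} [Fintype ι] [DecidableEq ι] (A B : Matrix ι ι ℂ)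
    (i j k l : ι) : (A * Matrix.single i j (1 : ℂ) * B) k l = A k i * B j l := by
  simp [Matrix.mul_apply, Matrix.single_apply, ite_and]

/-- The matrix units contribute the product of the traces. Their duals, once `symplJ` is moved onto
the neighbouring factors, contribute `-tr (A J (J B)ᵀ)`, and self-duality of `B` turns this into
`-tr (A B)`. This is the correction `d - 1 = 1` of the loop equations. -/
theorem sum_mul_add_dual_mul {n : ℕ} (A : Matrix (Fin n × Fin 2) (Fin n × Fin 2) ℂ)
    {B : Matrix (Fin n × Fin 2) (Fin n × Fin 2) ℂ} (hB : dual B = B) :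
    ∑ i : Fin n × Fin 2, ∑ j : Fin n × Fin 2, (A * (Matrix.single i j (1 : ℂ) + dual (Matrix.single i j (1 : ℂ))) * B) i j =
      A.trace * B.trace - (A * B).trace := by
  have e1 : ∀ i j : Fin n × Fin 2, (A * (Matrix.single i j (1 : ℂ) + dual (Matrix.single i j (1 : ℂ))) * B) i j =
      A i i * B j j - (A * symplJ n) i j * (symplJ n * B) i j := by
    intro i j
    have : A * dual (Matrix.single i j (1 : ℂ)) * B =
        -((A * symplJ n) * Matrix.single j i (1 : ℂ) * (symplJ n * B)) := by
      rw [dual, Matrix.transpose_single]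
      simp only [mul_neg, neg_mul, mul_assoc]
    rw [mul_add, add_mul, this, Matrix.add_apply, Matrix.neg_apply, mul_single_mul_apply,
      mul_single_mul_apply, sub_eq_add_neg]
  simp_rw [e1, Finset.sum_sub_distrib]
  rw [sum_mul_apply_eq_trace, ← Finset.sum_mul_sum]
  have e2 : A * symplJ n * (symplJ n * B).transpose = A * B := by
    rw [Matrix.transpose_mul, symplJ_transpose]
    conv_rhs => rw [← hB, dual]
    simp only [mul_neg, mul_assoc]
  rw [e2]
  rfl

/-- The trace is invariant under `dual` and `B` is self-dual, so the unit and its dual contribute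
equally; hence the factor `2`. -/
theorem sum_mul_trace_add_dual {n : ℕ} (A : Matrix (Fin n × Fin 2) (Fin n × Fin 2) ℂ)
    {B : Matrix (Fin n × Fin 2) (Fin n × Fin 2) ℂ} (hB : dual B = B) :
    ∑ i, ∑ j, A i j * (B * (Matrix.single i j (1 : ℂ) + dual (Matrix.single i j (1 : ℂ)))).trace =
      2 * (A * B).trace := by
  have e1 : ∀ i j : Fin n × Fin 2, (B * (Matrix.single i j (1 : ℂ) + dual (Matrix.single i j (1 : ℂ)))).trace =
      (B.transpose + B.transpose) i j := by
    intro i j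
    have e2 : (B * dual (Matrix.single i j (1 : ℂ))).trace =
        (B * Matrix.single i j (1 : ℂ)).trace := by
      rw [← trace_dual, dual_mul, dual_dual, hB, Matrix.trace_mul_comm]
    rw [mul_add, Matrix.trace_add, e2, Matrix.trace_mul_single]
    simp
  simp_rw [e1]
  rw [sum_mul_apply_eq_trace, Matrix.transpose_add, Matrix.transpose_transpose, mul_add,
    Matrix.trace_add, two_mul]

/-- The case `d = 2`, with the symmetrizations of the matrix units under `dual` as directions. The
map `Prod.fst` repeats each of the `n` eigenvalues twice, and the symmetry of `F` makes the order
irrelevant. -/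
theorem quat_weyl (n : ℕ) {F : (Fin n × Fin 2 → ℝ) → ℂ} (hF : Measurable F)
    (hsym : ∀ (σ : Equiv.Perm (Fin n × Fin 2)) z, F (z ∘ σ) = F z)
    (hint : Integrable fun z : Fin n → ℝ => (vandermonde z : ℂ) ^ 4 * F (fun p => z p.1)) :
    Integrable (fun c => F ((isHermitian_quatMatrix c).eigenvalues)) (quatMeasure n) ∧
    ∫ c, F ((isHermitian_quatMatrix c).eigenvalues) ∂(quatMeasure n) =
      ∫ z, (vandermonde z : ℂ) ^ 4 * F (fun p => z p.1) := by
  have h := weyl_integral (volume : Measure (QuatCoord n)) (quatLin n)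
    (fun c => isHermitian_quatMatrix c) (n := n) (d := 2) two_pos Prod.fst (fun i => ?_)
    (Q := fun c => (quatTrace ((quatMatrix c) ^ 2)).re) (fun c => ?_) (δ := 1 / 2) (by norm_num)
    norm_sq_le_quatMatrix (fun i j => Matrix.single i j 1 + dual (Matrix.single i j 1)) ?_ ?_ ?_
    hF hsym hint
  · exact h
  · have : (Finset.univ.filter fun p : Fin n × Fin 2 => p.1 = i) =
        Finset.univ.image (fun α : Fin 2 => (i, α)) := by
      ext ⟨k, α⟩; simp [eq_comm]
    rw [this, Finset.card_image_of_injective _ fun α β h => by simpa using h]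
    simp
  · change _ = _ * ((quatMatrix c) ^ 2).trace
    rw [quatTrace, trace_sq_of_isHermitian (isHermitian_quatMatrix c)]
    set S := ∑ i, ∑ j, ‖quatMatrix c i j‖ ^ 2
    rw [show (S : ℂ) / 2 = ((S / 2 : ℝ) : ℂ) by push_cast; rfl, Complex.ofReal_re]
    push_cast; ring
  · intro i j
    obtain ⟨H, K, hH, hK, e⟩ := exists_hermitian_add (Matrix.single i j (1 : ℂ))
    rw [e, dual_add, dual_smul, add_add_add_comm, ← smul_add]
    have hr : ∀ H : Matrix (Fin n × Fin 2) (Fin n × Fin 2) ℂ, H.IsHermitian →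
        H + dual H ∈ Set.range (quatLin n) := by
      intro H hH
      have : H + dual H ∈ Set.range (quatMatrix (n := n)) := by
        rw [range_quatMatrix, mem_selfDual_iff (hH.add (dual_isHermitian hH)), dual_add, dual_dual,
          add_comm]
      exact this
    exact Submodule.add_mem _ (Submodule.subset_span (hr H hH))
      (Submodule.smul_mem _ _ (Submodule.subset_span (hr K hK)))
  · intro c a b
    rw [pow_add, Nat.cast_two, show (2 - 1 : ℂ) = 1 by norm_num, one_mul]
    exact sum_mul_add_dual_mul _ (dual_pow (dual_quatMatrix c) b)
  · intro c a b
    rw [pow_add, Nat.cast_two]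
    exact sum_mul_trace_add_dual _ (dual_pow (dual_quatMatrix c) b)

/-! ### Determinants and Pfaffians of moment matrices as multiple integrals -/

theorem prod_above {n : ℕ} {M : Type} [CommMonoid M] (h : Fin n → Fin n → M) :
    ∏ p : Above n, h p.1.1 p.1.2 = ∏ i, ∏ j, if i < j then h i j else 1 := by
  rw [← Fintype.prod_prod_type' (f := fun i j => if i < j then h i j else 1),
    ← Finset.prod_filter, Finset.prod_subtype (p := fun p : Fin n × Fin n => p.1 < p.2)]
  intro x; simp

theorem det_vandermonde_eq_prod_ite {n : ℕ} (v : Fin n → ℂ) :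
    (Matrix.vandermonde v).det = ∏ i, ∏ j, if i < j then v j - v i else 1 := by
  rw [Matrix.det_vandermonde]
  refine Finset.prod_congr rfl fun i _ => ?_
  rw [← Finset.prod_filter]
  congr 1
  ext j; simp

theorem vandermonde_sq {n : ℕ} (z : Fin n → ℝ) :
    (vandermonde z : ℂ) ^ 2 = (Matrix.vandermonde fun i => (z i : ℂ)).det ^ 2 := by
  rw [det_vandermonde_eq_prod_ite, ← prod_above, vandermonde]
  push_cast
  rw [← Finset.prod_pow, ← Finset.prod_pow]
  exact Finset.prod_congr rfl fun p _ => by ring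

/-- Expand each of the two Vandermonde determinants over permutations `τ` and `σ`; the integrals
factorize. For fixed `τ` the sum over `σ` is the moment determinant with permuted columns, so after
the signs each of the `n!` values of `τ` contributes the same. -/
theorem andreief {w : ℝ → ℂ} (hw : ∀ k : ℕ, Integrable fun x : ℝ => (x : ℂ) ^ k * w x) (n : ℕ) :
    (Integrable fun z : Fin n → ℝ => (vandermonde z : ℂ) ^ 2 * ∏ i, w (z i)) ∧
    (Matrix.of fun i j : Fin n => ∫ x : ℝ, (x : ℂ) ^ (i : ℕ) * (x : ℂ) ^ (j : ℕ) * w x).det =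
      (1 / (n.factorial : ℂ)) * ∫ z : Fin n → ℝ, (vandermonde z : ℂ) ^ 2 * ∏ i, w (z i) := by
  set M : Matrix (Fin n) (Fin n) ℂ :=
    Matrix.of fun i j : Fin n => ∫ x : ℝ, (x : ℂ) ^ (i : ℕ) * (x : ℂ) ^ (j : ℕ) * w x with hM
  have hw2 : ∀ i j : ℕ, Integrable fun x : ℝ => (x : ℂ) ^ i * (x : ℂ) ^ j * w x := by
    intro i j; simp_rw [← pow_add]; exact hw _
  have hdet : ∀ z : Fin n → ℝ, (Matrix.vandermonde fun i => (z i : ℂ)).det =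
      ∑ σ : Equiv.Perm (Fin n), ((Equiv.Perm.sign σ : ℤ) : ℂ) * ∏ i, (z i : ℂ) ^ (σ i : ℕ) := by
    intro z
    rw [← Matrix.det_transpose, Matrix.det_apply']
    rfl
  have hexp : ∀ z : Fin n → ℝ, (vandermonde z : ℂ) ^ 2 * ∏ i, w (z i) =
      ∑ τ : Equiv.Perm (Fin n), ∑ σ : Equiv.Perm (Fin n),
        (((Equiv.Perm.sign τ : ℤ) : ℂ) * ((Equiv.Perm.sign σ : ℤ) : ℂ)) *
          ∏ i, ((z i : ℂ) ^ (σ i : ℕ) * (z i : ℂ) ^ (τ i : ℕ) * w (z i)) := by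
    intro z
    rw [vandermonde_sq, pow_two, hdet, Finset.sum_mul_sum, Finset.sum_mul]
    refine Finset.sum_congr rfl fun τ _ => ?_
    rw [Finset.sum_mul]
    refine Finset.sum_congr rfl fun σ _ => ?_
    simp only [Finset.prod_mul_distrib]
    ring
  have hint : ∀ σ τ : Equiv.Perm (Fin n), Integrable fun z : Fin n → ℝ =>
      ∏ i, ((z i : ℂ) ^ (σ i : ℕ) * (z i : ℂ) ^ (τ i : ℕ) * w (z i)) := fun σ τ =>
    Integrable.fintype_prod (f := fun i (x : ℝ) => (x : ℂ) ^ (σ i : ℕ) * (x : ℂ) ^ (τ i : ℕ) * w x)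
      fun i => hw2 _ _
  constructor
  · simp_rw [hexp]
    exact integrable_finsetSum _ fun τ _ => integrable_finsetSum _ fun σ _ => (hint σ τ).const_mul _
  · have h1 : ∫ z : Fin n → ℝ, (vandermonde z : ℂ) ^ 2 * ∏ i, w (z i) =
        ∑ τ : Equiv.Perm (Fin n), ((Equiv.Perm.sign τ : ℤ) : ℂ) * ((Equiv.Perm.sign τ : ℤ) : ℂ) *
          M.det := by
      simp_rw [hexp]
      rw [integral_finsetSum _ fun τ _ => integrable_finsetSum _ fun σ _ => (hint σ τ).const_mul _]
      refine Finset.sum_congr rfl fun τ _ => ?_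
      rw [integral_finsetSum _ fun σ _ => (hint σ τ).const_mul _, mul_assoc, ← Matrix.det_permute',
        Matrix.det_apply', Finset.mul_sum]
      refine Finset.sum_congr rfl fun σ _ => ?_
      rw [integral_const_mul, integral_fintype_prod_volume_eq_prod
        (f := fun i (x : ℝ) => (x : ℂ) ^ (σ i : ℕ) * (x : ℂ) ^ (τ i : ℕ) * w x), mul_assoc]
      rfl
    have h2 : ∀ τ : Equiv.Perm (Fin n),
        ((Equiv.Perm.sign τ : ℤ) : ℂ) * ((Equiv.Perm.sign τ : ℤ) : ℂ) = 1 := by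
      intro τ
      rcases Int.units_eq_one_or (Equiv.Perm.sign τ) with h | h <;> simp [h]
    simp_rw [h1, h2, one_mul]
    rw [Finset.sum_const, Finset.card_univ, Fintype.card_perm, Fintype.card_fin, nsmul_eq_mul,
      one_div, inv_mul_cancel_left₀]
    exact_mod_cast n.factorial_ne_zero

/-! ### The confluent Vandermonde determinant -/

/-- Pairs of consecutive indices. -/
def pairEquiv (n : ℕ) : Fin n × Fin 2 ≃ Fin (2 * n) where
  toFun p := ⟨2 * p.1 + p.2, by omega⟩
  invFun m := (⟨m / 2, by omega⟩, ⟨m % 2, by omega⟩)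
  left_inv p := by
    ext
    · simp only; omega
    · simp only; omega
  right_inv m := by ext; simp only; omega

theorem pairEquiv_zero {n : ℕ} (k : Fin n) : pairEquiv n (k, 0) = ⟨2 * k, by omega⟩ := rfl

theorem pairEquiv_one {n : ℕ} (k : Fin n) : pairEquiv n (k, 1) = ⟨2 * k + 1, by omega⟩ := rfl

theorem prod_pairEquiv {n : ℕ} {M : Type} [CommMonoid M] (h : Fin (2 * n) → M) :
    ∏ m, h m = ∏ k : Fin n, h ⟨2 * k, by omega⟩ * h ⟨2 * k + 1, by omega⟩ := by
  rw [← (pairEquiv n).prod_comp, Fintype.prod_prod_type]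
  refine Finset.prod_congr rfl fun k _ => ?_
  rw [Fin.prod_univ_two]; rfl

/-- The confluent Vandermonde matrix: its rows with indices `2k` and `2k + 1` are `(z_kʲ)_j` and
the derivative of this row. -/
def confluent {n : ℕ} (z : Fin n → ℂ) : Matrix (Fin (2 * n)) (Fin (2 * n)) ℂ := fun m j =>
  if m.1 % 2 = 0 then z ⟨m / 2, by omega⟩ ^ (j : ℕ)
  else (j : ℕ) * z ⟨m / 2, by omega⟩ ^ ((j : ℕ) - 1)

/-- The matrix of the values and of the divided differences. -/
def divDiff {n : ℕ} (z : Fin n → ℂ) (h : ℂ) : Matrix (Fin (2 * n)) (Fin (2 * n)) ℂ := fun m j =>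
  if m.1 % 2 = 0 then z ⟨m / 2, by omega⟩ ^ (j : ℕ)
  else ∑ i ∈ Finset.range j, (z ⟨m / 2, by omega⟩ + h) ^ i * z ⟨m / 2, by omega⟩ ^ ((j : ℕ) - 1 - i)

/-- This is the Vandermonde determinant at the `2n` points `z_k`, `z_k + h`, with `h` factored out
of every second row. -/
theorem det_divDiff {n : ℕ} (z : Fin n → ℂ) {h : ℂ} (hh : h ≠ 0) : (divDiff z h).det =
    ∏ k, ∏ l, if k < l then (z l - z k) ^ 2 * ((z l + h - z k) * (z l - (z k + h))) else 1 := by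
  set v : Fin (2 * n) → ℂ := fun m => z ⟨m / 2, by omega⟩ + if m.1 % 2 = 0 then 0 else h with hv
  have h1 : (Matrix.vandermonde v).det = h ^ n * ∏ k, ∏ l, if k < l then
      (z l - z k) ^ 2 * ((z l + h - z k) * (z l - (z k + h))) else 1 := by
    rw [det_vandermonde_eq_prod_ite, prod_pairEquiv]
    -- A pair `k < l` of points accounts for four factors of the Vandermonde product, and the pair
    -- inside the block `k` for one factor `h`.
    have h2 : ∀ k : Fin n, (∏ j, if (⟨2 * k, by omega⟩ : Fin (2 * n)) < j then
          v j - v ⟨2 * k, by omega⟩ else 1) *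
        (∏ j, if (⟨2 * k + 1, by omega⟩ : Fin (2 * n)) < j then
          v j - v ⟨2 * k + 1, by omega⟩ else 1) =
        ∏ l, ((if k = l then h else 1) * if k < l then
          (z l - z k) ^ 2 * ((z l + h - z k) * (z l - (z k + h))) else 1) := by
      intro k
      rw [prod_pairEquiv, prod_pairEquiv, ← Finset.prod_mul_distrib]
      refine Finset.prod_congr rfl fun l _ => ?_
      have e0 : ∀ k : Fin n, v ⟨2 * k, by omega⟩ = z k := by
        intro k; simp [hv]
      have e1 : ∀ k : Fin n, v ⟨2 * k + 1, by omega⟩ = z k + h := by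
        intro k
        have : (2 * (k : ℕ) + 1) / 2 = k := by omega
        simp [hv, this, Nat.add_mod]
      simp only [e0, e1, Fin.mk_lt_mk]
      rcases lt_trichotomy k l with hkl | hkl | hkl
      · have : (k : ℕ) < l := hkl
        rw [if_pos (by omega), if_pos (by omega), if_pos (by omega), if_pos (by omega),
          if_neg hkl.ne, if_pos hkl]
        ring
      · subst hkl
        simp
      · have : (l : ℕ) < k := hkl
        rw [if_neg (by omega), if_neg (by omega), if_neg (by omega), if_neg (by omega),
          if_neg hkl.ne', if_neg hkl.not_gt]
        ring
    simp_rw [h2, Finset.prod_mul_distrib]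
    simp
  -- The unitriangular row operation subtracting row `2k` from row `2k + 1`. It leaves `(z + h)ʲ -
  -- zʲ`, that is, `h` times a divided difference.
  set T : Matrix (Fin (2 * n)) (Fin (2 * n)) ℂ := fun m m' =>
    if m = m' then 1 else if m.1 % 2 = 1 ∧ m'.1 + 1 = m.1 then -1 else 0 with hT
  have hTdet : T.det = 1 := by
    rw [Matrix.det_of_isLowerTriangular]
    · simp [hT]
    · intro i j hij
      have hij' : (i : ℕ) < j := hij
      simp only [hT]
      rw [if_neg (by intro h; subst h; omega), if_neg (by omega)]
  have hTV : T * Matrix.vandermonde v = Matrix.of fun m j =>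
      (if m.1 % 2 = 0 then 1 else h) * divDiff z h m j := by
    ext m j
    rw [Matrix.mul_apply, Matrix.of_apply]
    rcases Nat.mod_two_eq_zero_or_one m with hm | hm
    · rw [Finset.sum_eq_single m]
      · simp [hT, hv, hm, divDiff, Matrix.vandermonde]
      · intro b _ hb
        simp [hT, hb.symm, hm]
      · simp
    · have hm1 : 0 < m.1 := by omega
      rw [Finset.sum_eq_add m (⟨m.1 - 1, by omega⟩ : Fin (2 * n))]
      · have e2 : (m.1 - 1) % 2 = 0 := by omega
        have e3 : (m.1 - 1) / 2 = m.1 / 2 := by omega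
        have e4 : m ≠ (⟨m.1 - 1, by omega⟩ : Fin (2 * n)) := by
          intro h; have := congrArg Fin.val h; simp at this; omega
        have e6 : m.1 - 1 + 1 = m.1 := by omega
        simp only [hT, hv, divDiff, Matrix.vandermonde, Matrix.of_apply, hm, e2, e3, e4, e6,
          one_ne_zero, if_false, if_true, add_zero, one_mul, and_self]
        have := (Commute.all (z ⟨m / 2, by omega⟩ + h) (z ⟨m / 2, by omega⟩)).mul_geom_sum₂ j
        rw [add_sub_cancel_left] at this
        rw [this]; ring
      · intro h; have := congrArg Fin.val h; simp at this; omega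
      · intro b _ hb
        have : ¬ (m.1 % 2 = 1 ∧ b.1 + 1 = m.1) := by
          rintro ⟨_, h⟩
          exact hb.2 (Fin.ext (by simp; omega))
        simp [hT, hb.1.symm, this]
      · simp
      · simp
  have h3 : h ^ n * (divDiff z h).det = (Matrix.vandermonde v).det := by
    have := congrArg Matrix.det hTV
    rw [Matrix.det_mul, hTdet, one_mul, Matrix.det_mul_column] at this
    rw [this, prod_pairEquiv]
    congr 1
    simp
  rw [h1] at h3
  exact mul_left_cancel₀ (pow_ne_zero _ hh) h3

/-- Both sides of `det_divDiff` are continuous in `h` and agree off `h = 0`, so they agree at `0`,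
where divided differences become derivatives. -/
theorem det_confluent {n : ℕ} (z : Fin n → ℂ) :
    (confluent z).det = ∏ k, ∏ l, if k < l then (z l - z k) ^ 4 else 1 := by
  have hc : (fun h : ℂ => (divDiff z h).det) = fun h : ℂ => ∏ k, ∏ l, if k < l then
      (z l - z k) ^ 2 * ((z l + h - z k) * (z l - (z k + h))) else 1 := by
    refine Continuous.ext_on (dense_compl_singleton (0 : ℂ)) ?_ ?_ fun h hh => det_divDiff z hh
    · refine Continuous.matrix_det ?_
      refine continuous_matrix fun m j => ?_
      unfold divDiff
      split_ifs <;> fun_prop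
    · refine continuous_finsetProd _ fun k _ => continuous_finsetProd _ fun l _ => ?_
      split_ifs <;> fun_prop
  have h0 := congrFun hc 0
  have e : divDiff z 0 = confluent z := by
    ext m j
    unfold divDiff confluent
    split_ifs with hm
    · rfl
    · rw [add_zero, Finset.sum_congr rfl fun i hi => by
        have := Finset.mem_range.1 hi
        rw [← pow_add, show i + ((j : ℕ) - 1 - i) = (j : ℕ) - 1 by omega]]
      simp
  simp only [e] at h0
  rw [h0]
  refine Finset.prod_congr rfl fun k _ => Finset.prod_congr rfl fun l _ => ?_
  split_ifs
  · ring
  · rfl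

theorem det_confluent_eq_vandermonde {n : ℕ} (z : Fin n → ℝ) :
    (confluent fun i => (z i : ℂ)).det = (vandermonde z : ℂ) ^ 4 := by
  rw [det_confluent, ← prod_above fun k l => ((z l : ℂ) - z k) ^ 4, vandermonde]
  push_cast
  rw [← Finset.prod_pow]
  exact Finset.prod_congr rfl fun p _ => by ring

/-! ### De Bruijn's identity for the Pfaffian of skew moments -/

/-- Antisymmetrizing the matrix does not change an alternating sum over pairings. -/
theorem sum_sign_prod_antisymm {n : ℕ} (A : Matrix (Fin (2 * n)) (Fin (2 * n)) ℂ) :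
    ∑ σ : Equiv.Perm (Fin (2 * n)), ((Equiv.Perm.sign σ : ℤ) : ℂ) *
      ∏ k : Fin n, ((1 / 2) * (A (σ ⟨2 * k, by omega⟩) (σ ⟨2 * k + 1, by omega⟩) -
        A (σ ⟨2 * k + 1, by omega⟩) (σ ⟨2 * k, by omega⟩))) =
    ∑ σ : Equiv.Perm (Fin (2 * n)), ((Equiv.Perm.sign σ : ℤ) : ℂ) *
      ∏ k : Fin n, A (σ ⟨2 * k, by omega⟩) (σ ⟨2 * k + 1, by omega⟩) := by
  set a : Fin n → Fin (2 * n) := fun k => ⟨2 * k, by omega⟩ with ha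
  set b : Fin n → Fin (2 * n) := fun k => ⟨2 * k + 1, by omega⟩ with hb
  have hab : ∀ k l, a k ≠ b l := by
    intro k l h; have := congrArg Fin.val h; simp [ha, hb] at this; omega
  have haa : ∀ k l, k ≠ l → a k ≠ a l := by
    intro k l hkl h; have := congrArg Fin.val h; simp [ha] at this; exact hkl (Fin.ext this)
  have hbb : ∀ k l, k ≠ l → b k ≠ b l := by
    intro k l hkl h; have := congrArg Fin.val h; simp [hb] at this; exact hkl (Fin.ext this)
  -- Induction on the set of pairs already antisymmetrized. Composing `σ` with the swap inside the
  -- pair `m` reverses the sign and leaves the factors of the other pairs alone.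
  have key : ∀ S : Finset (Fin n), ∑ σ : Equiv.Perm (Fin (2 * n)), ((Equiv.Perm.sign σ : ℤ) : ℂ) *
      ∏ k : Fin n, (if k ∈ S then (1 / 2) * (A (σ (a k)) (σ (b k)) - A (σ (b k)) (σ (a k))) else
        A (σ (a k)) (σ (b k))) =
      ∑ σ : Equiv.Perm (Fin (2 * n)), ((Equiv.Perm.sign σ : ℤ) : ℂ) *
        ∏ k : Fin n, A (σ (a k)) (σ (b k)) := by
    intro S
    induction S using Finset.induction_on with
    | empty => simp
    | insert m S hm ih =>
      rw [← ih]
      set R : Equiv.Perm (Fin (2 * n)) → ℂ := fun σ => ∏ k ∈ Finset.univ.erase m,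
        (if k ∈ S then (1 / 2) * (A (σ (a k)) (σ (b k)) - A (σ (b k)) (σ (a k))) else
          A (σ (a k)) (σ (b k))) with hR
      have h1 : ∀ σ : Equiv.Perm (Fin (2 * n)), ∏ k : Fin n, (if k ∈ insert m S then
          (1 / 2) * (A (σ (a k)) (σ (b k)) - A (σ (b k)) (σ (a k))) else A (σ (a k)) (σ (b k))) =
          ((1 / 2) * (A (σ (a m)) (σ (b m)) - A (σ (b m)) (σ (a m)))) * R σ := by
        intro σ
        rw [← Finset.mul_prod_erase _ _ (Finset.mem_univ m), if_pos (Finset.mem_insert_self _ _)]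
        congr 1
        refine Finset.prod_congr rfl fun k hk => ?_
        have := Finset.ne_of_mem_erase hk
        simp [this]
      have h2 : ∀ σ : Equiv.Perm (Fin (2 * n)), ∏ k : Fin n, (if k ∈ S then
          (1 / 2) * (A (σ (a k)) (σ (b k)) - A (σ (b k)) (σ (a k))) else A (σ (a k)) (σ (b k))) =
          A (σ (a m)) (σ (b m)) * R σ := by
        intro σ
        rw [← Finset.mul_prod_erase _ _ (Finset.mem_univ m), if_neg hm]
      have h3 : ∑ σ : Equiv.Perm (Fin (2 * n)), ((Equiv.Perm.sign σ : ℤ) : ℂ) *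
          (A (σ (b m)) (σ (a m)) * R σ) =
          -∑ σ : Equiv.Perm (Fin (2 * n)), ((Equiv.Perm.sign σ : ℤ) : ℂ) *
          (A (σ (a m)) (σ (b m)) * R σ) := by
        rw [← Finset.sum_neg_distrib]
        refine Fintype.sum_equiv (Equiv.mulRight (Equiv.swap (a m) (b m))) _ _ fun σ => ?_
        have hRσ : R (σ * Equiv.swap (a m) (b m)) = R σ := by
          refine Finset.prod_congr rfl fun k hk => ?_
          have hkm := Finset.ne_of_mem_erase hk
          have e1 : Equiv.swap (a m) (b m) (a k) = a k :=
            Equiv.swap_apply_of_ne_of_ne (haa _ _ hkm) (hab _ _)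
          have e2 : Equiv.swap (a m) (b m) (b k) = b k :=
            Equiv.swap_apply_of_ne_of_ne (hab _ _).symm (hbb _ _ hkm)
          simp only [Equiv.Perm.mul_apply, e1, e2]
        rw [Equiv.coe_mulRight, hRσ, Equiv.Perm.sign_mul, Equiv.Perm.sign_swap (hab m m)]
        simp only [Equiv.Perm.mul_apply, Equiv.swap_apply_left, Equiv.swap_apply_right]
        push_cast
        ring
      simp_rw [h1, h2]
      calc _ = (1 / 2) * (∑ σ : Equiv.Perm (Fin (2 * n)), ((Equiv.Perm.sign σ : ℤ) : ℂ) *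
            (A (σ (a m)) (σ (b m)) * R σ)) - (1 / 2) * ∑ σ : Equiv.Perm (Fin (2 * n)),
              ((Equiv.Perm.sign σ : ℤ) : ℂ) * (A (σ (b m)) (σ (a m)) * R σ) := by
            rw [Finset.mul_sum, Finset.mul_sum, ← Finset.sum_sub_distrib]
            exact Finset.sum_congr rfl fun σ _ => by ring
        _ = _ := by rw [h3]; ring
  simpa using key Finset.univ

theorem integral_prod_pow_mul_deriv {w : ℝ → ℂ}
    (hw : ∀ k : ℕ, Integrable fun x : ℝ => (x : ℂ) ^ k * w x) {n : ℕ} (u v : Fin n → ℕ) :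
    (Integrable fun z : Fin n → ℝ =>
      ∏ k, ((z k : ℂ) ^ u k * ((v k : ℂ) * (z k : ℂ) ^ (v k - 1)) * w (z k))) ∧
    ∫ z : Fin n → ℝ, ∏ k, ((z k : ℂ) ^ u k * ((v k : ℂ) * (z k : ℂ) ^ (v k - 1)) * w (z k)) =
      ∏ k, ∫ x : ℝ, (x : ℂ) ^ u k * ((v k : ℂ) * (x : ℂ) ^ (v k - 1)) * w x := by
  have hw2 : ∀ i j : ℕ, Integrable fun x : ℝ =>
      (x : ℂ) ^ i * ((j : ℂ) * (x : ℂ) ^ (j - 1)) * w x := by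
    intro i j
    refine ((hw (i + (j - 1))).const_mul (j : ℂ)).congr (ae_of_all _ fun x => ?_)
    simp only [pow_add]; ring
  exact ⟨Integrable.fintype_prod
    (f := fun k (x : ℝ) => (x : ℂ) ^ u k * ((v k : ℂ) * (x : ℂ) ^ (v k - 1)) * w x)
      fun k => hw2 _ _, integral_fintype_prod_volume_eq_prod
    (f := fun k (x : ℝ) => (x : ℂ) ^ u k * ((v k : ℂ) * (x : ℂ) ^ (v k - 1)) * w x)⟩

/-- The confluent determinant expanded over permutations and grouped by its row pairs: each factor
depends on a single `z_k`, so the integral splits into one-dimensional ones. -/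
theorem vandermonde_pow_four_mul_prod {n : ℕ} (w : ℝ → ℂ) (z : Fin n → ℝ) :
    (vandermonde z : ℂ) ^ 4 * ∏ i, w (z i) =
      ∑ σ : Equiv.Perm (Fin (2 * n)), ((Equiv.Perm.sign σ : ℤ) : ℂ) *
        ∏ k : Fin n, ((z k : ℂ) ^ (σ ⟨2 * k, by omega⟩).1 *
          (((σ ⟨2 * k + 1, by omega⟩).1 : ℂ) *
          (z k : ℂ) ^ ((σ ⟨2 * k + 1, by omega⟩).1 - 1)) * w (z k)) := by
  rw [← det_confluent_eq_vandermonde, ← Matrix.det_transpose, Matrix.det_apply', Finset.sum_mul]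
  refine Finset.sum_congr rfl fun σ _ => ?_
  rw [mul_assoc, prod_pairEquiv, ← Finset.prod_mul_distrib]
  refine congrArg₂ _ rfl (Finset.prod_congr rfl fun k _ => ?_)
  have e1 : (2 * (k : ℕ) + 1) / 2 = k := by omega
  have e2 : (2 * (k : ℕ) + 1) % 2 = 1 := by omega
  have e3 : (2 * (k : ℕ)) / 2 = k := by omega
  have e4 : (2 * (k : ℕ)) % 2 = 0 := by omega
  simp only [confluent, Matrix.transpose_apply, e1, e2, e3, e4, if_true, one_ne_zero, if_false,
    Fin.eta]

/-- Integrating the expansion of `Δ⁴` gives an alternating sum of products of the integrals `D i j`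
of `xⁱ (xʲ)' w`. The moments in the Pfaffian are the antisymmetrization of `D`, which leaves such a
sum unchanged. The prefactor is that of the definition of `pfaffian` as a sum over all permutations.
-/
theorem deBruijn {w : ℝ → ℂ} (hw : ∀ k : ℕ, Integrable fun x : ℝ => (x : ℂ) ^ k * w x) (n : ℕ) :
    (Integrable fun z : Fin n → ℝ => (vandermonde z : ℂ) ^ 4 * ∏ i, w (z i)) ∧
    pfaffian (Matrix.of fun i j : Fin (2 * n) => -(1 / 2) * ∫ x : ℝ,
      ((i.1 : ℂ) * (x : ℂ) ^ (i.1 - 1) * (x : ℂ) ^ j.1 -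
        (x : ℂ) ^ i.1 * ((j.1 : ℂ) * (x : ℂ) ^ (j.1 - 1))) * w x) =
      (1 / (2 ^ n * n.factorial : ℂ)) *
        ∫ z : Fin n → ℝ, (vandermonde z : ℂ) ^ 4 * ∏ i, w (z i) := by
  set D : ℕ → ℕ → ℂ := fun i j => ∫ x : ℝ, (x : ℂ) ^ i * ((j : ℂ) * (x : ℂ) ^ (j - 1)) * w x with hD
  have hw2 : ∀ i j : ℕ, Integrable fun x : ℝ =>
      (x : ℂ) ^ i * ((j : ℂ) * (x : ℂ) ^ (j - 1)) * w x := by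
    intro i j
    refine ((hw (i + (j - 1))).const_mul (j : ℂ)).congr (ae_of_all _ fun x => ?_)
    simp only [pow_add]; ring
  have hM : ∀ i j : ℕ, -(1 / 2) * ∫ x : ℝ,
      ((i : ℂ) * (x : ℂ) ^ (i - 1) * (x : ℂ) ^ j -
        (x : ℂ) ^ i * ((j : ℂ) * (x : ℂ) ^ (j - 1))) * w x = (1 / 2) * (D i j - D j i) := by
    intro i j
    simp only [hD]
    rw [← integral_sub (hw2 _ _) (hw2 _ _), ← integral_const_mul, ← integral_const_mul]
    congr 1; funext x; ring
  have hint := fun σ : Equiv.Perm (Fin (2 * n)) => integral_prod_pow_mul_deriv hw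
    (fun k : Fin n => (σ ⟨2 * k, by omega⟩).1) (fun k : Fin n => (σ ⟨2 * k + 1, by omega⟩).1)
  simp only [hM]
  rw [funext (vandermonde_pow_four_mul_prod w)]
  refine ⟨integrable_finsetSum _ fun σ _ => (hint σ).1.const_mul _, ?_⟩
  rw [integral_finsetSum _ fun σ _ => (hint σ).1.const_mul _, pfaffian]
  refine congrArg₂ _ rfl ?_
  refine (sum_sign_prod_antisymm (Matrix.of fun i j : Fin (2 * n) => D i j)).trans
    (Finset.sum_congr rfl fun σ _ => ?_)
  rw [integral_const_mul, (hint σ).2]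
  rfl

/-! ### The matrix integrals -/

theorem trace_potential {ι : Type} [Fintype ι] [DecidableEq ι] {A : Matrix ι ι ℂ}
    (hA : A.IsHermitian) (U : ℝ → ℝ) (t : Times) :
    (potential U t A).trace = ∑ i, ((U (hA.eigenvalues i) : ℂ) + timeSum t (hA.eigenvalues i)) := by
  rw [potential, Matrix.trace_add, Finset.sum_add_distrib]
  congr 1
  · rw [hA.cfc_eq, Matrix.IsHermitian.cfc, Unitary.conjStarAlgAut_apply, Matrix.trace_mul_cycle]
    simp [Matrix.trace_diagonal]
  · simp only [Finsupp.sum, timeSum, Matrix.trace_sum, Matrix.trace_smul, trace_pow_eq_powSum hA,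
      powSum, smul_eq_mul, Finset.mul_sum]
    rw [Finset.sum_comm]

theorem exp_trace_potential {ι : Type} [Fintype ι] [DecidableEq ι] {A : Matrix ι ι ℂ}
    (hA : A.IsHermitian) (V : ℝ → ℝ) (t : Times) :
    Complex.exp (potential (fun z => -V z) t A).trace = ∏ i, rho V t (hA.eigenvalues i) := by
  rw [trace_potential hA, Complex.exp_sum]
  simp [rho]

theorem hermWeight_eq {n : ℕ} (V : ℝ → ℝ) (t : Times) (c : HermCoord n) :
    hermWeight V t c = ∏ i, rho V t ((isHermitian_hermMatrix c).eigenvalues i) :=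
  exp_trace_potential _ V t

theorem quatWeight_eq {n : ℕ} (U : ℝ → ℝ) (t : Times) (c : QuatCoord n) :
    quatWeight U t c = ∏ i, rho U t ((isHermitian_quatMatrix c).eigenvalues i) := by
  rw [← exp_trace_potential, quatWeight, quatTrace, mul_div_cancel₀ _ two_ne_zero]

theorem spectrum_subset_iff {ι : Type} [Fintype ι] [DecidableEq ι] {A : Matrix ι ι ℂ}
    (hA : A.IsHermitian) (E : Set ℝ) : spectrum ℝ A ⊆ E ↔ ∀ i, hA.eigenvalues i ∈ E := by
  rw [hA.spectrum_real_eq_range_eigenvalues, Set.range_subset_iff]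

/-- A product of weights, set to zero unless all the arguments are in `E`. -/
theorem indicator_prod {X ι : Type} [Fintype ι] (E : Set ℝ) (w : ℝ → ℂ) (y : X → ι → ℝ) :
    {c | ∀ i, y c i ∈ E}.indicator (fun c => ∏ i, w (y c i)) =
      fun c => ∏ i, E.indicator w (y c i) := by
  funext c
  by_cases h : ∀ i, y c i ∈ E
  · rw [Set.indicator_of_mem (by exact h)]
    exact Finset.prod_congr rfl fun i _ => (Set.indicator_of_mem (h i) _).symm
  · rw [Set.indicator_of_notMem (by exact h)]
    push Not at h
    obtain ⟨i, hi⟩ := h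
    exact (Finset.prod_eq_zero (Finset.mem_univ i) (Set.indicator_of_notMem hi _)).symm

theorem continuous_timeSum (t : Times) : Continuous (timeSum t) := by
  unfold timeSum Finsupp.sum
  fun_prop

theorem continuousOn_rho {E : Set ℝ} {V : ℝ → ℝ} (hV : ContinuousOn V E) (t : Times) :
    ContinuousOn (rho V t) E := by
  have := (continuous_timeSum t).comp Complex.continuous_ofReal
  unfold rho
  refine Complex.continuous_exp.comp_continuousOn (ContinuousOn.add ?_ this.continuousOn)
  exact (Complex.continuous_ofReal.comp_continuousOn hV).neg

theorem measurable_indicator_of_continuousOn {E : Set ℝ} (hE : MeasurableSet E) {w : ℝ → ℂ}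
    (hw : ContinuousOn w E) : Measurable (E.indicator w) := by
  classical
  rw [← Set.piecewise_eq_indicator]
  exact hw.measurable_piecewise continuousOn_const hE

theorem integrable_pow_mul_indicator {E : Set ℝ} (hE : MeasurableSet E) {w : ℝ → ℂ} {k : ℕ}
    (hw : IntegrableOn (fun z : ℝ => (z : ℂ) ^ k * w z) E) :
    Integrable fun x : ℝ => (x : ℂ) ^ k * E.indicator w x := by
  rw [← integrable_indicator_iff hE] at hw
  refine hw.congr (ae_of_all _ fun x => ?_)
  by_cases hx : x ∈ E <;> simp [hx]

theorem integral_mul_indicator {E : Set ℝ} (hE : MeasurableSet E) (w φ : ℝ → ℂ) :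
    ∫ x, φ x * E.indicator w x = ∫ x in E, φ x * w x := by
  rw [← integral_indicator hE]
  congr 1; funext x
  by_cases hx : x ∈ E <;> simp [hx]

/-! ### Matrix integrals over a spectral domain, and their positivity -/

section Integrals

variable {E : Set ℝ} {V : ℝ → ℝ} {t : Times}

theorem tau_eq_integral_vandermonde (hE : MeasurableSet E) (ht : Admissible E V t) (n : ℕ) :
    tau E V t n = (1 / (n.factorial : ℂ)) *
      ∫ z : Fin n → ℝ, (vandermonde z : ℂ) ^ 2 * ∏ i, E.indicator (rho V t) (z i) := by
  rw [← (andreief (fun k => integrable_pow_mul_indicator hE (ht k)) n).2, tau, leadingDet]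
  congr 1; ext i j
  simp only [Matrix.of_apply, moment, symIP, pfun]
  rw [integral_mul_indicator hE]
  simp

theorem herm_integral (hE : MeasurableSet E) (hV : ContinuousOn V E) (ht : Admissible E V t)
    (n : ℕ) : IntegrableOn (hermWeight V t) (hermDomain E n) (hermMeasure n) ∧
      tau E V t n = (1 / (n.factorial : ℂ)) * ∫ c in hermDomain E n, hermWeight V t c ∂hermMeasure n := by
  have hm := measurable_indicator_of_continuousOn hE (continuousOn_rho hV t)
  have hdom : hermDomain E n = {c | ∀ i, (isHermitian_hermMatrix c).eigenvalues i ∈ E} :=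
    Set.ext fun c => spectrum_subset_iff (isHermitian_hermMatrix c) E
  have hdm : MeasurableSet (hermDomain E n) := by
    rw [hdom]
    have hy : Measurable fun c : HermCoord n => (isHermitian_hermMatrix c).eigenvalues :=
      measurable_eigenvalues (X := fun c => hermLin n c)
        (fun i j => by
          exact (LinearMap.continuous_of_finiteDimensional
            ((LinearMap.proj j ∘ₗ LinearMap.proj i) ∘ₗ hermLin n :
              HermCoord n →ₗ[ℝ] ℂ)).measurable) _
    have := hy (MeasurableSet.univ_pi fun _ => hE)
    simpa only [Set.pi, Set.preimage, Set.mem_univ, true_imp_iff, Set.mem_ofPred_eq] using this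
  have hind : (hermDomain E n).indicator (hermWeight V t) =
      fun c => ∏ i, E.indicator (rho V t) ((isHermitian_hermMatrix c).eigenvalues i) := by
    rw [← indicator_prod, hdom]
    congr 1; funext c; exact hermWeight_eq V t c
  have key := herm_weyl n (F := fun z => ∏ i, E.indicator (rho V t) (z i))
    (Finset.measurable_prod _ fun i _ => hm.comp (measurable_pi_apply i))
    (fun σ z => Equiv.prod_comp σ fun i => E.indicator (rho V t) (z i))
    (andreief (fun k => integrable_pow_mul_indicator hE (ht k)) n).1
  rw [← integrable_indicator_iff hdm, ← integral_indicator hdm, hind,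
    tau_eq_integral_vandermonde hE ht]
  exact ⟨key.1, by rw [key.2]⟩

theorem quat_integral (hE : MeasurableSet E) {U : ℝ → ℝ} (hU : ContinuousOn U E)
    (ht : ∀ k : ℕ, IntegrableOn (fun z : ℝ => (z : ℂ) ^ k * rho U t z ^ 2) E)
    (n : ℕ) : IntegrableOn (quatWeight U t) (quatDomain E n) (quatMeasure n) ∧
      ∫ c in quatDomain E n, quatWeight U t c ∂quatMeasure n =
        ∫ z : Fin n → ℝ, (vandermonde z : ℂ) ^ 4 *
          ∏ i, E.indicator (fun x => rho U t x ^ 2) (z i) := by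
  have hm := measurable_indicator_of_continuousOn hE (continuousOn_rho hU t)
  have hdom : quatDomain E n = {c | ∀ i, (isHermitian_quatMatrix c).eigenvalues i ∈ E} :=
    Set.ext fun c => spectrum_subset_iff (isHermitian_quatMatrix c) E
  have hdm : MeasurableSet (quatDomain E n) := by
    rw [hdom]
    have hy : Measurable fun c : QuatCoord n => (isHermitian_quatMatrix c).eigenvalues :=
      measurable_eigenvalues (X := fun c => quatLin n c)
        (fun i j => by
          exact (LinearMap.continuous_of_finiteDimensional
            ((LinearMap.proj j ∘ₗ LinearMap.proj i) ∘ₗ quatLin n :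
              QuatCoord n →ₗ[ℝ] ℂ)).measurable) _
    have := hy (MeasurableSet.univ_pi fun _ => hE)
    simpa only [Set.pi, Set.preimage, Set.mem_univ, true_imp_iff, Set.mem_ofPred_eq] using this
  have hind : (quatDomain E n).indicator (quatWeight U t) =
      fun c => ∏ i, E.indicator (rho U t) ((isHermitian_quatMatrix c).eigenvalues i) := by
    rw [← indicator_prod, hdom]
    congr 1; funext c; exact quatWeight_eq U t c
  -- The doubling of the eigenvalues is what produces the squared weight.
  have hsq : ∀ z : Fin n → ℝ, ∏ p : Fin n × Fin 2, E.indicator (rho U t) (z p.1) =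
      ∏ i, E.indicator (fun x => rho U t x ^ 2) (z i) := by
    intro z
    rw [Fintype.prod_prod_type]
    refine Finset.prod_congr rfl fun i _ => ?_
    by_cases h : z i ∈ E <;> simp [h]
  have key := quat_weyl n (F := fun z => ∏ p, E.indicator (rho U t) (z p))
    (Finset.measurable_prod _ fun i _ => hm.comp (measurable_pi_apply i))
    (fun σ z => Equiv.prod_comp σ fun i => E.indicator (rho U t) (z i))
    (by simp only [hsq]
        exact (deBruijn (fun k => integrable_pow_mul_indicator hE (ht k)) n).1)
  rw [← integrable_indicator_iff hdm, ← integral_indicator hdm, hind]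
  exact ⟨key.1, by rw [key.2]; simp only [hsq]⟩

/-- The integral of a power of the Vandermonde determinant against a positive weight. -/
theorem exists_pos_eq_integral_vandermonde (hE : IsOpen E) (hne : E.Nonempty) (n d : ℕ)
    {w : ℝ → ℂ} {r : ℝ → ℝ} (hr : ∀ x ∈ E, 0 < r x) (hwr : ∀ x ∈ E, w x = r x)
    (hint : Integrable fun z : Fin n → ℝ =>
      (vandermonde z : ℂ) ^ (2 * d) * ∏ i, E.indicator w (z i)) :
    ∃ s : ℝ, 0 < s ∧
      ∫ z : Fin n → ℝ, (vandermonde z : ℂ) ^ (2 * d) * ∏ i, E.indicator w (z i) = s := by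
  have e : (fun z : Fin n → ℝ => (vandermonde z : ℂ) ^ (2 * d) * ∏ i, E.indicator w (z i)) =
      fun z => ((vandermonde z ^ (2 * d) * ∏ i, E.indicator r (z i) : ℝ) : ℂ) := by
    funext z
    push_cast
    congr 1
    refine Finset.prod_congr rfl fun i _ => ?_
    by_cases h : z i ∈ E
    · simp [h, hwr]
    · simp [h]
  rw [e] at hint ⊢
  refine ⟨_, integral_vandermonde_pos hE hne n d (w := fun z => ∏ i, E.indicator r (z i)) ?_ ?_ ?_,
    integral_complex_ofReal⟩
  · exact fun z => Finset.prod_nonneg fun i _ => Set.indicator_nonneg (fun x hx => (hr x hx).le) _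
  · exact fun z hz => Finset.prod_pos fun i _ => by
      rw [Set.indicator_of_mem (hz i)]; exact hr _ (hz i)
  · exact hint.re.congr (ae_of_all _ fun z => Complex.ofReal_re _)

theorem rho_eq_ofReal (V : ℝ → ℝ) (ht : IsRealTimes t) (z : ℝ) :
    rho V t z = (Real.exp (-V z + (timeSum t z).re) : ℝ) := by
  have : ((timeSum t z).re : ℂ) = timeSum t z := by
    refine Complex.conj_eq_iff_re.1 ?_
    simp only [timeSum, Finsupp.sum, map_sum, map_mul, map_pow, Complex.conj_ofReal]
    refine Finset.sum_congr rfl fun i _ => ?_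
    rw [Complex.conj_eq_iff_im.2 (ht i)]
  rw [rho, Complex.ofReal_exp]
  push_cast
  rw [this]

theorem tau_pos (hE : IsOpen E) (hne : E.Nonempty) (ht : Admissible E V t) (htr : IsRealTimes t)
    (n : ℕ) : ∃ r : ℝ, 0 < r ∧ tau E V t n = r := by
  obtain ⟨s, hs, h⟩ := exists_pos_eq_integral_vandermonde hE hne n 1
    (r := fun z => Real.exp (-V z + (timeSum t z).re)) (fun _ _ => Real.exp_pos _)
    (fun z _ => rho_eq_ofReal V htr z)
    (andreief (fun k => integrable_pow_mul_indicator hE.measurableSet (ht k)) n).1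
  refine ⟨1 / n.factorial * s, by positivity, ?_⟩
  rw [tau_eq_integral_vandermonde hE.measurableSet ht]
  rw [mul_one] at h
  rw [h]; push_cast; ring

theorem integral_vandermonde_four_pos (hE : IsOpen E) (hne : E.Nonempty) {U : ℝ → ℝ}
    (ht : ∀ k : ℕ, IntegrableOn (fun z : ℝ => (z : ℂ) ^ k * rho U t z ^ 2) E)
    (htr : IsRealTimes t) (n : ℕ) : ∃ r : ℝ, 0 < r ∧ (1 / (2 ^ n * n.factorial : ℂ)) *
      ∫ z : Fin n → ℝ, (vandermonde z : ℂ) ^ 4 *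
        ∏ i, E.indicator (fun x => rho U t x ^ 2) (z i) = r := by
  obtain ⟨s, hs, h⟩ := exists_pos_eq_integral_vandermonde hE hne n 2
    (r := fun z => Real.exp (-U z + (timeSum t z).re) ^ 2) (fun _ _ => by positivity)
    (w := fun x => rho U t x ^ 2)
    (fun z _ => by rw [rho_eq_ofReal U htr z]; push_cast; rfl)
    (deBruijn (fun k => integrable_pow_mul_indicator hE.measurableSet (ht k)) n).1
  refine ⟨1 / (2 ^ n * n.factorial) * s, by positivity, ?_⟩
  rw [show 2 * 2 = 4 from rfl] at h
  rw [h]; push_cast; ring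

end Integrals

/-! ### Analysis on the interval -/

theorem isOpen_interval (a b : EReal) : IsOpen (interval a b) :=
  (isOpen_Ioo (a := a) (b := b)).preimage continuous_coe_real_ereal

theorem nonempty_interval {a b : EReal} (hab : a < b) : (interval a b).Nonempty := by
  obtain ⟨x, h1, h2⟩ := EReal.lt_iff_exists_real_btwn.1 hab
  exact ⟨x, h1, h2⟩

theorem timeSum_add (t u : Times) (z : ℂ) : timeSum (t + u) z = timeSum t z + timeSum u z :=
  Finsupp.sum_add_index' (by simp) (by intros; ring)

theorem timeSum_smul (c : ℂ) (t : Times) (z : ℂ) : timeSum (c • t) z = c * timeSum t z := by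
  rw [timeSum, Finsupp.sum_smul_index (by simp), timeSum, Finsupp.mul_sum]
  simp only [mul_assoc]

theorem timeSum_single (j : ℕ+) (s z : ℂ) : timeSum (Finsupp.single j s) z = s * z ^ (j : ℕ) :=
  Finsupp.sum_single_index (by simp)

/-- The derivative of `timeSum`. -/
def timePoly (t : Times) : Polynomial ℂ :=
  t.sum fun i c => Polynomial.C ((i : ℕ) * c) * Polynomial.X ^ ((i : ℕ) - 1)

theorem hasDerivAt_timeSum (t : Times) (z : ℂ) :
    HasDerivAt (timeSum t) ((timePoly t).eval z) z := by
  unfold timeSum timePoly Finsupp.sum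
  rw [Polynomial.eval_finsetSum]
  refine HasDerivAt.fun_sum fun i _ => ?_
  refine ((hasDerivAt_pow (i : ℕ) z).const_mul (t i)).congr_deriv ?_
  simp only [Polynomial.eval_mul, Polynomial.eval_C, Polynomial.eval_pow, Polynomial.eval_X]
  ring

theorem hasDerivAt_pfun (P : Polynomial ℂ) (z : ℝ) :
    HasDerivAt (pfun P) (pfun (Polynomial.derivative P) z) z :=
  (P.hasDerivAt (z : ℂ)).comp_ofReal

/-- A real polynomial as a complex polynomial. -/
abbrev toC (f : Polynomial ℝ) : Polynomial ℂ := f.map (algebraMap ℝ ℂ)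

theorem pfun_toC (f : Polynomial ℝ) (z : ℝ) : pfun (toC f) z = (f.eval z : ℝ) := by
  rw [pfun, toC, Polynomial.eval_map]
  exact Polynomial.eval₂_at_apply (algebraMap ℝ ℂ) z

/-- The operator `𝕟_t` on polynomials. -/
def nPoly (f g : Polynomial ℝ) (t : Times) (P : Polynomial ℂ) : Polynomial ℂ :=
  toC f * Polynomial.derivative P + Polynomial.C (1 / 2) *
    ((Polynomial.derivative (toC f) - toC g + toC f * timePoly t) * P)

theorem pfun_add (P Q : Polynomial ℂ) (z : ℝ) : pfun (P + Q) z = pfun P z + pfun Q z := by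
  simp [pfun]

theorem pfun_sub (P Q : Polynomial ℂ) (z : ℝ) : pfun (P - Q) z = pfun P z - pfun Q z := by
  simp [pfun]

theorem pfun_mul (P Q : Polynomial ℂ) (z : ℝ) : pfun (P * Q) z = pfun P z * pfun Q z := by
  simp [pfun]

theorem pfun_C (c : ℂ) (z : ℝ) : pfun (Polynomial.C c) z = c := by
  simp [pfun]

/-- With `r = √(f ρ)` the prefactor `√(f/ρ)` is `f / r`, and `(f ρ)' = (f' - g) ρ` gives `r' = (f' -
g) ρ / (2r)`. All exponentials and roots then cancel, leaving a polynomial. -/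
theorem nOp_pfun {f g : Polynomial ℝ} {V : ℝ → ℝ} {z : ℝ} (hf : 0 < f.eval z)
    (hV : HasDerivAt V (g.eval z / f.eval z) z) (t : Times) (P : Polynomial ℂ) :
    nOp f V t (pfun P) z = pfun (nPoly f g t P) z := by
  set r : ℝ := Real.sqrt (f.eval z * Real.exp (-V z)) with hr
  have hpos : 0 < f.eval z * Real.exp (-V z) := by positivity
  have hr0 : 0 < r := Real.sqrt_pos.2 hpos
  have hrr : r * r = f.eval z * Real.exp (-V z) := Real.mul_self_sqrt hpos.le
  have hq : Real.sqrt (f.eval z / Real.exp (-V z)) = f.eval z / r := by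
    rw [eq_div_iff hr0.ne', hr, ← Real.sqrt_mul (by positivity)]
    rw [show f.eval z / Real.exp (-V z) * (f.eval z * Real.exp (-V z)) = f.eval z ^ 2 by
      field_simp]
    exact Real.sqrt_sq hf.le
  have h1 : HasDerivAt (fun x => Real.sqrt (f.eval x * Real.exp (-V x)))
      (((Polynomial.derivative f).eval z - g.eval z) * Real.exp (-V z) / (2 * r)) z := by
    refine ((f.hasDerivAt z).mul hV.fun_neg.exp).sqrt hpos.ne' |>.congr_deriv ?_
    congr 1
    field_simp
    ring
  have h2 : HasDerivAt (fun x : ℝ => Complex.exp (timeSum t x / 2))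
      (Complex.exp (timeSum t z / 2) * ((timePoly t).eval (z : ℂ) / 2)) z :=
    (((hasDerivAt_timeSum t z).div_const 2).cexp).comp_ofReal
  have h3 := ((h1.ofReal_comp.mul h2).mul (hasDerivAt_pfun P z)).deriv
  simp only [Pi.mul_def] at h3
  unfold nOp
  rw [h3, hq, ← hr]
  have hrC : (r : ℂ) ≠ 0 := by exact_mod_cast hr0.ne'
  have hrrC : (r : ℂ) * r = (f.eval z : ℝ) * Complex.exp (-V z) := by
    rw [← Complex.ofReal_neg, ← Complex.ofReal_exp]; exact_mod_cast hrr
  have hfC : ((f.eval z : ℝ) : ℂ) ≠ 0 := by exact_mod_cast hf.ne'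
  have hee : Complex.exp (-(timeSum t z / 2)) * Complex.exp (timeSum t z / 2) = 1 := by
    rw [← Complex.exp_add]; simp
  have hT : (timePoly t).eval (z : ℂ) = pfun (timePoly t) z := rfl
  have hD : pfun (Polynomial.derivative (toC f)) z = ((Polynomial.derivative f).eval z : ℝ) := by
    rw [toC, Polynomial.derivative_map]; exact pfun_toC _ z
  simp only [nPoly, pfun_add, pfun_mul, pfun_sub, pfun_C, pfun_toC, hD, hT]
  push_cast
  have hrinv : Complex.exp (-V z) / r / r = 1 / (f.eval z : ℝ) := by
    rw [div_div, hrrC]; field_simp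
  calc _ = Complex.exp (-(timeSum t z / 2)) * Complex.exp (timeSum t z / 2) *
        ((f.eval z : ℝ) * (((Polynomial.derivative f).eval z : ℝ) - (g.eval z : ℝ)) *
          (Complex.exp (-V z) / r / r) / 2 * pfun P z +
          (f.eval z : ℝ) * ((r : ℂ) / r) * (pfun (timePoly t) z / 2 * pfun P z +
            pfun (Polynomial.derivative P) z)) := by ring
    _ = _ := by
      rw [hee, hrinv, div_self hrC]
      field_simp
      ring

/-- The integral of a polynomial against the weight. -/
def momentLin (E : Set ℝ) (V : ℝ → ℝ) (t : Times) (P : Polynomial ℂ) : ℂ :=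
  ∫ z in E, pfun P z * rho V t z

/-! ### The moment functional and its derivatives in the times -/

section General

variable {E : Set ℝ} {V : ℝ → ℝ} {t : Times}

theorem Admissible.integrableOn (ht : Admissible E V t) (P : Polynomial ℂ) :
    IntegrableOn (fun z => pfun P z * rho V t z) E := by
  have : ∀ z : ℝ, pfun P z * rho V t z =
      ∑ k ∈ Finset.range (P.natDegree + 1), P.coeff k * ((z : ℂ) ^ k * rho V t z) := by
    intro z
    rw [pfun, Polynomial.eval_eq_sum_range, Finset.sum_mul]
    exact Finset.sum_congr rfl fun k _ => by ring
  simp_rw [this]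
  exact integrable_finsetSum _ fun k _ => (ht k).const_mul _

theorem symIP_pfun (P Q : Polynomial ℂ) :
    symIP E V t (pfun P) (pfun Q) = momentLin E V t (P * Q) := by
  simp only [symIP, momentLin, pfun_mul]

theorem Admissible.momentLin_add (ht : Admissible E V t) (P Q : Polynomial ℂ) :
    momentLin E V t (P + Q) = momentLin E V t P + momentLin E V t Q := by
  simp only [momentLin, pfun_add, add_mul]
  exact integral_add (ht.integrableOn P) (ht.integrableOn Q)

theorem momentLin_C_mul (c : ℂ) (P : Polynomial ℂ) :
    momentLin E V t (Polynomial.C c * P) = c * momentLin E V t P := by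
  simp only [momentLin, pfun_mul, pfun_C, mul_assoc]
  exact integral_const_mul _ _

/-- `momentLin` as a linear map. -/
def momentMap (ht : Admissible E V t) : Polynomial ℂ →ₗ[ℂ] ℂ where
  toFun := momentLin E V t
  map_add' := ht.momentLin_add
  map_smul' c P := by
    rw [Polynomial.smul_eq_C_mul, momentLin_C_mul]; rfl

theorem momentMap_apply (ht : Admissible E V t) (P : Polynomial ℂ) :
    momentMap ht P = momentLin E V t P := rfl

/-- The mean value inequality for `x ↦ exp (x u)` on `[0, 1]`; there `exp (x Re u)` is at most `1`
or at most `exp (Re u)`, according to the sign of `Re u`. -/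
theorem norm_exp_sub_one_le_mul (u : ℂ) :
    ‖Complex.exp u - 1‖ ≤ ‖u‖ * (1 + Real.exp u.re) := by
  have h := (convex_Icc (0 : ℝ) 1).norm_image_sub_le_of_norm_hasDerivWithin_le
    (f := fun x : ℝ => Complex.exp (x * u)) (f' := fun x : ℝ => Complex.exp (x * u) * u)
    (C := ‖u‖ * (1 + Real.exp u.re)) (x := 0) (y := 1)
    (fun x _ => by
      have := ((hasDerivAt_id (x : ℂ)).mul_const u).cexp.comp_ofReal
      simp only [id, one_mul] at this
      exact this.hasDerivWithinAt)
    (fun x hx => by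
      rw [norm_mul, mul_comm, Complex.norm_exp]
      refine mul_le_mul_of_nonneg_left ?_ (norm_nonneg _)
      rw [Complex.re_ofReal_mul]
      rcases le_total 0 u.re with h | h
      · have : x * u.re ≤ u.re := by nlinarith [hx.2]
        have := Real.exp_le_exp.2 this
        linarith
      · have : x * u.re ≤ 0 := by nlinarith [hx.1]
        have := Real.exp_le_one_iff.2 this
        linarith [Real.exp_pos u.re])
    (by simp) (by simp)
  simpa using h

theorem rho_add_single (V : ℝ → ℝ) (t : Times) (j : ℕ+) (s : ℂ) (z : ℝ) :
    rho V (t + Finsupp.single j s) z = rho V t z * Complex.exp (s * (z : ℂ) ^ (j : ℕ)) := by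
  rw [rho, rho, ← Complex.exp_add, timeSum_add, timeSum_single, add_assoc]

/-- Since `I` need not contain a neighbourhood of `0`, domination may use only exponents from `I`.
If some point of `I` has positive real part, it dominates all points near `0`; otherwise the
exponentials are at most `1`. The next lemma is the mirror image, needed where `zʲ` is negative. -/
theorem exists_mem_re_bound {I : Set ℂ} (h0 : (0 : ℂ) ∈ I) :
    ∃ s₀ ∈ I, ∀ᶠ s in 𝓝[I] (0 : ℂ), ∀ w : ℝ, 0 ≤ w → Real.exp (s.re * w) ≤ 1 + Real.exp (s₀.re * w) := by
  by_cases h : ∃ s₀ ∈ I, 0 < s₀.re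
  · obtain ⟨s₀, hs₀, hre⟩ := h
    refine ⟨s₀, hs₀, ?_⟩
    have : ∀ᶠ s in 𝓝 (0 : ℂ), s.re < s₀.re :=
      Complex.continuous_re.continuousAt.eventually_lt continuousAt_const (by simpa using hre)
    filter_upwards [this.filter_mono nhdsWithin_le_nhds] with s hs w hw
    have := Real.exp_le_exp.2 (mul_le_mul_of_nonneg_right hs.le hw)
    linarith
  · push Not at h
    refine ⟨0, h0, ?_⟩
    filter_upwards [self_mem_nhdsWithin] with s hs w hw
    have := Real.exp_le_one_iff.2 (mul_nonpos_of_nonpos_of_nonneg (h s hs) hw)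
    linarith [Real.exp_pos ((0 : ℂ).re * w)]

theorem exists_mem_neg_re_bound {I : Set ℂ} (h0 : (0 : ℂ) ∈ I) :
    ∃ s₀ ∈ I, ∀ᶠ s in 𝓝[I] (0 : ℂ), ∀ w : ℝ, w ≤ 0 → Real.exp (s.re * w) ≤ 1 + Real.exp (s₀.re * w) := by
  by_cases h : ∃ s₀ ∈ I, s₀.re < 0
  · obtain ⟨s₀, hs₀, hre⟩ := h
    refine ⟨s₀, hs₀, ?_⟩
    have : ∀ᶠ s in 𝓝 (0 : ℂ), s₀.re < s.re :=
      continuousAt_const.eventually_lt Complex.continuous_re.continuousAt (by simpa using hre)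
    filter_upwards [this.filter_mono nhdsWithin_le_nhds] with s hs w hw
    have := Real.exp_le_exp.2 (mul_le_mul_of_nonpos_right hs.le hw)
    linarith
  · push Not at h
    refine ⟨0, h0, ?_⟩
    filter_upwards [self_mem_nhdsWithin] with s hs w hw
    have := Real.exp_le_one_iff.2 (mul_nonpos_of_nonneg_of_nonpos (h s hs) hw)
    linarith [Real.exp_pos ((0 : ℂ).re * w)]

/-- Dominated convergence of difference quotients. The majorant is built from the weights at two
parameters `s₀`, `s₁` of `I`, which are integrable by admissibility on `I` alone. -/
theorem hasDerivWithinAt_momentLin {j : ℕ+} {I : Set ℂ} (h0 : (0 : ℂ) ∈ I)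
    (hI : ∀ s ∈ I, Admissible E V (t + Finsupp.single j s)) (P : Polynomial ℂ) :
    HasDerivWithinAt (fun s => momentLin E V (t + Finsupp.single j s) P)
      (momentLin E V t (Polynomial.X ^ (j : ℕ) * P)) I 0 := by
  obtain ⟨s₀, hs₀, hb₀⟩ := exists_mem_re_bound h0
  obtain ⟨s₁, hs₁, hb₁⟩ := exists_mem_neg_re_bound h0
  have ht : Admissible E V t := by simpa using hI 0 h0
  set Q : Polynomial ℂ := Polynomial.X ^ (j : ℕ) * P with hQ
  rw [hasDerivWithinAt_iff_tendsto_slope]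
  have hle : 𝓝[I \ {0}] (0 : ℂ) ≤ 𝓝[I] 0 := nhdsWithin_mono _ Set.sdiff_subset
  have hmem : ∀ᶠ s in 𝓝[I \ {0}] (0 : ℂ), s ∈ I \ {0} := self_mem_nhdsWithin
  have hslope : ∀ᶠ s in 𝓝[I \ {0}] (0 : ℂ), ∫ z in E, pfun P z * rho V t z *
      (s⁻¹ * (Complex.exp (s * (z : ℂ) ^ (j : ℕ)) - 1)) =
      slope (fun s => momentLin E V (t + Finsupp.single j s) P) 0 s := by
    filter_upwards [hmem] with s hs
    rw [slope_def_field, momentLin, momentLin, sub_zero,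
      ← integral_sub ((hI s hs.1).integrableOn P) ((hI 0 h0).integrableOn P), ← integral_div]
    congr 1; funext z
    simp only [rho_add_single, zero_mul, Complex.exp_zero]
    ring
  refine Tendsto.congr' hslope ?_
  refine tendsto_integral_filter_of_dominated_convergence
    -- One unit of the `2` comes from the bound on `exp u - 1`, the other from the bound on `exp (Re
    -- u)` by `1` plus an exponential; the two exponentials cover the two signs of `zʲ`.
    (fun z => 2 * ‖pfun Q z * rho V t z‖ +
      (‖pfun Q z * rho V (t + Finsupp.single j s₀) z‖ +
      ‖pfun Q z * rho V (t + Finsupp.single j s₁) z‖)) ?_ ?_ ?_ ?_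
  · filter_upwards [hmem] with s hs
    have h := ((((hI s hs.1).integrableOn P).sub (ht.integrableOn P)).const_mul s⁻¹)
      |>.aestronglyMeasurable
    refine h.congr (ae_of_all _ fun z => ?_)
    simp only [Pi.sub_apply, rho_add_single]
    ring
  · filter_upwards [hmem, hb₀.filter_mono hle, hb₁.filter_mono hle] with s hs h1 h2
    refine ae_of_all _ fun z => ?_
    have hz : ∀ s : ℂ, (s * (z : ℂ) ^ (j : ℕ)).re = s.re * z ^ (j : ℕ) := by
      intro s; rw [← Complex.ofReal_pow, Complex.re_mul_ofReal]
    have hs0 : ‖s‖ ≠ 0 := norm_ne_zero_iff.2 hs.2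
    have hexp : ‖s⁻¹ * (Complex.exp (s * (z : ℂ) ^ (j : ℕ)) - 1)‖ ≤
        ‖(z : ℂ) ^ (j : ℕ)‖ * (2 + (Real.exp (s₀.re * z ^ (j : ℕ)) +
          Real.exp (s₁.re * z ^ (j : ℕ)))) := by
      rw [norm_mul, norm_inv, inv_mul_le_iff₀ (by positivity)]
      refine (norm_exp_sub_one_le_mul _).trans ?_
      rw [norm_mul, hz, mul_assoc]
      refine mul_le_mul_of_nonneg_left (mul_le_mul_of_nonneg_left ?_ (norm_nonneg _))
        (norm_nonneg _)
      rcases le_total 0 (z ^ (j : ℕ)) with h | h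
      · linarith [h1 _ h, Real.exp_pos (s₁.re * z ^ (j : ℕ))]
      · linarith [h2 _ h, Real.exp_pos (s₀.re * z ^ (j : ℕ))]
    have hQz : pfun Q z = (z : ℂ) ^ (j : ℕ) * pfun P z := by simp [hQ, pfun]
    rw [norm_mul]
    refine (mul_le_mul_of_nonneg_left hexp (norm_nonneg _)).trans (le_of_eq ?_)
    simp only [rho_add_single, hQz, norm_mul, Complex.norm_exp, hz]
    ring
  · exact ((ht.integrableOn Q).norm.const_mul 2).add
      (((hI s₀ hs₀).integrableOn Q).norm.add ((hI s₁ hs₁).integrableOn Q).norm)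
  · refine ae_of_all _ fun z => ?_
    have hd : HasDerivAt (fun s : ℂ => Complex.exp (s * (z : ℂ) ^ (j : ℕ)))
        ((z : ℂ) ^ (j : ℕ)) 0 := by
      have := ((hasDerivAt_id (0 : ℂ)).mul_const ((z : ℂ) ^ (j : ℕ))).cexp
      simpa using this
    have h := (hasDerivAt_iff_tendsto_slope.1 hd).mono_left
      (nhdsWithin_mono (0 : ℂ) (s := I \ {0}) fun x hx => hx.2)
    have h' := h.const_mul (pfun P z * rho V t z)
    have e : pfun Q z * rho V t z = pfun P z * rho V t z * (z : ℂ) ^ (j : ℕ) := by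
      simp [hQ, pfun]; ring
    rw [e]
    refine h'.congr fun s => ?_
    rw [slope_def_field]
    simp only [zero_mul, Complex.exp_zero, sub_zero]
    ring

end General

/-! ### Integration by parts -/

/-- At an infinite endpoint the integrability of `G` and `G'` already forces `G → 0`, so a boundary
condition is required only at a finite endpoint. -/
theorem integral_left_part {a : EReal} {c : ℝ} (hac : a < c) {G G' : ℝ → ℂ}
    (hd : ∀ z : ℝ, a < z → z ≤ c → HasDerivAt G (G' z) z)
    (hG : IntegrableOn G {x : ℝ | a < x ∧ x ≤ c}) (hG' : IntegrableOn G' {x : ℝ | a < x ∧ x ≤ c})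
    (hlim : ∀ a' : ℝ, a = a' → Tendsto G (𝓝[>] a') (𝓝 0)) :
    ∫ x in {x : ℝ | a < x ∧ x ≤ c}, G' x = G c := by
  induction a using EReal.rec with
  | top => exact absurd hac (by simp)
  | bot =>
    have e : {x : ℝ | (⊥ : EReal) < x ∧ x ≤ c} = Set.Iic c := by
      ext x; simp
    rw [e] at hG hG' ⊢
    have hd' : ∀ x ∈ Set.Iic c, HasDerivAt G (G' x) x := fun x hx => hd x (by simp) hx
    have h0 := tendsto_zero_of_hasDerivAt_of_integrableOn_Iic hd' hG' hG
    rw [integral_Iic_of_hasDerivAt_of_tendsto' hd' hG' h0, sub_zero]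
  | coe a =>
    have e : {x : ℝ | (a : EReal) < x ∧ x ≤ c} = Set.Ioc a c := by
      ext x; simp
    have hac' : a < c := by exact_mod_cast hac
    rw [e] at hG hG' ⊢
    rw [← intervalIntegral.integral_of_le hac'.le,
      intervalIntegral.integral_eq_sub_of_hasDerivAt_of_tendsto (fa := 0) (fb := G c) hac' ?_ ?_
        (hlim a rfl) ?_, sub_zero]
    · exact fun x hx => hd x (by exact_mod_cast hx.1) hx.2.le
    · rwa [intervalIntegrable_iff_integrableOn_Ioc_of_le hac'.le]
    · exact (hd c hac le_rfl).continuousAt.continuousWithinAt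

theorem integral_right_part {b : EReal} {c : ℝ} (hcb : c < b) {G G' : ℝ → ℂ}
    (hd : ∀ z : ℝ, c ≤ z → z < b → HasDerivAt G (G' z) z)
    (hG : IntegrableOn G {x : ℝ | c < x ∧ x < b}) (hG' : IntegrableOn G' {x : ℝ | c < x ∧ x < b})
    (hlim : ∀ b' : ℝ, b = b' → Tendsto G (𝓝[<] b') (𝓝 0)) :
    ∫ x in {x : ℝ | c < x ∧ x < b}, G' x = -G c := by
  induction b using EReal.rec with
  | bot => exact absurd hcb (by simp)
  | top =>
    have e : {x : ℝ | c < x ∧ x < (⊤ : EReal)} = Set.Ioi c := by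
      ext x; simp
    rw [e] at hG hG' ⊢
    have hd' : ∀ x ∈ Set.Ici c, HasDerivAt G (G' x) x := fun x hx => hd x hx (by simp)
    have h0 := tendsto_zero_of_hasDerivAt_of_integrableOn_Ioi
      (fun x hx => hd' x (Set.Ioi_subset_Ici_self hx)) hG' hG
    rw [integral_Ioi_of_hasDerivAt_of_tendsto' hd' hG' h0, zero_sub]
  | coe b =>
    have e : {x : ℝ | c < x ∧ (x : EReal) < b} = Set.Ioo c b := by
      ext x; simp
    have hcb' : c < b := by exact_mod_cast hcb
    rw [e] at hG hG' ⊢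
    rw [← integral_Ioc_eq_integral_Ioo, ← intervalIntegral.integral_of_le hcb'.le,
      intervalIntegral.integral_eq_sub_of_hasDerivAt_of_tendsto (fa := G c) (fb := 0) hcb' ?_ ?_ ?_
        (hlim b rfl), zero_sub]
    · exact fun x hx => hd x hx.1.le (by exact_mod_cast hx.2)
    · rw [intervalIntegrable_iff_integrableOn_Ioo_of_le hcb'.le]; exact hG'
    · exact (hd c le_rfl hcb).continuousAt.continuousWithinAt

theorem integral_interval_deriv_eq_zero {a b : EReal} (hab : a < b) {G G' : ℝ → ℂ}
    (hd : ∀ z ∈ interval a b, HasDerivAt G (G' z) z)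
    (hG : IntegrableOn G (interval a b)) (hG' : IntegrableOn G' (interval a b))
    (hlima : ∀ a' : ℝ, a = a' → Tendsto G (𝓝[>] a') (𝓝 0))
    (hlimb : ∀ b' : ℝ, b = b' → Tendsto G (𝓝[<] b') (𝓝 0)) :
    ∫ x in interval a b, G' x = 0 := by
  obtain ⟨c, hac, hcb⟩ := EReal.lt_iff_exists_real_btwn.1 hab
  have hleft : {x : ℝ | a < x ∧ x ≤ c} ⊆ interval a b := fun x hx =>
    ⟨hx.1, lt_of_le_of_lt (by exact_mod_cast hx.2) hcb⟩
  have hright : {x : ℝ | c < x ∧ x < b} ⊆ interval a b := fun x hx =>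
    ⟨hac.trans (by exact_mod_cast hx.1), hx.2⟩
  have hunion : interval a b = {x : ℝ | a < x ∧ x ≤ c} ∪ {x : ℝ | c < x ∧ x < b} := by
    refine Set.Subset.antisymm (fun x hx => ?_) (Set.union_subset hleft hright)
    rcases le_or_gt x c with h | h
    · exact Or.inl ⟨hx.1, h⟩
    · exact Or.inr ⟨h, hx.2⟩
  have hmeas : MeasurableSet {x : ℝ | c < x ∧ (x : EReal) < b} :=
    measurableSet_Ioi.inter (measurable_coe_real_ereal measurableSet_Iio)
  rw [hunion, setIntegral_union ?_ hmeas (hG'.mono_set hleft) (hG'.mono_set hright),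
    integral_left_part hac (fun z h1 h2 => hd z (hleft ⟨h1, h2⟩)) (hG.mono_set hleft)
      (hG'.mono_set hleft) hlima,
    integral_right_part hcb (fun z h1 h2 => hd z ⟨hac.trans_le (by exact_mod_cast h1), h2⟩)
      (hG.mono_set hright) (hG'.mono_set hright) hlimb]
  · ring
  · exact Set.disjoint_left.2 fun x hx hx' => (not_lt.2 hx.2) hx'.1

/-! ### Stokes' relation for the weight and the skewness of `𝕟_t` -/

section Weight

variable {a b : EReal} {f g : Polynomial ℝ} {V : ℝ → ℝ} {t : Times}

/-- The integrand is the derivative of `f P ρ_t`, because `V' = g / f`. Near a finite endpoint `f ρ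
→ 0` while `P` and the exponential of the times have finite limits. -/
theorem momentLin_stokes (hab : a < b)
    (hf : ∀ z ∈ interval a b, 0 < f.eval z)
    (hV : ∀ z ∈ interval a b, HasDerivAt V (g.eval z / f.eval z) z)
    (ha : Tendsto (fun z : ℝ => f.eval z * Real.exp (-V z))
      (comap (fun x : ℝ => (x : EReal)) (𝓝[>] a)) (𝓝 0))
    (hb : Tendsto (fun z : ℝ => f.eval z * Real.exp (-V z))
      (comap (fun x : ℝ => (x : EReal)) (𝓝[<] b)) (𝓝 0))
    (ht : Admissible (interval a b) V t) (P : Polynomial ℂ) :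
    momentLin (interval a b) V t ((Polynomial.derivative (toC f) - toC g + toC f * timePoly t) * P +
      toC f * Polynomial.derivative P) = 0 := by
  have hsplit : ∀ z : ℝ, pfun (toC f * P) z * rho V t z =
      ((f.eval z * Real.exp (-V z) : ℝ) : ℂ) * (pfun P z * Complex.exp (timeSum t z)) := by
    intro z
    rw [rho, Complex.exp_add, pfun_mul, pfun_toC]
    push_cast; ring
  have hcont : Continuous fun z : ℝ => pfun P z * Complex.exp (timeSum t z) := by
    have h1 : Continuous (pfun P) := P.continuous.comp Complex.continuous_ofReal
    have h2 := (continuous_timeSum t).comp Complex.continuous_ofReal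
    exact h1.mul (Complex.continuous_exp.comp h2)
  have hlim : ∀ (x : ℝ) (l : Filter ℝ), l ≤ 𝓝 x →
      Tendsto (fun z : ℝ => f.eval z * Real.exp (-V z)) l (𝓝 0) →
      Tendsto (fun z => pfun (toC f * P) z * rho V t z) l (𝓝 0) := by
    intro x l hl h
    simp_rw [hsplit]
    have := ((Complex.continuous_ofReal.tendsto 0).comp h).mul ((hcont.tendsto x).mono_left hl)
    simpa using this
  refine integral_interval_deriv_eq_zero hab (G := fun z => pfun (toC f * P) z * rho V t z)
    (fun z hz => ?_) (ht.integrableOn _) (ht.integrableOn _) ?_ ?_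
  · have hT : HasDerivAt (fun x : ℝ => timeSum t x) ((timePoly t).eval (z : ℂ)) z :=
      (hasDerivAt_timeSum t z).comp_ofReal
    have h := (hasDerivAt_pfun (toC f * P) z).fun_mul
      (((hV z hz).ofReal_comp.fun_neg).fun_add hT).cexp
    refine h.congr_deriv ?_
    have hfC : ((f.eval z : ℝ) : ℂ) ≠ 0 := by exact_mod_cast (hf z hz).ne'
    have hT' : (timePoly t).eval (z : ℂ) = pfun (timePoly t) z := rfl
    simp only [Polynomial.derivative_mul, pfun_add, pfun_mul, pfun_sub, pfun_toC, hT', rho]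
    push_cast
    field_simp
    ring
  · rintro x rfl
    refine hlim x _ nhdsWithin_le_nhds (ha.mono_left ?_)
    exact tendsto_iff_comap.1 (tendsto_nhdsWithin_of_tendsto_nhds_of_eventually_within _
      (continuous_coe_real_ereal.tendsto x |>.mono_left nhdsWithin_le_nhds)
      (eventually_mem_nhdsWithin.mono fun y hy => by
        simpa using hy))
  · rintro x rfl
    refine hlim x _ nhdsWithin_le_nhds (hb.mono_left ?_)
    exact tendsto_iff_comap.1 (tendsto_nhdsWithin_of_tendsto_nhds_of_eventually_within _
      (continuous_coe_real_ereal.tendsto x |>.mono_left nhdsWithin_le_nhds)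
      (eventually_mem_nhdsWithin.mono fun y hy => by
        simpa using hy))

theorem symIP_nOp (hf : ∀ z ∈ interval a b, 0 < f.eval z)
    (hV : ∀ z ∈ interval a b, HasDerivAt V (g.eval z / f.eval z) z) (P Q : Polynomial ℂ) :
    symIP (interval a b) V t (pfun P) (nOp f V t (pfun Q)) =
      momentLin (interval a b) V t (P * nPoly f g t Q) := by
  rw [symIP, momentLin]
  refine setIntegral_congr_fun (isOpen_interval a b).measurableSet fun z hz => ?_
  simp only [nOp_pfun (hf z hz) (hV z hz), pfun_mul]

/-- Subtracting half of Stokes' relation for `P Q` removes the zeroth-order part of `𝕟_t` and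
antisymmetrizes the derivative. -/
theorem momentLin_mul_nPoly (hab : a < b)
    (hf : ∀ z ∈ interval a b, 0 < f.eval z)
    (hV : ∀ z ∈ interval a b, HasDerivAt V (g.eval z / f.eval z) z)
    (ha : Tendsto (fun z : ℝ => f.eval z * Real.exp (-V z))
      (comap (fun x : ℝ => (x : EReal)) (𝓝[>] a)) (𝓝 0))
    (hb : Tendsto (fun z : ℝ => f.eval z * Real.exp (-V z))
      (comap (fun x : ℝ => (x : EReal)) (𝓝[<] b)) (𝓝 0))
    (ht : Admissible (interval a b) V t) (P Q : Polynomial ℂ) :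
    momentLin (interval a b) V t (P * nPoly f g t Q) =
      -(1 / 2) * momentLin (interval a b) V t (bracket P Q * toC f) := by
  have h := momentLin_stokes hab hf hV ha hb ht (P * Q)
  have h' : momentLin (interval a b) V t (Polynomial.C (1 / 2) *
      ((Polynomial.derivative (toC f) - toC g + toC f * timePoly t) * (P * Q) +
        toC f * Polynomial.derivative (P * Q))) = 0 := by
    rw [momentLin_C_mul, h, mul_zero]
  rw [← momentLin_C_mul, ← sub_eq_zero, ← h', ← momentMap_apply ht, ← momentMap_apply ht,
    ← momentMap_apply ht, ← map_sub]
  congr 1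
  have hC : Polynomial.C (1 / 2 : ℂ) * 2 = 1 := by
    rw [← Polynomial.C_ofNat, ← Polynomial.C_mul]; norm_num
  simp only [nPoly, bracket, Polynomial.derivative_mul, map_neg]
  linear_combination (-P * toC f * Polynomial.derivative Q) * hC

theorem rho_Vtilde_sq {z : ℝ} (hf : 0 < f.eval z) (t : Times) :
    rho (Vtilde f V) t z ^ 2 = rho V ((2 : ℂ) • t) z * ((f.eval z : ℝ) : ℂ) := by
  have : ((f.eval z : ℝ) : ℂ) = Complex.exp (Real.log (f.eval z)) := by
    rw [← Complex.ofReal_exp, Real.exp_log hf]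
  rw [this, rho, rho, ← Complex.exp_nat_mul, ← Complex.exp_add, timeSum_smul, Vtilde]
  congr 1
  push_cast; ring

theorem continuousOn_of_hasDerivAt
    (hV : ∀ z ∈ interval a b, HasDerivAt V (g.eval z / f.eval z) z) :
    ContinuousOn V (interval a b) := fun z hz => (hV z hz).continuousAt.continuousWithinAt

theorem continuousOn_Vtilde (hf : ∀ z ∈ interval a b, 0 < f.eval z)
    (hV : ∀ z ∈ interval a b, HasDerivAt V (g.eval z / f.eval z) z) :
    ContinuousOn (Vtilde f V) (interval a b) := by
  unfold Vtilde
  exact ((continuousOn_of_hasDerivAt hV).sub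
    (f.continuous.continuousOn.log fun z hz => (hf z hz).ne')).div_const 2

theorem pfun_mul_rho_Vtilde_sq (hf : ∀ z ∈ interval a b, 0 < f.eval z) (t : Times)
    (P : Polynomial ℂ) : Set.EqOn (fun z => pfun P z * rho (Vtilde f V) t z ^ 2)
      (fun z => pfun (P * toC f) z * rho V ((2 : ℂ) • t) z) (interval a b) := by
  intro z hz
  simp only [rho_Vtilde_sq (hf z hz), pfun_mul, pfun_toC]
  ring

theorem integrableOn_rho_Vtilde_sq (hf : ∀ z ∈ interval a b, 0 < f.eval z)
    (ht : Admissible (interval a b) V ((2 : ℂ) • t)) (P : Polynomial ℂ) :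
    IntegrableOn (fun z => pfun P z * rho (Vtilde f V) t z ^ 2) (interval a b) :=
  (integrableOn_congr_fun (pfun_mul_rho_Vtilde_sq hf t P) (isOpen_interval a b).measurableSet).2
    (ht.integrableOn _)

theorem integral_rho_Vtilde_sq (hf : ∀ z ∈ interval a b, 0 < f.eval z) (P : Polynomial ℂ) :
    ∫ z in interval a b, pfun P z * rho (Vtilde f V) t z ^ 2 =
      momentLin (interval a b) V ((2 : ℂ) • t) (P * toC f) :=
  setIntegral_congr_fun (isOpen_interval a b).measurableSet (pfun_mul_rho_Vtilde_sq hf t P)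

end Weight

/-! ### Row-finite matrices -/

/-- Matrices whose rows have finitely many nonzero entries. -/
def RowFin (A : SMat) : Prop := ∀ i, ∃ n, ∀ k, n ≤ k → A i k = 0

theorem mul_apply_range {A : SMat} {i n : ℕ} (h : ∀ k, n ≤ k → A i k = 0) (B : SMat) (j : ℕ) :
    mul A B i j = ∑ k ∈ Finset.range n, A i k * B k j := by
  refine finsum_eq_sum_of_support_subset _ fun k hk => ?_
  by_contra hk'
  have : n ≤ k := by simpa using hk'
  exact hk (by simp [h k this])

theorem tr_tr (A : SMat) : tr (tr A) = A := rfl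

theorem tr_mul (A B : SMat) : tr (mul A B) = mul (tr B) (tr A) := by
  funext i j
  simp only [tr, mul]
  exact finsum_congr fun k => mul_comm _ _

theorem tr_one : tr one = one := by
  funext i j; simp only [tr, one, eq_comm]

theorem IsLower.rowFin {A : SMat} (hA : IsLower A) : RowFin A := fun i =>
  ⟨i + 1, fun k hk => hA i k hk⟩

theorem IsLower.mul_apply {A : SMat} (hA : IsLower A) (B : SMat) (i j : ℕ) :
    mul A B i j = ∑ k ∈ Finset.range (i + 1), A i k * B k j :=
  mul_apply_range (fun k hk => hA i k hk) B j

theorem isLower_one : IsLower one := fun i j hij => by simp [one, hij.ne]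

theorem RowFin.mul {A B : SMat} (hA : RowFin A) (hB : RowFin B) : RowFin (mul A B) := by
  intro i
  obtain ⟨n, hn⟩ := hA i
  choose b hb using hB
  refine ⟨(Finset.range n).sup b, fun k hk => ?_⟩
  rw [mul_apply_range hn]
  refine Finset.sum_eq_zero fun l hl => ?_
  rw [hb l k ((Finset.le_sup hl).trans hk), mul_zero]

theorem RowFin.add {A B : SMat} (hA : RowFin A) (hB : RowFin B) : RowFin (A + B) := by
  intro i
  obtain ⟨n, hn⟩ := hA i
  obtain ⟨m, hm⟩ := hB i
  refine ⟨max n m, fun k hk => ?_⟩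
  rw [Pi.add_apply, Pi.add_apply, hn k (le_of_max_le_left hk), hm k (le_of_max_le_right hk),
    add_zero]

theorem RowFin.smul {A : SMat} (c : ℂ) (hA : RowFin A) : RowFin (c • A) := by
  intro i
  obtain ⟨n, hn⟩ := hA i
  exact ⟨n, fun k hk => by rw [Pi.smul_apply, Pi.smul_apply, hn k hk, smul_zero]⟩

theorem RowFin.neg {A : SMat} (hA : RowFin A) : RowFin (-A) := by
  simpa using hA.smul (-1)

theorem RowFin.sub {A B : SMat} (hA : RowFin A) (hB : RowFin B) : RowFin (A - B) := by
  rw [sub_eq_add_neg]; exact hA.add hB.neg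

theorem RowFin.sum {ι : Type} {s : Finset ι} {A : ι → SMat} (hA : ∀ i ∈ s, RowFin (A i)) :
    RowFin (∑ i ∈ s, A i) := by
  classical
  induction s using Finset.induction_on with
  | empty => exact fun i => ⟨0, fun k _ => rfl⟩
  | insert a s ha ih =>
    rw [Finset.sum_insert ha]
    exact (hA a (Finset.mem_insert_self _ _)).add (ih fun i hi => hA i (Finset.mem_insert_of_mem hi))

theorem RowFin.pow {A : SMat} (hA : RowFin A) : ∀ n, RowFin (pow A n)
  | 0 => isLower_one.rowFin
  | n + 1 => (RowFin.pow hA n).mul hA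

theorem rowFin_shift : RowFin shift := fun i => ⟨i + 2, fun k hk => by
  simp only [shift]; rw [if_neg (by omega)]⟩

theorem rowFin_derivMat : RowFin derivMat := fun i => ⟨i, fun k hk => by
  simp only [derivMat]; rw [if_neg (by omega)]⟩

theorem rowFin_J : RowFin J := fun i => ⟨i + 2, fun k hk => by
  simp only [J]; rw [if_neg (by omega), if_neg (by omega)]⟩

theorem evalMat_eq (P : Polynomial ℝ) (A : SMat) :
    evalMat P A = ∑ k ∈ Finset.range (P.natDegree + 1), (P.coeff k : ℂ) • pow A k := by
  funext i j
  simp [evalMat, Finset.sum_apply]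

theorem RowFin.evalMat {A : SMat} (P : Polynomial ℝ) (hA : RowFin A) : RowFin (evalMat P A) := by
  rw [evalMat_eq]
  exact RowFin.sum fun k _ => (hA.pow k).smul _

/-- The polynomial whose coefficients are the entries of a row. -/
def rowPoly (A : SMat) (i : ℕ) : Polynomial ℂ := ∑ᶠ k, Polynomial.monomial k (A i k)

theorem rowPoly_eq {A : SMat} {i n : ℕ} (h : ∀ k, n ≤ k → A i k = 0) :
    rowPoly A i = ∑ k ∈ Finset.range n, Polynomial.monomial k (A i k) := by
  refine finsum_eq_sum_of_support_subset _ fun k hk => ?_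
  by_contra hk'
  have : n ≤ k := by simpa using hk'
  exact hk (by simp [h k this])

theorem RowFin.coeff_rowPoly {A : SMat} (hA : RowFin A) (i j : ℕ) :
    (rowPoly A i).coeff j = A i j := by
  obtain ⟨n, hn⟩ := hA i
  rw [rowPoly_eq hn, Polynomial.finsetSum_coeff]
  simp only [Polynomial.coeff_monomial, Finset.sum_ite_eq', Finset.mem_range]
  split_ifs with h
  · rfl
  · exact (hn j (not_lt.1 h)).symm

/-- The linear map of polynomials sending `Xⁱ` to the polynomial of the row `i`. -/
def op (A : SMat) : Module.End ℂ (Polynomial ℂ) :=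
  (Polynomial.basisMonomials ℂ).constr ℂ (rowPoly A)

theorem op_X_pow (A : SMat) (i : ℕ) : op A (Polynomial.X ^ i) = rowPoly A i := by
  rw [Polynomial.X_pow_eq_monomial]
  have := (Polynomial.basisMonomials ℂ).constr_basis ℂ (rowPoly A) i
  rwa [Polynomial.coe_basisMonomials] at this

theorem end_ext {φ ψ : Module.End ℂ (Polynomial ℂ)}
    (h : ∀ i, φ (Polynomial.X ^ i) = ψ (Polynomial.X ^ i)) : φ = ψ := by
  refine (Polynomial.basisMonomials ℂ).ext fun i => ?_
  have := h i
  rwa [Polynomial.X_pow_eq_monomial] at this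

theorem RowFin.coeff_op {A : SMat} (hA : RowFin A) (i j : ℕ) :
    (op A (Polynomial.X ^ i)).coeff j = A i j := by
  rw [op_X_pow, hA.coeff_rowPoly]

theorem op_injective {A B : SMat} (hA : RowFin A) (hB : RowFin B) (h : op A = op B) : A = B := by
  funext i j
  rw [← hA.coeff_op, h, hB.coeff_op]

theorem op_eq_iff {A : SMat} (hA : RowFin A) (φ : Module.End ℂ (Polynomial ℂ)) :
    op A = φ ↔ ∀ i j, A i j = (φ (Polynomial.X ^ i)).coeff j := by
  refine ⟨fun h i j => by rw [← h, hA.coeff_op], fun h => end_ext fun i => ?_⟩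
  ext j
  rw [hA.coeff_op, h]

theorem map_rowPoly {M : Type} [AddCommMonoid M] [Module ℂ M] (φ : Polynomial ℂ →ₗ[ℂ] M)
    {A : SMat} {i n : ℕ} (h : ∀ k, n ≤ k → A i k = 0) :
    φ (rowPoly A i) = ∑ k ∈ Finset.range n, A i k • φ (Polynomial.X ^ k) := by
  rw [rowPoly_eq h, map_sum]
  refine Finset.sum_congr rfl fun k _ => ?_
  rw [← Polynomial.C_mul_X_pow_eq_monomial, ← Polynomial.smul_eq_C_mul, map_smul]

/-- Rows are images of monomials, hence the reversal of the order. Together with `op_injective` this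
moves identities between row-finite matrices into an associative algebra of endomorphisms. -/
theorem op_mul {A B : SMat} (hA : RowFin A) (hB : RowFin B) : op (mul A B) = op B * op A := by
  rw [op_eq_iff (hA.mul hB)]
  intro i j
  obtain ⟨n, hn⟩ := hA i
  rw [Module.End.mul_apply, op_X_pow, map_rowPoly _ hn, mul_apply_range hn,
    Polynomial.finsetSum_coeff]
  refine Finset.sum_congr rfl fun k _ => ?_
  rw [Polynomial.coeff_smul, hB.coeff_op, smul_eq_mul]

theorem op_add {A B : SMat} (hA : RowFin A) (hB : RowFin B) : op (A + B) = op A + op B := by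
  rw [op_eq_iff (hA.add hB)]
  intro i j
  rw [LinearMap.add_apply, Polynomial.coeff_add, hA.coeff_op, hB.coeff_op]; rfl

theorem op_sub {A B : SMat} (hA : RowFin A) (hB : RowFin B) : op (A - B) = op A - op B := by
  rw [op_eq_iff (hA.sub hB)]
  intro i j
  rw [LinearMap.sub_apply, Polynomial.coeff_sub, hA.coeff_op, hB.coeff_op]; rfl

theorem op_smul (c : ℂ) {A : SMat} (hA : RowFin A) : op (c • A) = c • op A := by
  rw [op_eq_iff (hA.smul c)]
  intro i j
  rw [LinearMap.smul_apply, Polynomial.coeff_smul, hA.coeff_op]; rfl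

theorem op_neg {A : SMat} (hA : RowFin A) : op (-A) = -op A := by
  rw [op_eq_iff hA.neg]
  intro i j
  rw [LinearMap.neg_apply, Polynomial.coeff_neg, hA.coeff_op]; rfl

theorem op_sum {ι : Type} {s : Finset ι} {A : ι → SMat} (hA : ∀ i ∈ s, RowFin (A i)) :
    op (∑ i ∈ s, A i) = ∑ i ∈ s, op (A i) := by
  rw [op_eq_iff (RowFin.sum hA)]
  intro i j
  rw [LinearMap.sum_apply, Polynomial.finsetSum_coeff, Finset.sum_apply, Finset.sum_apply]
  exact Finset.sum_congr rfl fun k hk => ((hA k hk).coeff_op i j).symm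

theorem op_one : op one = 1 := by
  rw [op_eq_iff isLower_one.rowFin]
  intro i j
  simp [one, Polynomial.coeff_X_pow, eq_comm]

theorem op_pow {A : SMat} (hA : RowFin A) : ∀ n, op (pow A n) = op A ^ n
  | 0 => op_one
  | n + 1 => by rw [pow, op_mul (hA.pow n) hA, op_pow hA n, pow_succ']

theorem op_evalMat {A : SMat} (P : Polynomial ℝ) (hA : RowFin A) :
    op (evalMat P A) = Polynomial.aeval (op A) (toC P) := by
  rw [evalMat_eq, op_sum fun k _ => (hA.pow k).smul _, Polynomial.aeval_eq_sum_range'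
    (n := P.natDegree + 1) (lt_of_le_of_lt Polynomial.natDegree_map_le (Nat.lt_succ_self _))]
  refine Finset.sum_congr rfl fun k _ => ?_
  rw [op_smul _ (hA.pow k), op_pow hA, Polynomial.coeff_map]; rfl

/-- Multiplication by a polynomial. -/
def mulOp (P : Polynomial ℂ) : Module.End ℂ (Polynomial ℂ) := LinearMap.mulLeft ℂ P

theorem mulOp_apply (P Q : Polynomial ℂ) : mulOp P Q = P * Q := rfl

theorem mulOp_eq_algHom : mulOp = Algebra.lmul ℂ (Polynomial ℂ) := rfl

theorem op_shift : op shift = mulOp Polynomial.X := by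
  rw [op_eq_iff rowFin_shift]
  intro i j
  rw [mulOp_apply, ← pow_succ', Polynomial.coeff_X_pow]; rfl

theorem op_pow_shift (n : ℕ) : op (pow shift n) = mulOp (Polynomial.X ^ n) := by
  rw [op_pow rowFin_shift, op_shift, mulOp_eq_algHom, map_pow]

theorem pow_shift_apply (n i j : ℕ) : pow shift n i j = if j = i + n then 1 else 0 := by
  rw [← (rowFin_shift.pow n).coeff_op, op_pow_shift, mulOp_apply, ← pow_add, Polynomial.coeff_X_pow,
    add_comm]

theorem aeval_mulOp_X (P : Polynomial ℂ) : Polynomial.aeval (mulOp Polynomial.X) P = mulOp P := by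
  rw [mulOp_eq_algHom, Polynomial.aeval_algHom_apply, Polynomial.aeval_X_left_apply]

theorem op_derivMat : op derivMat = Polynomial.derivative (R := ℂ) := by
  rw [op_eq_iff rowFin_derivMat]
  intro i j
  rw [Polynomial.derivative_X_pow, Polynomial.coeff_C_mul, Polynomial.coeff_X_pow]
  simp only [derivMat]
  rcases i with _ | i
  · simp
  · simp [eq_comm]

/-- Products of infinite matrices are not associative in general. The three versions differ in where
the finiteness sits: rows of the two left factors, columns of the two right factors, or the outer
factors. -/
theorem mul_assoc_left {A B : SMat} (hA : RowFin A) (hB : RowFin B) (C : SMat) :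
    mul (mul A B) C = mul A (mul B C) := by
  funext i j
  obtain ⟨n, hn⟩ := hA i
  choose b hb using hB
  have hb' : ∀ k ∈ Finset.range n, ∀ l, (Finset.range n).sup b ≤ l → B k l = 0 := fun k hk l hl =>
    hb k l ((Finset.le_sup hk).trans hl)
  rw [mul_apply_range (n := (Finset.range n).sup b), mul_apply_range hn]
  · simp_rw [mul_apply_range hn, Finset.sum_mul]
    rw [Finset.sum_comm]
    refine Finset.sum_congr rfl fun k hk => ?_
    rw [mul_apply_range (hb' k hk), Finset.mul_sum]
    exact Finset.sum_congr rfl fun l _ => mul_assoc _ _ _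
  · intro k hk
    rw [mul_apply_range hn]
    exact Finset.sum_eq_zero fun l hl => by rw [hb' l hl k hk, mul_zero]

theorem mul_assoc_right {B C : SMat} (hB : RowFin (tr B)) (hC : RowFin (tr C)) (A : SMat) :
    mul (mul A B) C = mul A (mul B C) := by
  have := mul_assoc_left hC hB (tr A)
  rw [← tr_mul, ← tr_mul, ← tr_mul, ← tr_mul] at this
  rw [← tr_tr (mul A (mul B C)), this, tr_tr]

theorem mul_assoc_outer {A C : SMat} (hA : RowFin A) (hC : RowFin (tr C)) (B : SMat) :
    mul (mul A B) C = mul A (mul B C) := by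
  funext i j
  obtain ⟨n, hn⟩ := hA i
  obtain ⟨m, hm⟩ := hC j
  have h : ∀ (D : SMat) (l : ℕ), mul D C l j = ∑ k ∈ Finset.range m, D l k * C k j := by
    intro D l
    rw [← tr_tr (mul D C), tr_mul]
    simp only [tr] at hm ⊢
    rw [mul_apply_range hm]
    exact Finset.sum_congr rfl fun k _ => mul_comm _ _
  rw [h, mul_apply_range hn]
  simp_rw [mul_apply_range hn, h, Finset.sum_mul, Finset.mul_sum]
  rw [Finset.sum_comm]
  exact Finset.sum_congr rfl fun k _ => Finset.sum_congr rfl fun l _ => mul_assoc _ _ _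

theorem one_mul' (A : SMat) : mul one A = A := by
  funext i j
  rw [isLower_one.mul_apply, Finset.sum_eq_single i]
  · simp [one]
  · intro k _ hk; simp [one, hk.symm]
  · simp

theorem mul_one' (A : SMat) : mul A one = A := by
  rw [← tr_tr (mul A one), tr_mul, tr_one, one_mul', tr_tr]

theorem mul_add' {A : SMat} (hA : RowFin A) (B C : SMat) : mul A (B + C) = mul A B + mul A C := by
  funext i j
  obtain ⟨n, hn⟩ := hA i
  simp only [Pi.add_apply, mul_apply_range hn, mul_add, Finset.sum_add_distrib]

theorem mul_neg' (A B : SMat) : mul A (-B) = -mul A B := by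
  funext i j
  simp only [mul, Pi.neg_apply, mul_neg, finsum_neg_distrib]

theorem neg_mul' (A B : SMat) : mul (-A) B = -mul A B := by
  funext i j
  simp only [mul, Pi.neg_apply, neg_mul, finsum_neg_distrib]

theorem add_mul' {C : SMat} (hC : RowFin (tr C)) (A B : SMat) :
    mul (A + B) C = mul A C + mul B C := by
  have := mul_add' hC (tr A) (tr B)
  rw [← tr_mul, ← tr_mul] at this
  rw [← tr_tr (mul (A + B) C), tr_mul]
  exact congrArg tr this

/-! ### Lower-triangular matrices -/

theorem IsLower.mul {A B : SMat} (hA : IsLower A) (hB : IsLower B) : IsLower (mul A B) := by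
  intro i j hij
  rw [hA.mul_apply]
  refine Finset.sum_eq_zero fun k hk => ?_
  have := Finset.mem_range.1 hk
  rw [hB k j (by omega), mul_zero]

theorem IsLower.mul_diag {A B : SMat} (hA : IsLower A) (hB : IsLower B) (i : ℕ) :
    TodaPfaff.mul A B i i = A i i * B i i := by
  rw [hA.mul_apply, Finset.sum_range_succ, Finset.sum_eq_zero, zero_add]
  intro k hk
  rw [hB k i (Finset.mem_range.1 hk), mul_zero]

theorem lowerInv_diag {A : SMat} (hA : IsLower A) (hd : ∀ n, A n n ≠ 0) (i : ℕ) :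
    lowerInv A i i = (A i i)⁻¹ := by
  have h := congrFun₂ (mul_lowerInv hA hd) i i
  rw [hA.mul_diag (lowerInv_isLower A)] at h
  simp only [one, if_true] at h
  exact eq_inv_of_mul_eq_one_right h

theorem lowerInv_diag_ne_zero {A : SMat} (hA : IsLower A) (hd : ∀ n, A n n ≠ 0) (i : ℕ) :
    lowerInv A i i ≠ 0 := by
  rw [lowerInv_diag hA hd]; exact inv_ne_zero (hd i)

theorem eq_of_mul_eq_one {A B C : SMat} (hA : RowFin A) (hB : RowFin B)
    (hAB : mul A B = one) (hBC : mul B C = one) : C = A := by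
  have := mul_assoc_left hA hB C
  rw [hAB, hBC, one_mul', mul_one'] at this
  exact this

theorem lowerInv_lowerInv {A : SMat} (hA : IsLower A) (hd : ∀ n, A n n ≠ 0) :
    lowerInv (lowerInv A) = A :=
  eq_of_mul_eq_one hA.rowFin (lowerInv_isLower A).rowFin (mul_lowerInv hA hd)
    (mul_lowerInv (lowerInv_isLower A) (lowerInv_diag_ne_zero hA hd))

theorem lowerInv_mul {A : SMat} (hA : IsLower A) (hd : ∀ n, A n n ≠ 0) :
    mul (lowerInv A) A = one := by
  have := mul_lowerInv (lowerInv_isLower A) (lowerInv_diag_ne_zero hA hd)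
  rwa [lowerInv_lowerInv hA hd] at this

theorem eq_lowerInv {A B : SMat} (hA : IsLower A) (hd : ∀ n, A n n ≠ 0)
    (h : mul A B = one) : B = lowerInv A :=
  eq_of_mul_eq_one (lowerInv_isLower A).rowFin hA.rowFin (lowerInv_mul hA hd) h

theorem lowerInv_mul_eq {A B : SMat} (hA : IsLower A) (hAd : ∀ n, A n n ≠ 0)
    (hB : IsLower B) (hBd : ∀ n, B n n ≠ 0) :
    lowerInv (mul A B) = mul (lowerInv B) (lowerInv A) := by
  refine (eq_lowerInv (hA.mul hB) (fun n => ?_) ?_).symm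
  · rw [hA.mul_diag hB]; exact mul_ne_zero (hAd n) (hBd n)
  · rw [mul_assoc_left hA.rowFin hB.rowFin, ← mul_assoc_left hB.rowFin (lowerInv_isLower B).rowFin,
      mul_lowerInv hB hBd, one_mul', mul_lowerInv hA hAd]

theorem op_mul_op_lowerInv {A : SMat} (hA : IsLower A) (hd : ∀ n, A n n ≠ 0) :
    op A * op (lowerInv A) = 1 := by
  rw [← op_mul (lowerInv_isLower A).rowFin hA.rowFin, lowerInv_mul hA hd, op_one]

theorem op_lowerInv_mul_op {A : SMat} (hA : IsLower A) (hd : ∀ n, A n n ≠ 0) :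
    op (lowerInv A) * op A = 1 := by
  rw [← op_mul hA.rowFin (lowerInv_isLower A).rowFin, mul_lowerInv hA hd, op_one]

theorem polyP_eq {S : SMat} (hS : IsLower S) (n : ℕ) : polyP S n = op S (Polynomial.X ^ n) := by
  rw [op_X_pow, rowPoly_eq fun k hk => hS n k hk, polyP]
  exact Finset.sum_congr rfl fun k _ => Polynomial.C_mul_X_pow_eq_monomial

theorem polyQ_eq {S O : SMat} (hS : IsLower S) (hO : IsLower O) (n : ℕ) :
    polyQ S O n = op (mul O S) (Polynomial.X ^ n) := by
  rw [op_mul hO.rowFin hS.rowFin, Module.End.mul_apply, op_X_pow,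
    map_rowPoly _ fun k hk => hO n k hk, polyQ]
  exact Finset.sum_congr rfl fun k _ => by rw [polyP_eq hS, Polynomial.smul_eq_C_mul]

/-- The matrix of a bilinear form after a change of basis. -/
theorem mul_mul_tr_apply {B : Polynomial ℂ → Polynomial ℂ → ℂ} {m : SMat}
    (hB1 : ∀ Q, IsLinearMap ℂ fun P => B P Q) (hB2 : ∀ P, IsLinearMap ℂ (B P))
    (hm : ∀ i j, B (Polynomial.X ^ i) (Polynomial.X ^ j) = m i j) {S T : SMat} (hS : RowFin S)
    (hT : RowFin T) (i j : ℕ) :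
    mul (mul S m) (tr T) i j = B (op S (Polynomial.X ^ i)) (op T (Polynomial.X ^ j)) := by
  obtain ⟨n, hn⟩ := hS i
  obtain ⟨l, hl⟩ := hT j
  have h1 : mul (mul S m) (tr T) i j = ∑ k ∈ Finset.range l, T j k * mul S m i k := by
    rw [← tr_tr (mul _ _), tr_mul, tr_tr, tr, mul_apply_range hl]; rfl
  have h2 : B (op S (Polynomial.X ^ i)) (op T (Polynomial.X ^ j)) = ∑ k ∈ Finset.range l,
      T j k • B (op S (Polynomial.X ^ i)) (Polynomial.X ^ k) := by
    have := map_rowPoly (hB2 (op S (Polynomial.X ^ i))).mk' hl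
    rwa [op_X_pow T]
  rw [h1, h2]
  refine Finset.sum_congr rfl fun k _ => ?_
  have := map_rowPoly (hB1 (Polynomial.X ^ k)).mk' hn
  simp only [IsLinearMap.mk'_apply, hm] at this
  rw [op_X_pow, this, mul_apply_range hn, smul_eq_mul]
  simp only [smul_eq_mul]

/-! ### The matrices of the lattices as operators on polynomials -/

theorem conj_pow_of_inverse {A : Type} [Ring A] {u v : A} (huv : u * v = 1) (hvu : v * u = 1)
    (x : A) (n : ℕ) : (v * x * u) ^ n = v * x ^ n * u := by
  induction n with
  | zero => simp [hvu]
  | succ n ih =>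
    rw [pow_succ, ih, pow_succ]
    calc v * x ^ n * u * (v * x * u) = v * x ^ n * (u * v) * x * u := by noncomm_ring
      _ = _ := by rw [huv]; noncomm_ring

theorem aeval_conj_of_inverse {A : Type} [Ring A] [Algebra ℂ A] {u v : A} (huv : u * v = 1)
    (hvu : v * u = 1) (x : A) (P : Polynomial ℂ) :
    Polynomial.aeval (v * x * u) P = v * Polynomial.aeval x P * u := by
  rw [Polynomial.aeval_eq_sum_range, Polynomial.aeval_eq_sum_range, Finset.mul_sum, Finset.sum_mul]
  refine Finset.sum_congr rfl fun k _ => ?_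
  rw [conj_pow_of_inverse huv hvu, mul_smul_comm, smul_mul_assoc]

/-- Differentiation of polynomials. -/
def derivOp : Module.End ℂ (Polynomial ℂ) := Polynomial.derivative (R := ℂ)

theorem derivOp_apply (P : Polynomial ℂ) : derivOp P = Polynomial.derivative P := rfl

/-- The operator `𝕟_t` on polynomials as a linear map. -/
def nLin (f g : Polynomial ℝ) (t : Times) : Module.End ℂ (Polynomial ℂ) :=
  mulOp (toC f) * derivOp + (1 / 2 : ℂ) •
    mulOp (Polynomial.derivative (toC f) - toC g + toC f * timePoly t)

theorem nLin_apply (f g : Polynomial ℝ) (t : Times) (P : Polynomial ℂ) :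
    nLin f g t P = nPoly f g t P := by
  simp only [nLin, nPoly, LinearMap.add_apply, LinearMap.smul_apply, Module.End.mul_apply,
    mulOp_apply, Polynomial.smul_eq_C_mul, derivOp_apply]

theorem conj_mul_conj_sub {A : Type} [Ring A] {u v : A} (huv : u * v = 1) (a b c : A) :
    v * a * u * (v * b * u) - v * c * u = v * (a * b - c) * u := by
  calc v * a * u * (v * b * u) - v * c * u = v * a * (u * v) * b * u - v * c * u := by noncomm_ring
    _ = _ := by rw [huv]; noncomm_ring

/-- The commutator of `d/dz` and `f` is `f'`, which turns `-(f' + g) / 2` into `(f' - g) / 2`. The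
multiplication by `f` stands on the right because `op` reverses the product `f(L) M`. -/
theorem nLin_eq (f g : Polynomial ℝ) (t : Times) :
    (derivOp + (1 / 2 : ℂ) • mulOp (timePoly t)) * mulOp (toC f) -
      mulOp (toC (Polynomial.C (1 / 2) * (Polynomial.derivative f + g))) = nLin f g t := by
  refine LinearMap.ext fun Q => ?_
  have hC : Polynomial.C (1 / 2 : ℂ) * 2 = 1 := by
    rw [← Polynomial.C_ofNat, ← Polynomial.C_mul]; norm_num
  have hC' : (algebraMap ℝ ℂ) (1 / 2) = 1 / 2 := by simp
  have hD : Polynomial.derivative (toC f) = toC (Polynomial.derivative f) :=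
    Polynomial.derivative_map f _
  simp only [nLin, LinearMap.sub_apply, LinearMap.add_apply, LinearMap.smul_apply,
    Module.End.mul_apply, mulOp_apply, derivOp_apply, Polynomial.smul_eq_C_mul, toC,
    Polynomial.map_mul, Polynomial.map_C, Polynomial.map_add, hC', Polynomial.derivative_mul] at hD ⊢
  rw [hD]
  linear_combination (-(Polynomial.derivative f).map (algebraMap ℝ ℂ) * Q) * hC

section Conj

variable {S : SMat}

theorem rowFin_conj {Z : SMat} (hS : IsLower S) (hZ : RowFin Z) :
    RowFin (mul (mul S Z) (lowerInv S)) :=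
  (hS.rowFin.mul hZ).mul (lowerInv_isLower S).rowFin

theorem op_conj {Z : SMat} (hS : IsLower S) (hZ : RowFin Z) :
    op (mul (mul S Z) (lowerInv S)) = op (lowerInv S) * op Z * op S := by
  rw [op_mul (hS.rowFin.mul hZ) (lowerInv_isLower S).rowFin, op_mul hS.rowFin hZ, mul_assoc]

theorem rowFin_matL (hS : IsLower S) : RowFin (matL S) := rowFin_conj hS rowFin_shift

theorem op_matL (hS : IsLower S) :
    op (matL S) = op (lowerInv S) * mulOp Polynomial.X * op S := by
  rw [matL, op_conj hS rowFin_shift, op_shift]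

theorem rowFin_timeMat (t : Times) : RowFin (derivMat + (1 / 2 : ℂ) •
    t.sum fun i c => ((i : ℕ) * c : ℂ) • pow shift ((i : ℕ) - 1)) :=
  rowFin_derivMat.add ((RowFin.sum fun _ _ => (rowFin_shift.pow _).smul _).smul _)

theorem op_timeMat (t : Times) : op (derivMat + (1 / 2 : ℂ) •
    t.sum fun i c => ((i : ℕ) * c : ℂ) • pow shift ((i : ℕ) - 1)) =
      derivOp + (1 / 2 : ℂ) • mulOp (timePoly t) := by
  have h : ∀ i ∈ t.support, RowFin (((i : ℕ) * t i : ℂ) • pow shift ((i : ℕ) - 1)) :=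
    fun i _ => (rowFin_shift.pow _).smul _
  rw [Finsupp.sum, op_add rowFin_derivMat ((RowFin.sum h).smul _), op_smul _ (RowFin.sum h),
    op_sum h, op_derivMat, timePoly, Finsupp.sum, mulOp_eq_algHom, map_sum]
  congr 2
  refine Finset.sum_congr rfl fun i _ => ?_
  rw [op_smul _ (rowFin_shift.pow _), op_pow_shift, ← Polynomial.smul_eq_C_mul, map_smul]; rfl

theorem rowFin_matM (t : Times) (hS : IsLower S) : RowFin (matM t S) :=
  rowFin_conj hS (rowFin_timeMat t)

theorem rowFin_matN (f g : Polynomial ℝ) (t : Times) (hS : IsLower S) : RowFin (matN f g t S) :=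
  (((rowFin_matL hS).evalMat _).mul (rowFin_matM t hS)).sub ((rowFin_matL hS).evalMat _)

theorem op_evalMat_matL (hS : IsLower S) (hd : ∀ n, S n n ≠ 0) (P : Polynomial ℝ) :
    op (evalMat P (matL S)) = op (lowerInv S) * mulOp (toC P) * op S := by
  rw [op_evalMat P (rowFin_matL hS), op_matL hS,
    aeval_conj_of_inverse (op_mul_op_lowerInv hS hd) (op_lowerInv_mul_op hS hd), aeval_mulOp_X]

theorem op_matN (f g : Polynomial ℝ) (t : Times) (hS : IsLower S) (hd : ∀ n, S n n ≠ 0) :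
    op (matN f g t S) = op (lowerInv S) * nLin f g t * op S := by
  have hL := rowFin_matL hS
  rw [matN, op_sub ((hL.evalMat _).mul (rowFin_matM t hS)) (hL.evalMat _),
    op_mul (hL.evalMat _) (rowFin_matM t hS), op_evalMat_matL hS hd, op_evalMat_matL hS hd, matM,
    op_conj hS (rowFin_timeMat t), op_timeMat]
  rw [conj_mul_conj_sub (op_mul_op_lowerInv hS hd), nLin_eq]

theorem op_mul_op_matN (f g : Polynomial ℝ) (t : Times) (hS : IsLower S) (hd : ∀ n, S n n ≠ 0) :
    op S * op (matN f g t S) = nLin f g t * op S := by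
  rw [op_matN f g t hS hd, ← mul_assoc, ← mul_assoc, op_mul_op_lowerInv hS hd, one_mul]

theorem nPoly_polyP (f g : Polynomial ℝ) (t : Times) (hS : IsLower S) (hd : ∀ n, S n n ≠ 0)
    {n N : ℕ} (hN : ∀ k, N ≤ k → matN f g t S n k = 0) : nPoly f g t (polyP S n) =
      ∑ k ∈ Finset.range N, matN f g t S n k • polyP S k := by
  have := congrArg (fun φ => φ (Polynomial.X ^ n)) (op_mul_op_matN f g t hS hd)
  simp only [Module.End.mul_apply, nLin_apply] at this
  rw [op_X_pow (matN f g t S), map_rowPoly _ hN] at this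
  simp only [polyP_eq hS, this]

theorem pow_matL (hS : IsLower S) (hd : ∀ n, S n n ≠ 0) (j : ℕ) :
    pow (matL S) j = mul (mul S (pow shift j)) (lowerInv S) := by
  refine op_injective ((rowFin_matL hS).pow j) (rowFin_conj hS (rowFin_shift.pow j)) ?_
  rw [op_pow (rowFin_matL hS), op_conj hS (rowFin_shift.pow j), op_matL hS,
    conj_pow_of_inverse (op_mul_op_lowerInv hS hd) (op_lowerInv_mul_op hS hd),
    op_pow rowFin_shift, op_shift]

/-- `L̃` is again `Q Λ Q⁻¹`, now with `Q = O S`, so a single Lax computation serves both lattices.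
-/
theorem matLtilde_eq {O : SMat} (hS : IsLower S) (hd : ∀ n, S n n ≠ 0) (hO : IsLower O)
    (hOd : ∀ n, O n n ≠ 0) : matLtilde S O = matL (mul O S) := by
  refine op_injective (rowFin_conj hO (rowFin_matL hS)) (rowFin_matL (hO.mul hS)) ?_
  rw [matLtilde, op_conj hO (rowFin_matL hS), op_matL hS, op_matL (hO.mul hS),
    lowerInv_mul_eq hO hOd hS hd, op_mul (lowerInv_isLower S).rowFin (lowerInv_isLower O).rowFin,
    op_mul hO.rowFin hS.rowFin]
  noncomm_ring

/-! ### Congruences -/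

/-- The congruence by `Q` cancels a factor `(Q⁻¹)ᵀ`. -/
theorem congruence_cancel {Z W A : SMat} (hS : IsLower S) (hA : IsLower A) (hSA : mul S A = one)
    (hZ : RowFin Z) :
    mul (mul S (mul (mul Z W) (tr A))) (tr S) = mul (mul S Z) W := by
  rw [← mul_assoc_outer hS.rowFin (by exact hA.rowFin), mul_assoc_right (by exact hA.rowFin)
    (by exact hS.rowFin), ← tr_mul, hSA, tr_one, mul_one', mul_assoc_left hS.rowFin hZ]

theorem congruence_cancel' {Z W A : SMat} (hS : IsLower S) (hA : IsLower A) (hSA : mul S A = one)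
    (hZ : RowFin Z) :
    mul (mul S (mul (mul A W) (tr Z))) (tr S) = mul W (tr (mul S Z)) := by
  have h := congrArg tr (congruence_cancel (W := tr W) hS hA hSA hZ)
  rw [tr_mul, tr_mul, tr_mul, tr_mul (mul S Z), tr_mul, tr_tr, tr_tr, tr_tr] at h
  rw [← h, mul_assoc_outer hS.rowFin (by exact hS.rowFin), mul_assoc_outer hA.rowFin (by exact hZ)]

end Conj

/-! ### Derivatives of semi-infinite matrices -/

section Flow

variable {I : Set ℂ} {x : ℂ}

/-- Entrywise derivative. -/
def HasD (I : Set ℂ) (x : ℂ) (A : ℂ → SMat) (A' : SMat) : Prop :=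
  ∀ i j, HasDerivWithinAt (fun s => A s i j) (A' i j) I x

/-- A row bound uniform over `I` makes every entry of the product a sum over a fixed finite range,
so the ordinary product rule applies. -/
theorem HasD.mul {A B : ℂ → SMat} {A' B' : SMat} (hx : x ∈ I) (hA : HasD I x A A')
    (hB : HasD I x B B') {b : ℕ → ℕ} (hAb : ∀ s ∈ I, ∀ i k, b i ≤ k → A s i k = 0)
    (hAb' : ∀ i k, b i ≤ k → A' i k = 0) :
    HasD I x (fun s => mul (A s) (B s)) (mul A' (B x) + mul (A x) B') := by
  intro i j
  have h : HasDerivWithinAt (fun s => ∑ k ∈ Finset.range (b i), A s i k * B s k j)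
      (∑ k ∈ Finset.range (b i), (A' i k * B x k j + A x i k * B' k j)) I x :=
    HasDerivWithinAt.fun_sum fun k _ => (hA i k).fun_mul (hB k j)
  rw [Finset.sum_add_distrib, ← mul_apply_range (hAb' i), ← mul_apply_range (hAb x hx i)] at h
  exact h.congr (fun s hs => mul_apply_range (hAb s hs i) _ _)
    (mul_apply_range (hAb x hx i) _ _)

theorem HasD.tr {A : ℂ → SMat} {A' : SMat} (hA : HasD I x A A') :
    HasD I x (fun s => tr (A s)) (tr A') := fun i j => hA j i

theorem HasD.const (A : SMat) : HasD I x (fun _ => A) 0 := fun _ _ => hasDerivWithinAt_const _ _ _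

theorem HasD.congr {A B : ℂ → SMat} {A' : SMat} (hx : x ∈ I) (hA : HasD I x A A')
    (h : ∀ s ∈ I, B s = A s) : HasD I x B A' := fun i j =>
  (hA i j).congr (fun s hs => congrFun₂ (h s hs) i j) (congrFun₂ (h x hx) i j)

theorem HasD.unique {A : ℂ → SMat} {A' B' : SMat} (hu : UniqueDiffWithinAt ℂ I x)
    (hA : HasD I x A A') (hB : HasD I x A B') : A' = B' := by
  funext i j
  exact hu.eq_deriv I (hA i j) (hB i j)

theorem mul_zero' (A : SMat) : TodaPfaff.mul A 0 = 0 := by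
  funext i j; simp [TodaPfaff.mul]

/-- Lower-triangular matrices with differentiable entries have a lower-triangular derivative. -/
theorem exists_hasD_of_isLower {A : ℂ → SMat} (hx : x ∈ I) (hA : ∀ s ∈ I, IsLower (A s))
    (hd : ∀ i j, j ≤ i → DifferentiableWithinAt ℂ (fun s => A s i j) I x) :
    ∃ A', IsLower A' ∧ HasD I x A A' := by
  refine ⟨fun i j => if i < j then 0 else derivWithin (fun s => A s i j) I x,
    fun i j hij => if_pos hij, fun i j => ?_⟩
  beta_reduce
  by_cases h : i < j
  · rw [if_pos h]
    exact (hasDerivWithinAt_const x I (0 : ℂ)).congr (fun s hs => hA s hs i j h) (hA x hx i j h)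
  · rw [if_neg h]
    exact (hd i j (not_lt.1 h)).hasDerivWithinAt

theorem differentiableWithinAt_lowerInv {A : ℂ → SMat}
    (hne : ∀ n, A x n n ≠ 0) (hd : ∀ i j, DifferentiableWithinAt ℂ (fun s => A s i j) I x) (i j : ℕ) :
    DifferentiableWithinAt ℂ (fun s => lowerInv (A s) i j) I x := by
  induction i using Nat.strong_induction_on with
  | _ i ih =>
    have h : (fun s => lowerInv (A s) i j) = fun s =>
        ((if i = j then 1 else 0) - ∑ k : Fin i, A s i k * lowerInv (A s) k j) / A s i i := by
      funext s; rw [lowerInv]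
    rw [h]
    refine DifferentiableWithinAt.fun_div ?_ (hd i i) (hne i)
    refine (differentiableWithinAt_const _).fun_sub ?_
    exact DifferentiableWithinAt.fun_sum fun k _ => (hd i k).fun_mul (ih k k.2)

/-- In the application `u`, `v`, `a`, `q` are the operators of `Q`, `Q⁻¹`, `(Q⁻¹)'`, `Q'`, and `h`
is the derivative of `Q Q⁻¹ = 1` with products reversed by `op`. It allows `q` to be eliminated. -/
theorem lax_identity {A : Type} [Ring A] {u v a q : A} (huv : u * v = 1) (h : v * q + a * u = 0)
    (x : A) : v * (x * q) + a * (x * u) =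
      -(v * x * u * (a * u) - a * u * (v * x * u)) := by
  have h3 : q = -(u * a * u) := by
    have : u * (v * q + a * u) = 0 := by rw [h, mul_zero]
    rw [mul_add, ← mul_assoc, huv, one_mul] at this
    rw [eq_neg_iff_add_eq_zero, ← this]; noncomm_ring
  have h4 : a * (u * v) * x * u = a * x * u := by rw [huv]; noncomm_ring
  rw [h3]
  calc _ = -(v * x * u * (a * u)) + a * x * u := by noncomm_ring
    _ = _ := by rw [← h4]; noncomm_ring

/-- The Lax equation for `L = Q Λ Q⁻¹`. -/
theorem hasD_matL {Q : ℂ → SMat} (hu : UniqueDiffWithinAt ℂ I x) (hx : x ∈ I)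
    (hQ : ∀ s ∈ I, IsLower (Q s)) (hQd : ∀ s ∈ I, ∀ n, Q s n n ≠ 0) {A' : SMat} (hA'l : IsLower A')
    (hA' : HasD I x (fun s => lowerInv (Q s)) A') :
    HasD I x (fun s => matL (Q s)) (-comm (mul (Q x) A') (matL (Q x))) := by
  have hAl : ∀ s, IsLower (lowerInv (Q s)) := fun s => lowerInv_isLower _
  -- `Q` is recovered from `Q⁻¹` by forward substitution, hence is differentiable too.
  obtain ⟨Q', hQ'l, hQ'⟩ : ∃ Q', IsLower Q' ∧ HasD I x Q Q' := by
    refine exists_hasD_of_isLower hx hQ fun i j _ => ?_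
    have := differentiableWithinAt_lowerInv (A := fun s => lowerInv (Q s))
      (lowerInv_diag_ne_zero (hQ x hx) (hQd x hx)) (fun i j => (hA' i j).differentiableWithinAt) i j
    refine this.congr (fun s hs => ?_) ?_
    · rw [lowerInv_lowerInv (hQ s hs) (hQd s hs)]
    · rw [lowerInv_lowerInv (hQ x hx) (hQd x hx)]
  have hb : ∀ {B : SMat}, IsLower B → ∀ i k, i + 1 ≤ k → B i k = 0 := fun hB i k hk => hB i k hk
  have h1 : mul Q' (lowerInv (Q x)) + mul (Q x) A' = 0 := by
    refine HasD.unique hu (HasD.mul hx hQ' hA' (fun s hs => hb (hQ s hs)) (hb hQ'l)) ?_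
    exact (HasD.const one).congr hx fun s hs => mul_lowerInv (hQ s hs) (hQd s hs)
  have hΛ : HasD I x (fun s => mul (Q s) shift) (mul Q' shift) := by
    have := HasD.mul hx hQ' (HasD.const (I := I) (x := x) shift) (fun s hs => hb (hQ s hs)) (hb hQ'l)
    rwa [mul_zero', add_zero] at this
  -- Row `i` of `Q Λ` reaches no further than column `i + 1`.
  have h2 := HasD.mul (b := fun i => i + 2) hx hΛ hA'
    (fun s hs i k hk => by
      rw [(hQ s hs).mul_apply]
      refine Finset.sum_eq_zero fun l hl => ?_
      have := Finset.mem_range.1 hl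
      rw [shift, if_neg (by omega), mul_zero])
    (fun i k hk => by
      rw [hQ'l.mul_apply]
      refine Finset.sum_eq_zero fun l hl => ?_
      have := Finset.mem_range.1 hl
      rw [shift, if_neg (by omega), mul_zero])
  have hQx := hQ x hx
  have hL := rowFin_matL hQx
  have e : mul (mul Q' shift) (lowerInv (Q x)) + mul (mul (Q x) shift) A' =
      -comm (mul (Q x) A') (matL (Q x)) := by
    have rQ := hQx.rowFin
    have rQ' := hQ'l.rowFin
    have rA' := hA'l.rowFin
    have rA := (hAl x).rowFin
    have rX := rQ.mul rA'
    refine op_injective (((rQ'.mul rowFin_shift).mul rA).add ((rQ.mul rowFin_shift).mul rA'))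
      ((rX.mul hL).sub (hL.mul rX)).neg ?_
    have h1' := congrArg op h1
    rw [op_add (rQ'.mul rA) rX, op_mul rQ' rA, op_mul rQ rA',
      show op 0 = 0 by simpa using op_smul 0 rQ] at h1'
    rw [comm, op_neg ((rX.mul hL).sub (hL.mul rX)), op_sub (rX.mul hL) (hL.mul rX), op_mul rX hL, op_mul hL rX,
      op_add ((rQ'.mul rowFin_shift).mul rA) ((rQ.mul rowFin_shift).mul rA'),
      op_mul (rQ'.mul rowFin_shift) rA, op_mul rQ' rowFin_shift, op_mul (rQ.mul rowFin_shift) rA',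
      op_mul rQ rowFin_shift, op_mul rQ rA', op_matL hQx, op_shift]
    exact lax_identity (op_mul_op_lowerInv hQx (hQd x hx)) h1' _
  rw [← e]
  exact h2

/-- The derivative of a factorization `m = A C Aᵀ`. -/
theorem congruence_deriv {Q m : ℂ → SMat} {A' C m' : SMat} (hu : UniqueDiffWithinAt ℂ I x)
    (hx : x ∈ I) (hQ : ∀ s ∈ I, IsLower (Q s)) (hQd : ∀ s ∈ I, ∀ n, Q s n n ≠ 0)
    (hA'l : IsLower A') (hA' : HasD I x (fun s => lowerInv (Q s)) A')
    (hC : RowFin C)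
    (hm : ∀ s ∈ I, m s = mul (mul (lowerInv (Q s)) C) (tr (lowerInv (Q s))))
    (hm' : HasD I x m m') :
    mul (mul (Q x) m') (tr (Q x)) = mul (mul (Q x) A') C + mul C (tr (mul (Q x) A')) := by
  have hAl : ∀ s, IsLower (lowerInv (Q s)) := fun s => lowerInv_isLower _
  have hb : ∀ {B : SMat}, IsLower B → ∀ i k, i + 1 ≤ k → B i k = 0 := fun hB i k hk => hB i k hk
  choose c hc using hC
  have hb2 : ∀ {B : SMat}, IsLower B → ∀ i k, (Finset.range (i + 1)).sup c ≤ k →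
      mul B C i k = 0 := fun hB i k hk => by
    rw [hB.mul_apply]
    exact Finset.sum_eq_zero fun l hl => by rw [hc l k ((Finset.le_sup hl).trans hk), mul_zero]
  have h1 : HasD I x (fun s => mul (lowerInv (Q s)) C) (mul A' C) := by
    have := HasD.mul hx hA' (HasD.const (I := I) (x := x) C) (fun s _ => hb (hAl s)) (hb hA'l)
    rwa [mul_zero', add_zero] at this
  have h2 := (HasD.mul hx h1 hA'.tr (fun s _ => hb2 (hAl s)) (hb2 hA'l)).congr hx hm
  rw [HasD.unique hu hm' h2, mul_add' (hQ x hx).rowFin, add_mul' (by exact (hQ x hx).rowFin),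
    congruence_cancel (hQ x hx) (hAl x) (mul_lowerInv (hQ x hx) (hQd x hx)) hA'l.rowFin,
    congruence_cancel' (hQ x hx) (hAl x) (mul_lowerInv (hQ x hx) (hQd x hx)) hA'l.rowFin]

end Flow

/-! ### Gram–Schmidt -/

/-- One Gram–Schmidt step: invertibility of the leading block lets a combination of its rows cancel
the first `n` entries of `r`. -/
theorem exists_orthogonal_row {m : SMat} {n : ℕ} (hdet : leadingDet m n ≠ 0) (r : ℕ → ℂ) :
    ∃ c : ℕ → ℂ, ∀ l < n, r l + ∑ k ∈ Finset.range n, c k * m k l = 0 := by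
  set M : Matrix (Fin n) (Fin n) ℂ := Matrix.of fun i j : Fin n => m i j with hM
  have hu : IsUnit M.det := isUnit_iff_ne_zero.2 hdet
  set v : Fin n → ℂ := Matrix.vecMul (fun l : Fin n => -r l) M⁻¹ with hv
  have hvM : Matrix.vecMul v M = fun l : Fin n => -r l := by
    rw [hv, Matrix.vecMul_vecMul, Matrix.nonsing_inv_mul _ hu, Matrix.vecMul_one]
  refine ⟨fun k => if h : k < n then v ⟨k, h⟩ else 0, fun l hl => ?_⟩
  have h := congrFun hvM ⟨l, hl⟩
  simp only [Matrix.vecMul, dotProduct, hM, Matrix.of_apply] at h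
  rw [Finset.sum_range, add_comm, ← eq_neg_iff_add_eq_zero, ← h]
  exact Finset.sum_congr rfl fun k _ => by simp

theorem leadingDet_eq_zero {m : SMat} {n : ℕ} (v : ℕ → ℂ) {i : ℕ} (hi : i < n) (hv : v i ≠ 0)
    (h : ∀ l < n, ∑ k ∈ Finset.range n, v k * m k l = 0) : leadingDet m n = 0 := by
  refine Matrix.exists_vecMul_eq_zero_iff.1 ⟨fun k : Fin n => v k, fun h0 => ?_, ?_⟩
  · exact hv (congrFun h0 ⟨i, hi⟩)
  · funext l
    have := h l l.2
    rw [Finset.sum_range] at this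
    exact this

theorem eq_of_congruence {S m C : SMat} (hS : IsLower S) (hd : ∀ n, S n n ≠ 0)
    (h : mul (mul S m) (tr S) = C) : m = mul (mul (lowerInv S) C) (tr (lowerInv S)) := by
  have rA := (lowerInv_isLower S).rowFin
  rw [← h, ← mul_assoc_outer rA (by exact hS.rowFin), mul_assoc_right (by exact hS.rowFin)
    (by exact rA), ← tr_mul, lowerInv_mul hS hd, tr_one, mul_one',
    ← mul_assoc_left rA hS.rowFin, lowerInv_mul hS hd, one_mul']

theorem congruence_of_eq {S m C : SMat} (hS : IsLower S) (hd : ∀ n, S n n ≠ 0)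
    (h : m = mul (mul (lowerInv S) C) (tr (lowerInv S))) : mul (mul S m) (tr S) = C := by
  rw [h, congruence_cancel hS (lowerInv_isLower S) (mul_lowerInv hS hd) (lowerInv_isLower S).rowFin,
    mul_lowerInv hS hd, one_mul']

theorem IsLower.mul_tr_apply {A : SMat} (hA : IsLower A) (B : SMat) (i j : ℕ) :
    TodaPfaff.mul B (tr A) i j = ∑ k ∈ Finset.range (j + 1), A j k * B i k := by
  rw [← tr_tr (TodaPfaff.mul B (tr A)), tr_mul, tr_tr, tr, hA.mul_apply]; rfl

theorem tr_congruence {S m : SMat} (hS : IsLower S) :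
    tr (mul (mul S m) (tr S)) = mul (mul S (tr m)) (tr S) := by
  rw [tr_mul, tr_mul, tr_tr, mul_assoc_outer hS.rowFin (by exact hS.rowFin)]

/-- Gram–Schmidt with unit leading coefficients makes `U m` upper triangular, so `U m Uᵀ` is both
upper triangular and symmetric, hence diagonal. Complex square roots of the diagonal entries
normalize the rows. -/
theorem exists_cholesky {m : SMat} (hsym : tr m = m) (hdet : ∀ n, leadingDet m n ≠ 0) :
    ∃ S, IsLower S ∧ (∀ n, S n n ≠ 0) ∧ m = mul (lowerInv S) (tr (lowerInv S)) := by
  choose c hc using fun n => exists_orthogonal_row (hdet n) (m n)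
  set U : SMat := fun n k => if k < n then c n k else if k = n then 1 else 0 with hU
  have hUl : IsLower U := fun i j hij => by
    simp only [hU]; rw [if_neg (by omega), if_neg (by omega)]
  have hUd : ∀ n, U n n = 1 := fun n => by simp [hU]
  have hUm : ∀ n l, mul U m n l = m n l + ∑ k ∈ Finset.range n, c n k * m k l := by
    intro n l
    rw [hUl.mul_apply, Finset.sum_range_succ, hUd, one_mul, add_comm]
    congr 1
    exact Finset.sum_congr rfl fun k hk => by simp [hU, Finset.mem_range.1 hk]
  have h0 : ∀ n, ∀ l < n, mul U m n l = 0 := fun n l hl => by rw [hUm, hc n l hl]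
  -- A vanishing pivot would make row `n` of `U` a left null vector of the leading block of size `n
  -- + 1`.
  have hne : ∀ n, mul U m n n ≠ 0 := by
    intro n hn
    refine hdet (n + 1) (leadingDet_eq_zero (U n) (Nat.lt_succ_self n) (by rw [hUd]; simp) ?_)
    intro l hl
    rw [← hUl.mul_apply]
    rcases Nat.lt_succ_iff_lt_or_eq.1 hl with h | h
    · exact h0 n l h
    · rw [h, hn]
  choose r hr using fun n => IsAlgClosed.exists_pow_nat_eq (mul U m n n) (n := 2) two_pos
  have hr0 : ∀ n, r n ≠ 0 := fun n h => hne n (by rw [← hr, h]; simp)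
  set S : SMat := fun n k => (r n)⁻¹ * U n k with hS
  have hSl : IsLower S := fun i j hij => by simp only [hS]; rw [hUl i j hij, mul_zero]
  have hSd : ∀ n, S n n ≠ 0 := fun n => by
    simp only [hS, hUd, mul_one]; exact inv_ne_zero (hr0 n)
  have hSm : ∀ n l, mul S m n l = (r n)⁻¹ * mul U m n l := by
    intro n l
    rw [hSl.mul_apply, hUl.mul_apply, Finset.mul_sum]
    exact Finset.sum_congr rfl fun k _ => mul_assoc _ _ _
  have hlow : ∀ n l, l < n → mul (mul S m) (tr S) n l = 0 := by
    intro n l hl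
    rw [hSl.mul_tr_apply]
    refine Finset.sum_eq_zero fun k hk => ?_
    have := Finset.mem_range.1 hk
    rw [hSm, h0 n k (by omega)]; ring
  have key : mul (mul S m) (tr S) = one := by
    funext n l
    rcases lt_trichotomy l n with h | h | h
    · rw [hlow n l h]; simp [one, h.ne']
    · subst h
      rw [hSl.mul_tr_apply, Finset.sum_range_succ, Finset.sum_eq_zero, hSm, ← hr]
      · have := hr0 l
        simp only [hS, hUd, one, if_true]
        field_simp; ring
      · intro k hk
        rw [hSm, h0 l k (Finset.mem_range.1 hk)]; ring
    · have := hlow l n h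
      have e := tr_congruence (m := m) hSl
      rw [hsym] at e
      rw [← e, tr, this]; simp [one, h.ne]
  refine ⟨S, hSl, hSd, ?_⟩
  have := eq_of_congruence hSl hSd key
  rwa [mul_one'] at this

/-! ### The Toda lattice -/

section Toda

variable {E : Set ℝ} {V : ℝ → ℝ} {t : Times} {S : SMat}

theorem moment_apply (i j : ℕ) : moment E V t i j =
    momentLin E V t (Polynomial.X ^ i * Polynomial.X ^ j) := symIP_pfun _ _

theorem moment_symm : tr (moment E V t) = moment E V t := by
  funext i j
  rw [tr, moment_apply, moment_apply, mul_comm]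

theorem congruence_moment (ht : Admissible E V t) {S T : SMat} (hS : RowFin S) (hT : RowFin T)
    (i j : ℕ) : mul (mul S (moment E V t)) (tr T) i j =
      momentLin E V t (op S (Polynomial.X ^ i) * op T (Polynomial.X ^ j)) := by
  refine mul_mul_tr_apply (B := fun P Q => momentLin E V t (P * Q)) (fun Q => ?_) (fun P => ?_)
    (fun i j => (moment_apply i j).symm) hS hT i j
  · exact ((momentMap ht).comp (LinearMap.mulRight ℂ Q)).isLinear
  · exact ((momentMap ht).comp (LinearMap.mulLeft ℂ P)).isLinear

theorem IsTodaFactor.congruence (hS : IsTodaFactor E V t S) :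
    mul (mul S (moment E V t)) (tr S) = one :=
  congruence_of_eq hS.1 hS.2.1 (by rw [mul_one']; exact hS.2.2)

theorem IsTodaFactor.orthonormal (ht : Admissible E V t) (hS : IsTodaFactor E V t S) (i j : ℕ) :
    momentLin E V t (polyP S i * polyP S j) = if i = j then 1 else 0 := by
  rw [polyP_eq hS.1, polyP_eq hS.1, ← congruence_moment ht hS.1.rowFin hS.1.rowFin, hS.congruence]
  rfl

/-- Orthonormality reads off the coefficient of `p_i` in the expansion of `𝕟_t p_j`; skewness of `𝒩`
then follows from that of `𝕟_t`. -/
theorem IsTodaFactor.matN_apply (ht : Admissible E V t) (hS : IsTodaFactor E V t S)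
    (f g : Polynomial ℝ) (i j : ℕ) :
    matN f g t S j i = momentLin E V t (polyP S i * nPoly f g t (polyP S j)) := by
  obtain ⟨N, hN⟩ := rowFin_matN f g t hS.1 j
  rw [nPoly_polyP f g t hS.1 hS.2.1 hN, Finset.mul_sum, ← momentMap_apply ht, map_sum]
  simp only [mul_smul_comm, map_smul, momentMap_apply, hS.orthonormal ht, smul_eq_mul]
  simp only [mul_ite, mul_one, mul_zero, Finset.sum_ite_eq, Finset.mem_range]
  split_ifs with h
  · rfl
  · exact hN i (not_lt.1 h)

theorem nOp_polyP {a b : EReal} {f g : Polynomial ℝ}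
    (hf : ∀ z ∈ interval a b, 0 < f.eval z)
    (hV : ∀ z ∈ interval a b, HasDerivAt V (g.eval z / f.eval z) z)
    (hS : IsLower S) (hd : ∀ n, S n n ≠ 0) (n : ℕ) {z : ℝ} (hz : z ∈ interval a b) :
    nOp f V t (pfun (polyP S n)) z = ∑ᶠ k, matN f g t S n k * pfun (polyP S k) z := by
  obtain ⟨N, hN⟩ := rowFin_matN f g t hS n
  rw [nOp_pfun (hf z hz) (hV z hz), nPoly_polyP f g t hS hd hN,
    finsum_eq_sum_of_support_subset (s := Finset.range N)]
  · simp [pfun, Polynomial.eval_finsetSum]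
  · intro k hk
    by_contra hk'
    have : N ≤ k := by simpa using hk'
    exact hk (by simp [hN k this])

theorem mul_pow_shift_apply (m : SMat) (j k l : ℕ) : mul (pow shift j) m k l = m (k + j) l := by
  rw [mul_apply_range (n := k + j + 1), Finset.sum_eq_single (k + j)]
  · simp [pow_shift_apply]
  · intro i _ hi; simp [pow_shift_apply, hi]
  · simp
  · intro i hi; rw [pow_shift_apply, if_neg (by omega)]

theorem hasD_moment {j : ℕ+} {I : Set ℂ} (h0 : (0 : ℂ) ∈ I)
    (hI : ∀ s ∈ I, Admissible E V (t + Finsupp.single j s)) :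
    HasD I 0 (fun s => moment E V (t + Finsupp.single j s))
      (mul (pow shift j) (moment E V t)) := by
  intro k l
  rw [mul_pow_shift_apply, moment_apply]
  simp only [moment_apply]
  rw [show (Polynomial.X ^ (k + (j : ℕ)) * Polynomial.X ^ l : Polynomial ℂ) =
    Polynomial.X ^ (j : ℕ) * (Polynomial.X ^ k * Polynomial.X ^ l) by ring]
  exact hasDerivWithinAt_momentLin h0 hI _

end Toda

/-! ### Differentiability of the triangular factors and the Toda flow -/

/-- A continuous square root of a differentiable function is differentiable where it does not
vanish. -/
theorem differentiableWithinAt_of_sq {h : ℂ → ℂ} {I : Set ℂ} {x : ℂ}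
    (hd : DifferentiableWithinAt ℂ (fun s => h s * h s) I x) (hc : ContinuousWithinAt h I x)
    (hne : h x ≠ 0) : DifferentiableWithinAt ℂ h I x := by
  have h1 := hasDerivWithinAt_iff_tendsto_slope.1 hd.hasDerivWithinAt
  -- The slope of `h` is the slope of `h²` divided by `h s + h x`, which tends to `2 h x`.
  have hc' : Tendsto (fun s => h s + h x) (𝓝[I \ {x}] x) (𝓝 (h x + h x)) :=
    ((hc.mono_left (nhdsWithin_mono _ Set.sdiff_subset)).add_const _)
  have hne' : h x + h x ≠ 0 := by rw [← two_mul]; exact mul_ne_zero two_ne_zero hne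
  refine (hasDerivWithinAt_iff_tendsto_slope.2 ((h1.div hc' hne').congr' ?_)).differentiableWithinAt
  filter_upwards [hc'.eventually_ne hne'] with s hs
  rw [Pi.div_apply, slope_def_field, slope_def_field, div_div, mul_self_sub_mul_self, mul_comm (s - x),
    mul_div_mul_left _ _ hs]

/-- Column by column: `A_jj A_ij` is an entry of `A Aᵀ` minus products from earlier columns. The
case `i = j` gives the square of the diagonal entry, whose continuity excludes sign jumps and makes
it differentiable; division by it settles the rest of the column. -/
theorem differentiableWithinAt_cholesky {A : ℂ → SMat} {I : Set ℂ} {x : ℂ} (hx : x ∈ I)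
    (hA : ∀ s ∈ I, IsLower (A s)) (hc : ∀ n, ContinuousWithinAt (fun s => A s n n) I x)
    (hne : ∀ n, A x n n ≠ 0)
    (hm : ∀ i j, DifferentiableWithinAt ℂ (fun s => mul (A s) (tr (A s)) i j) I x) (i j : ℕ)
    (hij : j ≤ i) : DifferentiableWithinAt ℂ (fun s => A s i j) I x := by
  induction j using Nat.strong_induction_on generalizing i with
  | _ j ih =>
    have h1 : ∀ i, j ≤ i → DifferentiableWithinAt ℂ (fun s => A s j j * A s i j) I x := by
      intro i hij
      have h2 : DifferentiableWithinAt ℂ (fun s => mul (A s) (tr (A s)) j i -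
          ∑ k ∈ Finset.range j, A s j k * A s i k) I x := by
        refine (hm j i).fun_sub (DifferentiableWithinAt.fun_sum fun k hk => ?_)
        have hk := Finset.mem_range.1 hk
        exact (ih k hk j hk.le).fun_mul (ih k hk i (hk.le.trans hij))
      have h3 : ∀ s ∈ I, A s j j * A s i j = mul (A s) (tr (A s)) j i -
          ∑ k ∈ Finset.range j, A s j k * A s i k := by
        intro s hs
        rw [(hA s hs).mul_apply, Finset.sum_range_succ]
        simp only [tr]; ring
      exact h2.congr h3 (h3 x hx)
    have hjj := differentiableWithinAt_of_sq (h1 j le_rfl) (hc j) (hne j)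
    have hev : ∀ᶠ s in 𝓝[I] x, A s j j ≠ 0 := (hc j).eventually_ne (hne j)
    refine ((h1 i hij).fun_div hjj (hne j)).congr_of_eventuallyEq ?_ ?_
    · filter_upwards [hev] with s hs
      rw [mul_div_cancel_left₀ _ hs]
    · rw [mul_div_cancel_left₀ _ (hne j)]

/-- At a point that is not an accumulation point every function has every derivative. -/
theorem hasDerivWithinAt_of_uniqueDiff {h : ℂ → ℂ} {h' x : ℂ} {I : Set ℂ}
    (H : UniqueDiffWithinAt ℂ I x → HasDerivWithinAt h h' I x) : HasDerivWithinAt h h' I x := by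
  by_cases hacc : AccPt x (𝓟 I)
  · exact H (uniqueDiffWithinAt_iff_accPt.2 hacc)
  · exact hasDerivWithinAt_iff_hasFDerivWithinAt.2 (HasFDerivWithinAt.of_not_accPt hacc)

theorem congruence_pow_shift {Q m C : SMat} (hQ : IsLower Q) (hd : ∀ n, Q n n ≠ 0)
    (hm : m = mul (mul (lowerInv Q) C) (tr (lowerInv Q))) (j : ℕ) :
    mul (mul Q (mul (pow shift j) m)) (tr Q) = mul (pow (matL Q) j) C := by
  have hA := lowerInv_isLower Q
  have hΛ := rowFin_shift.pow j
  rw [hm, ← mul_assoc_outer hΛ (by exact hA.rowFin), ← mul_assoc_left hΛ hA.rowFin,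
    congruence_cancel hQ hA (mul_lowerInv hQ hd) (hΛ.mul hA.rowFin), pow_matL hQ hd,
    mul_assoc_left hQ.rowFin hΛ]

/-- Since `X` is lower triangular, the hypothesis gives the skew part of `Lʲ` as `Lʲ - 2X`, and `Lʲ`
commutes with `L`. -/
theorem half_comm_skewPart {X L : SMat} {j : ℕ} (hX : IsLower X) (hL : RowFin L)
    (h : X + tr X = pow L j) : (1 / 2 : ℂ) • comm (skewPart (pow L j)) L = -comm X L := by
  have hP := hL.pow j
  have e : skewPart (pow L j) = pow L j - X - X := by
    rw [← h]
    funext k l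
    simp only [skewPart, Pi.add_apply, Pi.sub_apply, tr]
    rcases lt_trichotomy k l with hkl | hkl | hkl
    · rw [if_pos hkl, hX k l hkl]; ring
    · subst hkl; simp
    · rw [if_neg hkl.not_gt, if_pos hkl, hX l k hkl]; ring
  have rX := hX.rowFin
  have rK := (hP.sub rX).sub rX
  rw [e]
  have r1 := (rK.mul hL).sub (hL.mul rK)
  have r2 := (rX.mul hL).sub (hL.mul rX)
  refine op_injective (r1.smul _) r2.neg ?_
  rw [comm, comm, op_smul _ r1, op_neg r2, op_sub (rK.mul hL) (hL.mul rK),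
    op_sub (rX.mul hL) (hL.mul rX), op_mul rK hL, op_mul hL rK, op_mul rX hL, op_mul hL rX,
    op_sub (hP.sub rX) rX, op_sub hP rX, op_pow hL]
  have hcomm : op L * op L ^ j = op L ^ j * op L := (pow_mul_comm' _ _).symm
  generalize op L ^ j = p at *
  have : op L * (p - op X - op X) - (p - op X - op X) * op L =
      (2 : ℂ) • -(op L * op X - op X * op L) := by
    rw [two_smul, mul_sub, mul_sub, sub_mul, sub_mul, hcomm]; abel
  rw [this, smul_smul]; norm_num

/-- The Toda flow. -/
theorem toda_lax {E : Set ℝ} {V : ℝ → ℝ} {t : Times} {j : ℕ+} {I : Set ℂ} (h0 : (0 : ℂ) ∈ I)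
    (hI : ∀ s ∈ I, Admissible E V (t + Finsupp.single j s)) {S : ℂ → SMat}
    (hS : ∀ s ∈ I, IsTodaFactor E V (t + Finsupp.single j s) (S s))
    (hc : ∀ n, ContinuousWithinAt (fun s => S s n n) I 0) :
    HasD I 0 (fun s => matL (S s)) ((1 / 2 : ℂ) • comm (skewPart (pow (matL (S 0)) j)) (matL (S 0))) := by
  intro k l
  refine hasDerivWithinAt_of_uniqueDiff fun hu => ?_
  have hSl := fun s hs => (hS s hs).1
  have hSd := fun s hs => (hS s hs).2.1
  have hm := hasD_moment h0 hI
  obtain ⟨A', hA'l, hA'⟩ : ∃ A', IsLower A' ∧ HasD I 0 (fun s => lowerInv (S s)) A' := by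
    refine exists_hasD_of_isLower h0 (fun s _ => lowerInv_isLower _) ?_
    refine differentiableWithinAt_cholesky h0 (fun s _ => lowerInv_isLower _) (fun n => ?_)
      (lowerInv_diag_ne_zero (hSl 0 h0) (hSd 0 h0)) fun i j => ?_
    · exact ((hc n).inv₀ (hSd 0 h0 n)).congr (fun s hs => lowerInv_diag (hSl s hs) (hSd s hs) n)
        (lowerInv_diag (hSl 0 h0) (hSd 0 h0) n)
    · exact ((hm i j).differentiableWithinAt).congr
        (fun s hs => (congrFun₂ (hS s hs).2.2 i j).symm) (congrFun₂ (hS 0 h0).2.2 i j).symm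
  have hfac : ∀ s ∈ I, moment E V (t + Finsupp.single j s) =
      mul (mul (lowerInv (S s)) one) (tr (lowerInv (S s))) := fun s hs => by
    rw [mul_one']; exact (hS s hs).2.2
  -- With `X = S (S⁻¹)'` this reads `X + Xᵀ = S Λʲ m Sᵀ`, and the right side is `Lʲ`.
  have h1 := congruence_deriv hu h0 hSl hSd hA'l hA' isLower_one.rowFin hfac hm
  have hfac0 := hfac 0 h0
  rw [Finsupp.single_zero, add_zero] at hfac0
  rw [congruence_pow_shift (hSl 0 h0) (hSd 0 h0) hfac0, mul_one', mul_one', one_mul'] at h1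
  rw [half_comm_skewPart ((hSl 0 h0).mul hA'l) (rowFin_matL (hSl 0 h0)) h1.symm]
  exact hasD_matL hu h0 hSl hSd hA'l hA' k l

/-! ### Pfaffians -/

theorem sum_sign_prod_eq_det {n : ℕ} (B : Matrix (Fin (2 * n)) (Fin (2 * n)) ℂ)
    (f : Fin (2 * n) → Fin (2 * n)) :
    ∑ σ : Equiv.Perm (Fin (2 * n)), ((Equiv.Perm.sign σ : ℤ) : ℂ) * ∏ i, B (σ i) (f i) =
      (B.submatrix id f).det := by
  rw [Matrix.det_apply']; rfl

/-- Pairs of maps as maps on pairs of consecutive indices. -/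
def pairFunEquiv (n : ℕ) : (Fin n → Fin (2 * n) × Fin (2 * n)) ≃ (Fin (2 * n) → Fin (2 * n)) :=
  (Equiv.arrowCongr (Equiv.refl (Fin n)) (finTwoArrowEquiv (Fin (2 * n))).symm).trans
    ((Equiv.curry (Fin n) (Fin 2) (Fin (2 * n))).symm.trans
      (Equiv.arrowCongr (pairEquiv n) (Equiv.refl (Fin (2 * n)))))

theorem pairFunEquiv_zero {n : ℕ} (F : Fin n → Fin (2 * n) × Fin (2 * n)) (k : Fin n) :
    pairFunEquiv n F ⟨2 * k, by omega⟩ = (F k).1 := by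
  rw [← pairEquiv_zero]
  simp [pairFunEquiv]

theorem pairFunEquiv_one {n : ℕ} (F : Fin n → Fin (2 * n) × Fin (2 * n)) (k : Fin n) :
    pairFunEquiv n F ⟨2 * k + 1, by omega⟩ = (F k).2 := by
  rw [← pairEquiv_one]
  simp [pairFunEquiv]

/-- Expand the entries over all index maps `f`. The sum over `σ` produces the determinant of `B`
with columns selected by `f`, which vanishes unless `f` is a permutation and is then `± det B`. -/
theorem pfaffian_congruence {n : ℕ} (A B : Matrix (Fin (2 * n)) (Fin (2 * n)) ℂ) :
    pfaffian (B * A * B.transpose) = B.det * pfaffian A := by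
  set Φ : (Fin (2 * n) → Fin (2 * n)) → ℂ := fun f =>
    ∏ k : Fin n, A (f ⟨2 * k, by omega⟩) (f ⟨2 * k + 1, by omega⟩) with hΦ
  have h1 : ∀ x y, (B * A * B.transpose) x y =
      ∑ p : Fin (2 * n) × Fin (2 * n), B x p.1 * A p.1 p.2 * B y p.2 := by
    intro x y
    rw [Fintype.sum_prod_type, Finset.sum_comm]
    simp only [Matrix.mul_apply, Matrix.transpose_apply, Finset.sum_mul]
  have h2 : ∀ σ : Equiv.Perm (Fin (2 * n)),
      ∏ k : Fin n, (B * A * B.transpose) (σ ⟨2 * k, by omega⟩) (σ ⟨2 * k + 1, by omega⟩) =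
      ∑ f : Fin (2 * n) → Fin (2 * n), Φ f * ∏ i, B (σ i) (f i) := by
    intro σ
    simp_rw [h1]
    rw [Fintype.prod_sum, ← (pairFunEquiv n).sum_comp]
    refine Finset.sum_congr rfl fun F _ => ?_
    rw [prod_pairEquiv, hΦ, ← Finset.prod_mul_distrib]
    refine Finset.prod_congr rfl fun k _ => ?_
    rw [pairFunEquiv_zero, pairFunEquiv_one]
    ring
  have h3 : ∑ σ : Equiv.Perm (Fin (2 * n)), ((Equiv.Perm.sign σ : ℤ) : ℂ) *
      ∏ k : Fin n, (B * A * B.transpose) (σ ⟨2 * k, by omega⟩) (σ ⟨2 * k + 1, by omega⟩) =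
      ∑ f : Fin (2 * n) → Fin (2 * n), Φ f * (B.submatrix id f).det := by
    simp_rw [h2, Finset.mul_sum]
    rw [Finset.sum_comm]
    refine Finset.sum_congr rfl fun f _ => ?_
    rw [← sum_sign_prod_eq_det, Finset.mul_sum]
    exact Finset.sum_congr rfl fun σ _ => by ring
  have h4 : ∑ f : Fin (2 * n) → Fin (2 * n), Φ f * (B.submatrix id f).det =
      ∑ τ : Equiv.Perm (Fin (2 * n)), Φ τ * (B.submatrix id τ).det := by
    symm
    refine Finset.sum_of_injOn (s := Finset.univ) (t := Finset.univ)
      (f := fun τ : Equiv.Perm (Fin (2 * n)) => Φ τ * (B.submatrix id τ).det)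
      (g := fun f => Φ f * (B.submatrix id f).det)
      (fun τ : Equiv.Perm (Fin (2 * n)) => (τ : Fin (2 * n) → Fin (2 * n)))
      (fun σ _ τ _ h => Equiv.coe_fn_injective h) (fun _ _ => Finset.mem_univ _) ?_
      (fun _ _ => rfl)
    intro f _ hf
    have hinj : ¬ Function.Injective f := by
      intro h
      exact hf ⟨Equiv.ofBijective f (Finite.injective_iff_bijective.1 h), by simp, rfl⟩
    simp only [Function.Injective, not_forall] at hinj
    obtain ⟨i, j, hij, hne⟩ := hinj
    rw [Matrix.det_zero_of_column_eq hne fun k => by simp [hij], mul_zero]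
  rw [pfaffian, h3, h4, pfaffian, mul_left_comm]
  congr 1
  rw [Finset.mul_sum]
  refine Finset.sum_congr rfl fun τ _ => ?_
  rw [Matrix.det_permute', hΦ]
  ring

theorem pfaffian_eq_zero_of_row {n : ℕ} {A : Matrix (Fin (2 * n)) (Fin (2 * n)) ℂ}
    {i : Fin (2 * n)} (h : ∀ j, A i j = 0) (h' : ∀ j, A j i = 0) : pfaffian A = 0 := by
  rw [pfaffian]
  refine mul_eq_zero_of_right _ (Finset.sum_eq_zero fun σ _ => mul_eq_zero_of_right _ ?_)
  obtain ⟨⟨k, e⟩, hk⟩ := (pairEquiv n).surjective (σ.symm i)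
  have hk' : σ (pairEquiv n (k, e)) = i := by rw [hk, Equiv.apply_symm_apply]
  refine Finset.prod_eq_zero (Finset.mem_univ k) ?_
  fin_cases e
  · have : σ ⟨2 * k, by omega⟩ = i := hk'
    rw [this, h]
  · have : σ ⟨2 * k + 1, by omega⟩ = i := hk'
    rw [this, h']

/-- Replace row `i` of the identity by a null vector `v` with `v i ≠ 0`. The congruence by this
matrix gives `A` a zero row and column, so the Pfaffian vanishes, while `pfaffian_congruence`
multiplies it by `v i`. -/
theorem det_ne_zero_of_pfaffian_ne_zero {n : ℕ} {A : Matrix (Fin (2 * n)) (Fin (2 * n)) ℂ}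
    (hskew : A.transpose = -A) (hA : pfaffian A ≠ 0) : A.det ≠ 0 := by
  intro hdet
  obtain ⟨v, hv, hvA⟩ := Matrix.exists_vecMul_eq_zero_iff.2 hdet
  obtain ⟨i, hi⟩ : ∃ i, v i ≠ 0 := by
    by_contra h
    push Not at h
    exact hv (funext h)
  set B : Matrix (Fin (2 * n)) (Fin (2 * n)) ℂ := (1 : Matrix _ _ ℂ).updateRow i v with hB
  have hBdet : B.det = v i := by
    have := Matrix.cramer_transpose_apply (1 : Matrix (Fin (2 * n)) (Fin (2 * n)) ℂ) v i
    rw [Matrix.transpose_one, Matrix.cramer_one] at this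
    exact this.symm
  have h1 : ∀ j, (B * A * B.transpose) i j = 0 := by
    intro j
    rw [Matrix.mul_apply]
    refine Finset.sum_eq_zero fun k _ => ?_
    have : (B * A) i k = Matrix.vecMul v A k := by
      simp [Matrix.mul_apply, hB, Matrix.vecMul, dotProduct]
    rw [this, hvA]; simp
  have h2 : (B * A * B.transpose).transpose = -(B * A * B.transpose) := by
    rw [Matrix.transpose_mul, Matrix.transpose_mul, hskew, Matrix.transpose_transpose]
    simp [Matrix.mul_assoc]
  have h3 : ∀ j, (B * A * B.transpose) j i = 0 := by
    intro j
    have := congrFun₂ h2 i j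
    rw [Matrix.transpose_apply, Matrix.neg_apply, h1, neg_zero] at this
    exact this
  have := pfaffian_eq_zero_of_row h1 h3
  rw [pfaffian_congruence, hBdet] at this
  exact (mul_ne_zero hi hA) this

theorem leadingDet_ne_zero_of_leadingPf {m : SMat} (hskew : tr m = -m) {n : ℕ}
    (h : leadingPf m n ≠ 0) : leadingDet m (2 * n) ≠ 0 := by
  refine det_ne_zero_of_pfaffian_ne_zero ?_ h
  ext i j
  exact congrFun₂ hskew i j

/-! ### The matrix `J` -/

/-- The other index of a `2 × 2` block. -/
def partner (i : ℕ) : ℕ := if i % 2 = 0 then i + 1 else i - 1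

/-- The sign of the nonzero entry of a row of `J`. -/
def parity (i : ℕ) : ℂ := if i % 2 = 0 then 1 else -1

theorem partner_partner (i : ℕ) : partner (partner i) = i := by
  unfold partner; split_ifs <;> omega

theorem partner_div (i : ℕ) : partner i / 2 = i / 2 := by
  unfold partner; split_ifs <;> omega

theorem parity_partner (i : ℕ) : parity (partner i) = -parity i := by
  unfold parity partner
  split_ifs <;> first | omega | simp

theorem parity_mul_self (i : ℕ) : parity i * parity i = 1 := by
  unfold parity; split_ifs <;> simp

theorem J_apply (i j : ℕ) : J i j = if j = partner i then parity i else 0 := by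
  unfold J partner parity
  simp only [Nat.even_iff]
  split_ifs <;> first | rfl | omega

theorem J_mul_apply (A : SMat) (i j : ℕ) : mul J A i j = parity i * A (partner i) j := by
  have : partner i < i + 2 := by unfold partner; split_ifs <;> omega
  rw [mul_apply_range (n := i + 2), Finset.sum_eq_single (partner i)]
  · rw [J_apply, if_pos rfl]
  · intro k _ hk; rw [J_apply, if_neg hk, zero_mul]
  · intro h; exact absurd (Finset.mem_range.2 this) h
  · intro k hk; rw [J_apply, if_neg (by omega)]

theorem tr_J : tr J = -J := by
  funext i j
  rw [tr, Pi.neg_apply, Pi.neg_apply, J_apply, J_apply]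
  by_cases h : j = partner i
  · subst h
    rw [if_pos (partner_partner i).symm, if_pos rfl, parity_partner]
  · rw [if_neg h, if_neg, neg_zero]
    rintro rfl
    exact h (partner_partner j).symm

theorem mul_J_apply (A : SMat) (i j : ℕ) : mul A J i j = -parity j * A i (partner j) := by
  rw [← tr_tr (mul A J), tr_mul, tr_J, neg_mul', tr, Pi.neg_apply, Pi.neg_apply, J_mul_apply, tr]
  ring

theorem invol_apply (A : SMat) (i j : ℕ) :
    invol A i j = -(parity i * parity j) * A (partner j) (partner i) := by
  rw [invol, mul_J_apply, J_mul_apply, tr]; ring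

/-- The Lie algebra of `𝒢_𝕜`. -/
def IsK (X : SMat) : Prop :=
  IsLower X ∧ ∀ n, X (2 * n + 1) (2 * n + 1) = X (2 * n) (2 * n) ∧ X (2 * n + 1) (2 * n) = 0

theorem IsK.same_block {X : SMat} (hX : IsK X) {i j : ℕ} (hij : i / 2 = j / 2) :
    X i j = if i = j then X (2 * (i / 2)) (2 * (i / 2)) else 0 := by
  obtain ⟨hl, hn⟩ := hX
  rcases Nat.mod_two_eq_zero_or_one i with hi | hi <;>
    rcases Nat.mod_two_eq_zero_or_one j with hj | hj
  · obtain rfl : i = j := by omega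
    rw [if_pos rfl, show 2 * (i / 2) = i by omega]
  · rw [if_neg (by omega), hl i j (by omega)]
  · rw [if_neg (by omega)]
    have := (hn (j / 2)).2
    rwa [show 2 * (j / 2) + 1 = i by omega, show 2 * (j / 2) = j by omega] at this
  · obtain rfl : i = j := by omega
    have := (hn (i / 2)).1
    rw [show 2 * (i / 2) + 1 = i by omega] at this
    rw [if_pos rfl, this]

/-- The hypothesis `h` says that `P - X` is fixed by `invol`, so `P = X + (P - X)` is the
decomposition that defines the projection. The entries are compared above, on and below the block
diagonal. -/
theorem projK_eq {P X : SMat} (hX : IsK X)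
    (h : mul X J + mul J (tr X) = mul P J + mul J (tr P)) : projK P = X := by
  have key : ∀ i j, X i j + parity i * parity j * X (partner j) (partner i) =
      P i j + parity i * parity j * P (partner j) (partner i) := by
    intro i j
    have := congrFun₂ h i (partner j)
    simp only [Pi.add_apply, mul_J_apply, J_mul_apply, tr, parity_partner, partner_partner] at this
    have e := parity_mul_self j
    linear_combination parity j * this + (P i j - X i j) * e
  funext i j
  simp only [projK, Pi.add_apply, Pi.sub_apply, Pi.smul_apply, smul_eq_mul, invol_apply, blockLower,
    blockUpper, blockDiag, partner_div]
  rcases lt_trichotomy (i / 2) (j / 2) with hij | hij | hij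
  · rw [if_neg hij.not_gt, if_neg hij.not_gt, if_neg hij.ne, if_neg hij.ne', hX.1 i j (by omega)]
    ring
  · have e := key i j
    rw [if_neg hij.not_gt, if_neg hij.not_gt, if_pos hij, if_pos hij.symm]
    have hX1 := hX.same_block hij
    have hX2 := hX.same_block (i := partner j) (j := partner i) (by rw [partner_div, partner_div, hij])
    by_cases h' : i = j
    · subst h'
      rw [if_pos rfl, partner_div] at hX2
      rw [if_pos rfl] at hX1
      rw [parity_mul_self, hX2, ← hX1] at e
      rw [parity_mul_self]
      linear_combination -(1 / 2 : ℂ) * e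
    · rw [if_neg h'] at hX1
      rw [if_neg (fun h => h' (by rw [← partner_partner i, ← h, partner_partner]))] at hX2
      rw [hX1, hX2] at e
      rw [hX1]
      linear_combination -(1 / 2 : ℂ) * e
  · have e := key i j
    rw [hX.1 (partner j) (partner i) (by
      have := partner_div i; have := partner_div j; omega)] at e
    rw [if_pos hij, if_pos hij, if_neg hij.ne', if_neg hij.ne]
    linear_combination -e

/-! ### The group `𝒢_𝕜` -/

theorem IsGk.diag_ne_zero {Q : SMat} (hQ : IsGk Q) (n : ℕ) : Q n n ≠ 0 := by
  rcases Nat.even_or_odd' n with ⟨k, rfl | rfl⟩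
  · exact (hQ.2 k).1
  · rw [(hQ.2 k).2.1]; exact (hQ.2 k).1

theorem IsLower.mul_subdiag {A B : SMat} (hA : IsLower A) (hB : IsLower B) (i : ℕ) :
    TodaPfaff.mul A B (i + 1) i = A (i + 1) i * B i i + A (i + 1) (i + 1) * B (i + 1) i := by
  rw [hA.mul_apply, Finset.sum_range_succ, Finset.sum_range_succ, Finset.sum_eq_zero, zero_add]
  intro k hk
  rw [hB k i (Finset.mem_range.1 hk), mul_zero]

theorem IsGk.mul {A B : SMat} (hA : IsGk A) (hB : IsGk B) : IsGk (mul A B) := by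
  refine ⟨hA.1.mul hB.1, fun n => ⟨?_, ?_, ?_⟩⟩
  · rw [hA.1.mul_diag hB.1]; exact mul_ne_zero (hA.2 n).1 (hB.2 n).1
  · rw [hA.1.mul_diag hB.1, hA.1.mul_diag hB.1, (hA.2 n).2.1, (hB.2 n).2.1]
  · rw [hA.1.mul_subdiag hB.1, (hA.2 n).2.2, (hB.2 n).2.2]; ring

theorem IsGk.lowerInv {Q : SMat} (hQ : IsGk Q) : IsGk (lowerInv Q) := by
  refine ⟨lowerInv_isLower Q, fun n => ⟨lowerInv_diag_ne_zero hQ.1 hQ.diag_ne_zero _, ?_, ?_⟩⟩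
  · rw [lowerInv_diag hQ.1 hQ.diag_ne_zero, lowerInv_diag hQ.1 hQ.diag_ne_zero, (hQ.2 n).2.1]
  · have h := congrFun₂ (mul_lowerInv hQ.1 hQ.diag_ne_zero) (2 * n + 1) (2 * n)
    rw [hQ.1.mul_subdiag (lowerInv_isLower Q), (hQ.2 n).2.2, zero_mul, zero_add] at h
    simp only [one] at h
    rw [if_neg (by omega)] at h
    exact (mul_eq_zero.1 h).resolve_left (hQ.diag_ne_zero _)

/-- The symplectic matrices in `𝒢_𝕜` are the diagonal sign matrices. -/
theorem IsGk.exists_sign {R : SMat} (hR : IsGk R) (h : TodaPfaff.mul (TodaPfaff.mul R J) (tr R) = J) :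
    ∃ ε : ℕ → ℂ, (∀ n, ε n = 1 ∨ ε n = -1) ∧ ∀ i j, R i j = if i = j then ε (i / 2) else 0 := by
  have hd := hR.diag_ne_zero
  have hT := hR.lowerInv
  have e : TodaPfaff.mul R J = TodaPfaff.mul J (tr (TodaPfaff.lowerInv R)) := by
    conv_rhs => rw [← h]
    rw [mul_assoc_right (by exact hR.1.rowFin) (by exact hT.1.rowFin), ← tr_mul, lowerInv_mul hR.1 hd,
      tr_one, mul_one']
  -- The symplectic condition expresses `R` through the transpose of `R⁻¹`, so `R` is both block
  -- lower and block upper triangular. On a diagonal block it then says that the scalar equals its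
  -- own inverse.
  have e' : ∀ i j, R i j = parity i * parity j * TodaPfaff.lowerInv R (partner j) (partner i) := by
    intro i j
    have := congrFun₂ e i (partner j)
    rw [mul_J_apply, J_mul_apply, parity_partner, partner_partner, tr] at this
    have e := parity_mul_self j
    linear_combination parity j * this - R i j * e
  have hK : IsK R := ⟨hR.1, fun n => (hR.2 n).2⟩
  have h1 : ∀ n, R (2 * n) (2 * n) * R (2 * n) (2 * n) = 1 := by
    intro n
    have h1 := e' (2 * n) (2 * n)
    have hp : partner (2 * n) = 2 * n + 1 := by unfold partner; rw [if_pos (by omega)]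
    rw [parity_mul_self, hp, (hT.2 n).2.1, lowerInv_diag hR.1 hd, one_mul] at h1
    nth_rw 2 [h1]
    exact mul_inv_cancel₀ (hd _)
  refine ⟨fun n => R (2 * n) (2 * n), fun n => mul_self_eq_one_iff.1 (h1 n), fun i j => ?_⟩
  rcases lt_trichotomy (i / 2) (j / 2) with hij | hij | hij
  · rw [if_neg (by rintro rfl; omega), hR.1 i j (by omega)]
  · exact hK.same_block hij
  · rw [if_neg (by rintro rfl; omega), e' i j, hT.1 (partner j) (partner i) (by
      have := partner_div i; have := partner_div j; omega), mul_zero]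

/-! ### Skew Gram–Schmidt -/

/-- Gram–Schmidt in steps of two: rows `2k` and `2k + 1` are made orthogonal to the earlier pairs
only, which needs just the even leading minors. Their mutual pairing is normalized by one square
root shared by both rows, as `𝒢_𝕜` demands. -/
theorem exists_skew_cholesky {m : SMat} (hskew : tr m = -m)
    (hdet : ∀ n, leadingDet m (2 * n) ≠ 0) :
    ∃ Q, IsGk Q ∧ mul (mul Q m) (tr Q) = J := by
  choose c hc using fun n : ℕ => exists_orthogonal_row (hdet (n / 2)) (m n)
  set U : SMat := fun n k => if k < 2 * (n / 2) then c n k else if k = n then 1 else 0 with hU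
  have hUl : IsLower U := fun i j hij => by
    simp only [hU]; rw [if_neg (by omega), if_neg (by omega)]
  have hUd : ∀ n, U n n = 1 := fun n => by
    simp only [hU, if_true]; rw [if_neg (by omega)]
  have hU1 : ∀ k, U (2 * k + 1) (2 * k) = 0 := fun n => by
    simp only [hU]; rw [if_neg (by omega), if_neg (by omega)]
  have h0 : ∀ n, ∀ l < 2 * (n / 2), mul U m n l = 0 := by
    intro n l hl
    rw [← hc n l hl, add_comm, hUl.mul_apply, Finset.sum_range_succ, hUd, one_mul]
    congr 1
    have hs : ∀ k ∈ Finset.range (2 * (n / 2)), U n k * m k l = c n k * m k l := fun k hk => by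
      simp only [hU]; rw [if_pos (Finset.mem_range.1 hk)]
    rw [← Finset.sum_congr rfl hs]
    refine (Finset.sum_subset (Finset.range_subset_range.2 (by omega)) fun k hk hk' => ?_).symm
    have h1 := Finset.mem_range.1 hk
    have h2 : ¬ k < 2 * (n / 2) := fun h => hk' (Finset.mem_range.2 h)
    simp only [hU]
    rw [if_neg h2, if_neg (by omega), zero_mul]
  have hskew' : ∀ {S : SMat}, IsLower S → tr (mul (mul S m) (tr S)) = -mul (mul S m) (tr S) := by
    intro S hS
    rw [tr_congruence hS, hskew, mul_neg', neg_mul']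
  have hdiag : ∀ {S : SMat}, IsLower S → ∀ n, mul (mul S m) (tr S) n n = 0 := by
    intro S hS n
    have := congrFun₂ (hskew' hS) n n
    simp only [tr, Pi.neg_apply] at this
    exact self_eq_neg.1 this
  have hd0 : ∀ k, mul U m (2 * k) (2 * k) = 0 := by
    intro k
    have h := hdiag hUl (2 * k)
    rw [hUl.mul_tr_apply, Finset.sum_range_succ, Finset.sum_eq_zero, hUd] at h
    · simpa using h
    · intro l hl
      rw [h0 _ l (by have := Finset.mem_range.1 hl; omega), mul_zero]
  -- The entry at `2k` vanishes by skewness. If the pairing vanished too, row `2k` of `U` would be a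
  -- left null vector of the leading block of size `2k + 2`.
  have hne : ∀ k, mul U m (2 * k) (2 * k + 1) ≠ 0 := by
    intro k hk
    refine hdet (k + 1) (leadingDet_eq_zero (U (2 * k)) (i := 2 * k) (by omega) (by rw [hUd]; simp) ?_)
    intro l hl
    rw [← mul_apply_range fun i hi => hUl (2 * k) i (by omega)]
    rcases (show l < 2 * (2 * k / 2) ∨ l = 2 * k ∨ l = 2 * k + 1 by omega) with h | h | h
    · exact h0 _ l h
    · rw [h, hd0]
    · rw [h, hk]
  choose r hr using fun k => IsAlgClosed.exists_pow_nat_eq (mul U m (2 * k) (2 * k + 1)) (n := 2) two_pos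
  have hr0 : ∀ n, r n ≠ 0 := fun n h => hne n (by rw [← hr, h]; simp)
  set S : SMat := fun n k => (r (n / 2))⁻¹ * U n k with hS
  have hSl : IsLower S := fun i j hij => by simp only [hS]; rw [hUl i j hij, mul_zero]
  have hSm : ∀ n l, mul S m n l = (r (n / 2))⁻¹ * mul U m n l := by
    intro n l
    rw [hSl.mul_apply, hUl.mul_apply, Finset.mul_sum]
    exact Finset.sum_congr rfl fun k _ => mul_assoc _ _ _
  have hlow : ∀ n l, l / 2 < n / 2 → mul (mul S m) (tr S) n l = 0 := by
    intro n l hl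
    rw [hSl.mul_tr_apply]
    refine Finset.sum_eq_zero fun k hk => ?_
    have := Finset.mem_range.1 hk
    rw [hSm, h0 n k (by omega)]; ring
  have hpair : ∀ k, mul (mul S m) (tr S) (2 * k) (2 * k + 1) = 1 := by
    intro k
    rw [hSl.mul_tr_apply, Finset.sum_range_succ, Finset.sum_range_succ, Finset.sum_eq_zero]
    · have := hr0 k
      have e1 : S (2 * k + 1) (2 * k) = 0 := by simp only [hS, hU1, mul_zero]
      have e2 : S (2 * k + 1) (2 * k + 1) = (r k)⁻¹ := by
        simp only [hS, hUd, mul_one, show (2 * k + 1) / 2 = k by omega]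
      rw [e1, e2, hSm (2 * k) (2 * k + 1), ← hr, show 2 * k / 2 = k by omega]
      field_simp; ring
    · intro l hl
      rw [hSm, h0 (2 * k) l (by have := Finset.mem_range.1 hl; omega)]; ring
  have hsw : ∀ n l, mul (mul S m) (tr S) n l = -mul (mul S m) (tr S) l n := by
    intro n l
    exact congrFun₂ (hskew' hSl) l n
  refine ⟨S, ⟨hSl, fun n => ⟨?_, ?_, ?_⟩⟩, ?_⟩
  · simp only [hS, hUd, mul_one]; exact inv_ne_zero (hr0 _)
  · simp only [hS, hUd, show (2 * n + 1) / 2 = n by omega, show 2 * n / 2 = n by omega]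
  · simp only [hS, hU1, mul_zero]
  · funext n l
    rw [J_apply]
    rcases lt_trichotomy (l / 2) (n / 2) with h | h | h
    · rw [hlow n l h, if_neg]
      rintro rfl
      rw [partner_div] at h; omega
    · by_cases hnl : n = l
      · subst hnl
        rw [hdiag hSl, if_neg]
        unfold partner; split_ifs <;> omega
      · unfold partner parity
        by_cases hn : n % 2 = 0
        · rw [if_pos hn, if_pos (by omega), if_pos hn]
          have := hpair (n / 2)
          rwa [show 2 * (n / 2) = n by omega, show n + 1 = l by omega] at this
        · rw [if_neg hn, if_pos (by omega), if_neg hn, hsw]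
          have := hpair (n / 2)
          rw [show 2 * (n / 2) = l by omega, show l + 1 = n by omega] at this
          rw [this]
    · rw [hsw, hlow l n h, if_neg, neg_zero]
      rintro rfl
      rw [partner_div] at h; omega

/-! ### The map to the Pfaff lattice -/

theorem mul_tr_pow_shift_apply (m : SMat) (j k l : ℕ) : mul m (tr (pow shift j)) k l = m k (l + j) := by
  rw [← tr_tr (mul m _), tr_mul, tr_tr, tr, mul_pow_shift_apply]; rfl

theorem congruence_mul {O S m : SMat} (hO : IsLower O) (hS : IsLower S) :
    mul (mul O (mul (mul S m) (tr S))) (tr O) = mul (mul (mul O S) m) (tr (mul O S)) := by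
  rw [tr_mul, ← mul_assoc_outer hO.rowFin (by exact hS.rowFin),
    mul_assoc_right (by exact hS.rowFin) (by exact hO.rowFin), mul_assoc_left hO.rowFin hS.rowFin]

/-- As for `differentiableWithinAt_cholesky`, two columns at a time. Because `J` exchanges partners,
column `2m + 1` of `A J Aᵀ` gives the diagonal entry times column `2m` of `A`, and column `2m` gives
it times column `2m + 1`. -/
theorem differentiableWithinAt_skew_cholesky {A : ℂ → SMat} {I : Set ℂ} {x : ℂ} (hx : x ∈ I)
    (hA : ∀ s ∈ I, IsGk (A s)) (hc : ∀ n, ContinuousWithinAt (fun s => A s n n) I x)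
    (hm : ∀ i j, DifferentiableWithinAt ℂ (fun s => mul (mul (A s) J) (tr (A s)) i j) I x)
    (i j : ℕ) : DifferentiableWithinAt ℂ (fun s => A s i j) I x := by
  suffices H : ∀ m i, DifferentiableWithinAt ℂ (fun s => A s i (2 * m)) I x ∧
      DifferentiableWithinAt ℂ (fun s => A s i (2 * m + 1)) I x by
    rcases Nat.even_or_odd' j with ⟨m, rfl | rfl⟩
    · exact (H m i).1
    · exact (H m i).2
  intro m
  induction m using Nat.strong_induction_on with
  | _ m ih =>
    have ih' : ∀ k < 2 * m, ∀ i, DifferentiableWithinAt ℂ (fun s => A s i k) I x := by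
      intro k hk i
      rcases Nat.even_or_odd' k with ⟨l, rfl | rfl⟩
      · exact (ih l (by omega) i).1
      · exact (ih l (by omega) i).2
    have hsum : ∀ i l, DifferentiableWithinAt ℂ
        (fun s => ∑ k ∈ Finset.range (2 * m), A s l k * mul (A s) J i k) I x := by
      intro i l
      refine DifferentiableWithinAt.fun_sum fun k hk => (ih' k (Finset.mem_range.1 hk) l).fun_mul ?_
      simp only [mul_J_apply]
      refine (differentiableWithinAt_const _).fun_mul (ih' _ ?_ i)
      have := partner_div k
      have := Finset.mem_range.1 hk
      omega
    have hp : partner (2 * m) = 2 * m + 1 := by unfold partner; rw [if_pos (by omega)]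
    have hp' : partner (2 * m + 1) = 2 * m := by unfold partner; rw [if_neg (by omega)]; omega
    have he : parity (2 * m) = 1 := by unfold parity; rw [if_pos (by omega)]
    have he' : parity (2 * m + 1) = -1 := by unfold parity; rw [if_neg (by omega)]
    have h1 : ∀ i, DifferentiableWithinAt ℂ (fun s => A s (2 * m) (2 * m) * A s i (2 * m)) I x := by
      intro i
      have h3 : ∀ s ∈ I, A s (2 * m) (2 * m) * A s i (2 * m) =
          mul (mul (A s) J) (tr (A s)) i (2 * m + 1) -
            ∑ k ∈ Finset.range (2 * m), A s (2 * m + 1) k * mul (A s) J i k := by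
        intro s hs
        have hG := hA s hs
        rw [hG.1.mul_tr_apply, Finset.sum_range_succ, Finset.sum_range_succ, (hG.2 m).2.1,
          (hG.2 m).2.2, mul_J_apply _ i (2 * m + 1), hp', he']
        ring
      exact ((hm i (2 * m + 1)).fun_sub (hsum i (2 * m + 1))).congr h3 (h3 x hx)
    have h2 : ∀ i, DifferentiableWithinAt ℂ (fun s => A s (2 * m) (2 * m) * A s i (2 * m + 1)) I x := by
      intro i
      have h3 : ∀ s ∈ I, A s (2 * m) (2 * m) * A s i (2 * m + 1) =
          (∑ k ∈ Finset.range (2 * m), A s (2 * m) k * mul (A s) J i k) -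
          mul (mul (A s) J) (tr (A s)) i (2 * m) := by
        intro s hs
        rw [(hA s hs).1.mul_tr_apply, Finset.sum_range_succ, mul_J_apply _ i (2 * m), hp, he]
        ring
      exact ((hsum i (2 * m)).fun_sub (hm i (2 * m))).congr h3 (h3 x hx)
    have hne := (hA x hx).diag_ne_zero (2 * m)
    have hd := differentiableWithinAt_of_sq (h1 (2 * m)) (hc _) hne
    have hev : ∀ᶠ s in 𝓝[I] x, A s (2 * m) (2 * m) ≠ 0 := (hc (2 * m)).eventually_ne hne
    refine fun i => ⟨?_, ?_⟩
    · refine ((h1 i).fun_div hd hne).congr_of_eventuallyEq ?_ (mul_div_cancel_left₀ _ hne).symm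
      filter_upwards [hev] with s hs
      rw [mul_div_cancel_left₀ _ hs]
    · refine ((h2 i).fun_div hd hne).congr_of_eventuallyEq ?_ (mul_div_cancel_left₀ _ hne).symm
      filter_upwards [hev] with s hs
      rw [mul_div_cancel_left₀ _ hs]

/-! ### The skew moment matrix, the matrix `O` and the Pfaff flow -/

section Weight

variable {a b : EReal} {f g : Polynomial ℝ} {V : ℝ → ℝ} {t : Times}

/-- The standing assumptions on the weight `ρ = e^{-V}` on the interval from `a` to `b`. -/
structure IsWeight (a b : EReal) (f g : Polynomial ℝ) (V : ℝ → ℝ) : Prop where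
  lt : a < b
  pos : ∀ z ∈ interval a b, 0 < f.eval z
  deriv : ∀ z ∈ interval a b, HasDerivAt V (g.eval z / f.eval z) z
  left : Tendsto (fun z : ℝ => f.eval z * Real.exp (-V z))
      (comap (fun x : ℝ => (x : EReal)) (𝓝[>] a)) (𝓝 0)
  right : Tendsto (fun z : ℝ => f.eval z * Real.exp (-V z))
      (comap (fun x : ℝ => (x : EReal)) (𝓝[<] b)) (𝓝 0)

theorem IsWeight.skewIP_eq (hw : IsWeight a b f g V) (P Q : Polynomial ℂ) :
    skewIP (interval a b) f V t (pfun P) (pfun Q) =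
      momentLin (interval a b) V ((2 : ℂ) • t) (P * nPoly f g ((2 : ℂ) • t) Q) :=
  symIP_nOp hw.pos hw.deriv P Q

theorem IsWeight.skewIP_eq_bracket (hw : IsWeight a b f g V)
    (ht : Admissible (interval a b) V ((2 : ℂ) • t)) (P Q : Polynomial ℂ) :
    skewIP (interval a b) f V t (pfun P) (pfun Q) =
      -(1 / 2) * momentLin (interval a b) V ((2 : ℂ) • t) (bracket P Q * toC f) := by
  rw [hw.skewIP_eq, momentLin_mul_nPoly hw.lt hw.pos hw.deriv hw.left hw.right ht]

theorem bracket_swap (P Q : Polynomial ℂ) : bracket Q P = Polynomial.C (-1) * bracket P Q := by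
  simp only [bracket, map_neg, map_one]; ring

theorem IsWeight.skewIP_swap (hw : IsWeight a b f g V)
    (ht : Admissible (interval a b) V ((2 : ℂ) • t)) (P Q : Polynomial ℂ) :
    skewIP (interval a b) f V t (pfun Q) (pfun P) = -skewIP (interval a b) f V t (pfun P) (pfun Q) := by
  rw [hw.skewIP_eq_bracket ht, hw.skewIP_eq_bracket ht, bracket_swap, mul_assoc, momentLin_C_mul]
  ring

theorem IsWeight.tr_skewMoment (hw : IsWeight a b f g V)
    (ht : Admissible (interval a b) V ((2 : ℂ) • t)) :
    tr (skewMoment (interval a b) f V t) = -skewMoment (interval a b) f V t := by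
  funext i j
  exact hw.skewIP_swap ht _ _

theorem IsWeight.congruence_skewMoment (hw : IsWeight a b f g V)
    (ht : Admissible (interval a b) V ((2 : ℂ) • t)) {S T : SMat} (hS : RowFin S) (hT : RowFin T)
    (i j : ℕ) : mul (mul S (skewMoment (interval a b) f V t)) (tr T) i j =
      momentLin (interval a b) V ((2 : ℂ) • t) (op S (Polynomial.X ^ i) *
        nPoly f g ((2 : ℂ) • t) (op T (Polynomial.X ^ j))) := by
  refine mul_mul_tr_apply (B := fun P Q => momentLin (interval a b) V ((2 : ℂ) • t)
    (P * nPoly f g ((2 : ℂ) • t) Q)) (fun Q => ?_) (fun P => ?_)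
    (fun i j => (hw.skewIP_eq _ _).symm) hS hT i j
  · exact ((momentMap ht).comp (LinearMap.mulRight ℂ (nPoly f g ((2 : ℂ) • t) Q))).isLinear
  · simp only [← nLin_apply]
    exact ((momentMap ht).comp ((LinearMap.mulLeft ℂ P).comp (nLin f g ((2 : ℂ) • t)))).isLinear

/-- The moments of the skew inner product after the change of basis by `S`. -/
theorem IsWeight.congruence_toda (hw : IsWeight a b f g V)
    (ht : Admissible (interval a b) V ((2 : ℂ) • t)) {S : SMat}
    (hS : IsTodaFactor (interval a b) V ((2 : ℂ) • t) S) :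
    mul (mul S (skewMoment (interval a b) f V t)) (tr S) = -matN f g ((2 : ℂ) • t) S := by
  have h : mul (mul S (skewMoment (interval a b) f V t)) (tr S) = tr (matN f g ((2 : ℂ) • t) S) := by
    funext i j
    rw [hw.congruence_skewMoment ht hS.1.rowFin hS.1.rowFin, tr, hS.matN_apply ht, polyP_eq hS.1,
      polyP_eq hS.1]
  rw [← tr_tr (mul _ (tr S)), tr_congruence hS.1, hw.tr_skewMoment ht, mul_neg', neg_mul', h]
  rfl

theorem matN_skew (hw : IsWeight a b f g V) (ht : Admissible (interval a b) V t) {S : SMat}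
    (hS : IsTodaFactor (interval a b) V t S) (i j : ℕ) :
    matN f g t S j i = -matN f g t S i j := by
  rw [hS.matN_apply ht, hS.matN_apply ht,
    momentLin_mul_nPoly hw.lt hw.pos hw.deriv hw.left hw.right ht,
    momentLin_mul_nPoly hw.lt hw.pos hw.deriv hw.left hw.right ht,
    bracket_swap, mul_assoc, momentLin_C_mul]
  ring

theorem IsPfaffMap.diag_ne_zero {S O : SMat} (hS : IsLower S) (h : IsPfaffMap f g t S O) (n : ℕ) :
    O n n ≠ 0 := by
  have := h.2.1.diag_ne_zero n
  rw [h.1.mul_diag hS] at this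
  exact left_ne_zero_of_mul this

/-- As `S m̃ Sᵀ = -𝒩`, the condition on `O` says that `O S` is a skew Gram–Schmidt factor of `m̃`;
questions about `O` become questions about factors in `𝒢_𝕜`. -/
theorem IsWeight.congruence_pfaff (hw : IsWeight a b f g V)
    (ht : Admissible (interval a b) V ((2 : ℂ) • t)) {S O : SMat}
    (hS : IsTodaFactor (interval a b) V ((2 : ℂ) • t) S)
    (hO : IsPfaffMap f g ((2 : ℂ) • t) S O) :
    mul (mul (mul O S) (skewMoment (interval a b) f V t)) (tr (mul O S)) = J := by
  rw [← congruence_mul hO.1 hS.1, hw.congruence_toda ht hS]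
  exact congruence_of_eq hO.1 (hO.diag_ne_zero hS.1) hO.2.2

theorem IsWeight.exists_pfaffMap (hw : IsWeight a b f g V)
    (ht : Admissible (interval a b) V ((2 : ℂ) • t)) {S : SMat}
    (hS : IsTodaFactor (interval a b) V ((2 : ℂ) • t) S)
    (hτ : ∀ n, tauTilde (interval a b) f V t n ≠ 0) :
    ∃ O, IsPfaffMap f g ((2 : ℂ) • t) S O := by
  obtain ⟨Q, hQ, hQJ⟩ := exists_skew_cholesky (hw.tr_skewMoment ht)
    fun n => leadingDet_ne_zero_of_leadingPf (hw.tr_skewMoment ht) (hτ n)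
  have hOl := hQ.1.mul (lowerInv_isLower S)
  have hOS : mul (mul Q (lowerInv S)) S = Q := by
    rw [mul_assoc_left hQ.1.rowFin (lowerInv_isLower S).rowFin, lowerInv_mul hS.1 hS.2.1, mul_one']
  refine ⟨mul Q (lowerInv S), hOl, by rwa [hOS], ?_⟩
  refine eq_of_congruence hOl (fun n => ?_) ?_
  · rw [hQ.1.mul_diag (lowerInv_isLower S)]
    exact mul_ne_zero (hQ.diag_ne_zero n) (lowerInv_diag_ne_zero hS.1 hS.2.1 n)
  · rw [← hw.congruence_toda ht hS, congruence_mul hOl hS.1, hOS, hQJ]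

theorem IsWeight.pfaffMap_unique (hw : IsWeight a b f g V)
    (ht : Admissible (interval a b) V ((2 : ℂ) • t)) {S O O' : SMat}
    (hS : IsTodaFactor (interval a b) V ((2 : ℂ) • t) S)
    (hO : IsPfaffMap f g ((2 : ℂ) • t) S O) (hO' : IsPfaffMap f g ((2 : ℂ) • t) S O') :
    ∃ ε : ℕ → ℂ, (∀ n, ε n = 1 ∨ ε n = -1) ∧ ∀ i j, O' i j = ε (i / 2) * O i j := by
  set Q := mul O S with hQ
  set Q' := mul O' S with hQ'
  have hG : IsGk Q := hO.2.1
  have hG' : IsGk Q' := hO'.2.1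
  have rQ := hG.1.rowFin
  have rQ' := hG'.1.rowFin
  have rI := hG.lowerInv.1.rowFin
  -- The quotient of the two factors is a symplectic element of `𝒢_𝕜`, hence a diagonal matrix of
  -- signs.
  set R := mul Q' (lowerInv Q) with hR
  have hRJ : mul (mul R J) (tr R) = J := by
    have h1 := hw.congruence_pfaff ht hS hO'
    rw [← hQ', eq_of_congruence hG.1 hG.diag_ne_zero (hw.congruence_pfaff ht hS hO),
      congruence_mul hG'.1 hG.lowerInv.1] at h1
    exact h1
  obtain ⟨ε, hε, hRε⟩ : ∃ ε : ℕ → ℂ, (∀ n, ε n = 1 ∨ ε n = -1) ∧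
      ∀ i j, R i j = if i = j then ε (i / 2) else 0 :=
    (hG'.mul hG.lowerInv).exists_sign hRJ
  have hRQ : mul R Q = Q' := by
    rw [hR, mul_assoc_left rQ' rI, lowerInv_mul hG.1 hG.diag_ne_zero, mul_one']
  have rS := hS.1.rowFin
  have rSi := (lowerInv_isLower S).rowFin
  have hback : ∀ {O : SMat}, IsLower O → mul (mul O S) (lowerInv S) = O := fun h => by
    rw [mul_assoc_left h.rowFin rS, mul_lowerInv hS.1 hS.2.1, mul_one']
  have hRO : O' = mul R O := by
    rw [← hback hO'.1, ← hQ', ← hRQ, hQ, mul_assoc_left (hG'.mul hG.lowerInv).1.rowFin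
      (hO.1.mul hS.1).rowFin, hback hO.1]
  refine ⟨ε, hε, fun i j => ?_⟩
  have hRl : IsLower R := (hG'.mul hG.lowerInv).1
  rw [hRO, hRl.mul_apply, Finset.sum_eq_single i]
  · rw [hRε, if_pos rfl]
  · intro k _ hk
    rw [hRε, if_neg hk.symm, zero_mul]
  · simp

theorem IsWeight.skew_orthonormal (hw : IsWeight a b f g V)
    (ht : Admissible (interval a b) V ((2 : ℂ) • t)) {S O : SMat}
    (hS : IsTodaFactor (interval a b) V ((2 : ℂ) • t) S)
    (hO : IsPfaffMap f g ((2 : ℂ) • t) S O) (i j : ℕ) :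
    skewIP (interval a b) f V t (pfun (polyQ S O i)) (pfun (polyQ S O j)) = J i j := by
  rw [hw.skewIP_eq, ← hw.congruence_pfaff ht hS hO, hw.congruence_skewMoment ht
    (hO.1.mul hS.1).rowFin (hO.1.mul hS.1).rowFin, polyQ_eq hS.1 hO.1, polyQ_eq hS.1 hO.1]

/-- The two terms containing the derivative of `Xⁿ` cancel by antisymmetry. -/
theorem bracket_X_pow_mul (n : ℕ) (P Q : Polynomial ℂ) :
    bracket (Polynomial.X ^ n * P) Q + bracket P (Polynomial.X ^ n * Q) =
      Polynomial.C 2 * (Polynomial.X ^ n * bracket P Q) := by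
  simp only [bracket, Polynomial.derivative_mul, Polynomial.C_ofNat]
  ring

theorem two_smul_add_single (t : Times) (j : ℕ+) (s : ℂ) :
    (2 : ℂ) • (t + Finsupp.single j s) = (2 : ℂ) • t + Finsupp.single j (2 * s) := by
  rw [smul_add, Finsupp.smul_single, smul_eq_mul]

theorem IsWeight.hasD_skewMoment (hw : IsWeight a b f g V) {j : ℕ+} {I : Set ℂ} (h0 : (0 : ℂ) ∈ I)
    (hI : ∀ s ∈ I, Admissible (interval a b) V ((2 : ℂ) • (t + Finsupp.single j s))) :
    HasD I 0 (fun s => skewMoment (interval a b) f V (t + Finsupp.single j s))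
      (mul (pow shift j) (skewMoment (interval a b) f V t) +
        mul (skewMoment (interval a b) f V t) (tr (pow shift j))) := by
  intro k l
  have ht : Admissible (interval a b) V ((2 : ℂ) • t) := by simpa using hI 0 h0
  set P : Polynomial ℂ := bracket (Polynomial.X ^ k) (Polynomial.X ^ l) * toC f with hP
  -- The times enter as `2t`, so the moments are differentiated along the dilated set `2I` and
  -- composed with `s ↦ 2s`. The resulting factor `2` is the one in `bracket_X_pow_mul`.
  have h1 : HasDerivWithinAt (fun s => momentLin (interval a b) V
      ((2 : ℂ) • t + Finsupp.single j s) P)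
      (momentLin (interval a b) V ((2 : ℂ) • t) (Polynomial.X ^ (j : ℕ) * P))
      ((fun s => 2 * s) '' I) (2 * 0) := by
    rw [mul_zero]
    have h0' : (0 : ℂ) ∈ (fun s => 2 * s) '' I := ⟨0, h0, mul_zero _⟩
    refine hasDerivWithinAt_momentLin h0' ?_ P
    rintro _ ⟨s, hs, rfl⟩
    have := hI s hs
    rwa [two_smul_add_single] at this
  have h2 : HasDerivWithinAt (fun s : ℂ => 2 * s) 2 I 0 := by
    simpa using ((hasDerivAt_id (0 : ℂ)).const_mul 2).hasDerivWithinAt (s := I)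
  have h3 := (h1.comp (0 : ℂ) h2 (Set.mapsTo_image _ _)).const_mul (-(1 / 2) : ℂ)
  have h4 : ∀ s ∈ I, skewMoment (interval a b) f V (t + Finsupp.single j s) k l =
      -(1 / 2) * ((fun s => momentLin (interval a b) V
      ((2 : ℂ) • t + Finsupp.single j s) P) ∘ fun s => 2 * s) s := by
    intro s hs
    rw [skewMoment, hw.skewIP_eq_bracket (hI s hs), two_smul_add_single]; rfl
  refine (h3.congr h4 (h4 0 h0)).congr_deriv ?_
  rw [Pi.add_apply, Pi.add_apply, mul_pow_shift_apply, mul_tr_pow_shift_apply, skewMoment,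
    skewMoment, hw.skewIP_eq_bracket ht, hw.skewIP_eq_bracket ht, ← mul_add, ← ht.momentLin_add, ← add_mul,
    pow_add, pow_add, mul_comm (Polynomial.X ^ k), mul_comm (Polynomial.X ^ l), bracket_X_pow_mul,
    mul_assoc (Polynomial.C 2), momentLin_C_mul, hP, mul_assoc (Polynomial.X ^ (j : ℕ))]
  ring

/-- The Pfaff lattice. -/
theorem IsWeight.pfaff_lax (hw : IsWeight a b f g V) {j : ℕ+} {I : Set ℂ} (h0 : (0 : ℂ) ∈ I)
    (hI : ∀ s ∈ I, Admissible (interval a b) V ((2 : ℂ) • (t + Finsupp.single j s)))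
    {S O : ℂ → SMat}
    (hSO : ∀ s ∈ I, IsTodaFactor (interval a b) V ((2 : ℂ) • (t + Finsupp.single j s)) (S s) ∧
      IsPfaffMap f g ((2 : ℂ) • (t + Finsupp.single j s)) (S s) (O s))
    (hcS : ∀ n, ContinuousWithinAt (fun s => S s n n) I 0)
    (hcO : ∀ n, ContinuousWithinAt (fun s => O s n n) I 0) :
    HasD I 0 (fun s => matLtilde (S s) (O s))
      (comm (-projK (pow (matLtilde (S 0) (O 0)) j)) (matLtilde (S 0) (O 0))) := by
  intro k l
  refine hasDerivWithinAt_of_uniqueDiff fun hu => ?_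
  have hSl := fun s hs => (hSO s hs).1.1
  have hSd := fun s hs => (hSO s hs).1.2.1
  have hOl := fun s hs => (hSO s hs).2.1
  have hOd := fun s hs => (hSO s hs).2.diag_ne_zero (hSl s hs)
  have hG := fun s hs => (hSO s hs).2.2.1
  have hm := hw.hasD_skewMoment h0 hI
  have hfac : ∀ s ∈ I, skewMoment (interval a b) f V (t + Finsupp.single j s) =
      mul (mul (lowerInv (mul (O s) (S s))) J) (tr (lowerInv (mul (O s) (S s)))) := fun s hs =>
    eq_of_congruence (hG s hs).1 (hG s hs).diag_ne_zero
      (hw.congruence_pfaff (hI s hs) (hSO s hs).1 (hSO s hs).2)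
  obtain ⟨A', hA'l, hA'⟩ : ∃ A', IsLower A' ∧
      HasD I 0 (fun s => lowerInv (mul (O s) (S s))) A' := by
    refine exists_hasD_of_isLower h0 (fun s _ => lowerInv_isLower _) fun i j _ => ?_
    refine differentiableWithinAt_skew_cholesky h0 (fun s hs => (hG s hs).lowerInv) (fun n => ?_)
      (fun i j => ?_) i j
    · have e : ∀ s ∈ I, lowerInv (mul (O s) (S s)) n n = (O s n n * S s n n)⁻¹ := fun s hs => by
        rw [lowerInv_diag (hG s hs).1 (hG s hs).diag_ne_zero, (hOl s hs).mul_diag (hSl s hs)]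
      exact (((hcO n).mul (hcS n)).inv₀ (mul_ne_zero (hOd 0 h0 n) (hSd 0 h0 n))).congr e (e 0 h0)
    · exact ((hm i j).differentiableWithinAt).congr
        (fun s hs => (congrFun₂ (hfac s hs) i j).symm) (congrFun₂ (hfac 0 h0) i j).symm
  have hQl := fun s hs => (hG s hs).1
  have hQd := fun s hs => (hG s hs).diag_ne_zero
  -- The conditions on the diagonal blocks of `𝒢_𝕜` are linear and pass to the derivative.
  have hA'K : IsK A' := by
    refine ⟨hA'l, fun n => ⟨?_, ?_⟩⟩
    · refine hu.eq_deriv I (hA' (2 * n + 1) (2 * n + 1)) ((hA' (2 * n) (2 * n)).congr ?_ ?_)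
      · exact fun s hs => ((hG s hs).lowerInv.2 n).2.1
      · exact ((hG 0 h0).lowerInv.2 n).2.1
    · refine hu.eq_deriv I (hA' (2 * n + 1) (2 * n)) ((hasDerivWithinAt_const (0 : ℂ) I (0 : ℂ)).congr ?_ ?_)
      · exact fun s hs => ((hG s hs).lowerInv.2 n).2.2
      · exact ((hG 0 h0).lowerInv.2 n).2.2
  set Q := mul (O 0) (S 0) with hQ
  have hQG : IsGk Q := hG 0 h0
  have hXK : IsK (mul Q A') := by
    refine ⟨hQG.1.mul hA'l, fun n => ⟨?_, ?_⟩⟩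
    · rw [hQG.1.mul_diag hA'l, hQG.1.mul_diag hA'l, (hQG.2 n).2.1, (hA'K.2 n).1]
    · rw [hQG.1.mul_subdiag hA'l, (hQG.2 n).2.2, (hA'K.2 n).2]; ring
  have h1 := congruence_deriv hu h0 hQl hQd hA'l hA' rowFin_J hfac hm
  have hfac0 := hfac 0 h0
  rw [Finsupp.single_zero, add_zero] at hfac0
  have ht : Admissible (interval a b) V ((2 : ℂ) • t) := by simpa using hI 0 h0
  have h2 := congruence_pow_shift (hQl 0 h0) (hQd 0 h0) hfac0 j
  -- By skewness of `m̃`, the term `m̃ Λᵀʲ` is minus the transpose of `Λʲ m̃`, so its congruence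
  -- follows from `h2`.
  have h3 : mul (mul Q (mul (skewMoment (interval a b) f V t) (tr (pow shift j)))) (tr Q) =
      mul J (tr (pow (matL Q) j)) := by
    have e : mul (skewMoment (interval a b) f V t) (tr (pow shift j)) =
        -tr (mul (pow shift j) (skewMoment (interval a b) f V t)) := by
      rw [tr_mul, hw.tr_skewMoment ht, neg_mul', neg_neg]
    rw [e, mul_neg', neg_mul', ← tr_congruence hQG.1, h2, tr_mul, tr_J, neg_mul', neg_neg]
  rw [← hQ] at h1 h2
  rw [mul_add' hQG.1.rowFin, add_mul' (by exact hQG.1.rowFin), h2, h3] at h1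
  -- `X = Q (Q⁻¹)'` lies in `𝕜` and satisfies `X J + J Xᵀ = L̃ʲ J + J (L̃ʲ)ᵀ`, which characterizes
  -- the projection of `L̃ʲ`.
  have hproj : projK (pow (matL Q) j) = mul Q A' := projK_eq hXK h1.symm
  have hLt := fun s hs => matLtilde_eq (hSl s hs) (hSd s hs) (hOl s hs) (hOd s hs)
  have hfin := (hasD_matL hu h0 hQl hQd hA'l hA').congr h0 hLt
  rw [hLt 0 h0, ← hQ, hproj]
  have e : comm (-mul Q A') (matL Q) = -comm (mul Q A') (matL Q) := by
    rw [comm, comm, neg_mul', mul_neg']; abel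
  rw [e]
  exact hfin k l

theorem IsWeight.skewIP_integral (hw : IsWeight a b f g V)
    (ht : Admissible (interval a b) V ((2 : ℂ) • t)) (P Q : Polynomial ℂ) :
    IntegrableOn (fun z : ℝ => pfun P z * nOp f V ((2 : ℂ) • t) (pfun Q) z *
        rho V ((2 : ℂ) • t) z) (interval a b) ∧
      IntegrableOn (fun z : ℝ => pfun (bracket P Q) z * rho (Vtilde f V) t z ^ 2) (interval a b) ∧
      skewIP (interval a b) f V t (pfun P) (pfun Q) =
        -(1 / 2) * ∫ z in interval a b, pfun (bracket P Q) z * rho (Vtilde f V) t z ^ 2 := by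
  refine ⟨?_, integrableOn_rho_Vtilde_sq hw.pos ht _, ?_⟩
  · refine (integrableOn_congr_fun (fun z hz => ?_) (isOpen_interval a b).measurableSet).2
      (ht.integrableOn (P * nPoly f g ((2 : ℂ) • t) Q))
    simp only [nOp_pfun (hw.pos z hz) (hw.deriv z hz), pfun_mul]
  · rw [hw.skewIP_eq_bracket ht, integral_rho_Vtilde_sq hw.pos]

theorem integrableOn_pow_mul_rho_Vtilde_sq (hw : IsWeight a b f g V)
    (ht : Admissible (interval a b) V ((2 : ℂ) • t)) (k : ℕ) :
    IntegrableOn (fun z : ℝ => (z : ℂ) ^ k * rho (Vtilde f V) t z ^ 2) (interval a b) := by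
  simpa [pfun] using integrableOn_rho_Vtilde_sq hw.pos ht (Polynomial.X ^ k)

theorem IsWeight.tauTilde_eq (hw : IsWeight a b f g V)
    (ht : Admissible (interval a b) V ((2 : ℂ) • t)) (n : ℕ) :
    tauTilde (interval a b) f V t n = (1 / (2 ^ n * n.factorial : ℂ)) *
      ∫ z : Fin n → ℝ, (vandermonde z : ℂ) ^ 4 *
        ∏ i, (interval a b).indicator (fun x => rho (Vtilde f V) t x ^ 2) (z i) := by
  have hE := (isOpen_interval a b).measurableSet
  rw [← (deBruijn (fun k => integrable_pow_mul_indicator hE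
    (integrableOn_pow_mul_rho_Vtilde_sq hw ht k)) n).2, tauTilde, leadingPf]
  congr 1; ext i j
  simp only [Matrix.of_apply, skewMoment]
  rw [(hw.skewIP_integral ht _ _).2.2, integral_mul_indicator hE]
  simp [pfun, bracket, Polynomial.derivative_X_pow]

end Weight

end TodaPfaff

end

/-! ### The Toda lattice and its map to the Pfaff lattice -/

open TodaPfaff in
theorem proposition7p1 (a b : EReal) (hab : a < b) (f g : Polynomial ℝ) (V : ℝ → ℝ)
    (hf : ∀ z ∈ interval a b, 0 < f.eval z)
    (hV : ∀ z ∈ interval a b, HasDerivAt V (g.eval z / f.eval z) z)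
    (ha : Tendsto (fun z : ℝ => f.eval z * Real.exp (-V z))
      (comap (fun x : ℝ => (x : EReal)) (𝓝[>] a)) (𝓝 0))
    (hb : Tendsto (fun z : ℝ => f.eval z * Real.exp (-V z))
      (comap (fun x : ℝ => (x : EReal)) (𝓝[<] b)) (𝓝 0)) :
    -- Toda lattice
    (∀ t : Times, Admissible (interval a b) V t →
      -- the Hermitian matrix integrals
      (∀ n : ℕ, IntegrableOn (hermWeight V t) (hermDomain (interval a b) n) (hermMeasure n) ∧
        tau (interval a b) V t n =
          (1 / (n.factorial : ℂ)) * ∫ c in hermDomain (interval a b) n, hermWeight V t c ∂hermMeasure n) ∧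
      (IsRealTimes t → ∀ n, ∃ r : ℝ, 0 < r ∧ tau (interval a b) V t n = r) ∧
      -- the factorization, the orthonormal polynomials and the matrix `𝒩`
      ((∀ n, tau (interval a b) V t n ≠ 0) → ∃ S, IsTodaFactor (interval a b) V t S) ∧
      (∀ S, IsTodaFactor (interval a b) V t S →
        (∀ i j, symIP (interval a b) V t (pfun (polyP S i)) (pfun (polyP S j)) =
          if i = j then 1 else 0) ∧
        (∀ n, ∀ z ∈ interval a b, nOp f V t (pfun (polyP S n)) z =
          ∑ᶠ k, matN f g t S n k * pfun (polyP S k) z) ∧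
        (∀ i j, matN f g t S j i = -matN f g t S i j)) ∧
      -- the Toda flows
      (∀ (j : ℕ+) (I : Set ℂ), 0 ∈ I →
        (∀ s ∈ I, Admissible (interval a b) V (t + Finsupp.single j s)) →
        (∀ k l, HasDerivWithinAt
          (fun s => moment (interval a b) V (t + Finsupp.single j s) k l)
          (mul (pow shift j) (moment (interval a b) V t) k l) I 0) ∧
        (∀ S : ℂ → SMat,
          (∀ s ∈ I, IsTodaFactor (interval a b) V (t + Finsupp.single j s) (S s)) →
          (∀ n, ContinuousWithinAt (fun s => S s n n) I 0) →
          ∀ k l, HasDerivWithinAt (fun s => matL (S s) k l)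
            (((1 / 2 : ℂ) • comm (skewPart (pow (matL (S 0)) j)) (matL (S 0))) k l) I 0))) ∧
    -- the map to the Pfaff lattice
    (∀ t : Times, Admissible (interval a b) V ((2 : ℂ) • t) →
      -- the weight `ρ̃_t` and the skew inner product
      (∀ z ∈ interval a b,
        rho (Vtilde f V) t z ^ 2 = rho V ((2 : ℂ) • t) z * ((f.eval z : ℝ) : ℂ)) ∧
      (∀ φ ψ : Polynomial ℂ,
        IntegrableOn (fun z : ℝ => pfun φ z * nOp f V ((2 : ℂ) • t) (pfun ψ) z *
          rho V ((2 : ℂ) • t) z) (interval a b) ∧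
        IntegrableOn (fun z : ℝ => pfun (bracket φ ψ) z * rho (Vtilde f V) t z ^ 2)
          (interval a b) ∧
        skewIP (interval a b) f V t (pfun φ) (pfun ψ) =
          -(1 / 2) * ∫ z in interval a b, pfun (bracket φ ψ) z * rho (Vtilde f V) t z ^ 2) ∧
      -- the symplectic matrix integrals
      (∀ n : ℕ, IntegrableOn (quatWeight (Vtilde f V) t) (quatDomain (interval a b) n)
          (quatMeasure n) ∧
        tauTilde (interval a b) f V t n =
          (1 / (2 ^ n * n.factorial : ℂ)) *
            ∫ c in quatDomain (interval a b) n, quatWeight (Vtilde f V) t c ∂quatMeasure n) ∧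
      (IsRealTimes t → ∀ n, ∃ r : ℝ, 0 < r ∧ tauTilde (interval a b) f V t n = r) ∧
      -- the matrix `O(2t)` and the skew-orthonormal polynomials
      (∀ S, IsTodaFactor (interval a b) V ((2 : ℂ) • t) S →
        ((∀ n, tauTilde (interval a b) f V t n ≠ 0) →
          ∃ O, IsPfaffMap f g ((2 : ℂ) • t) S O) ∧
        (∀ O O', IsPfaffMap f g ((2 : ℂ) • t) S O → IsPfaffMap f g ((2 : ℂ) • t) S O' →
          ∃ ε : ℕ → ℂ, (∀ n, ε n = 1 ∨ ε n = -1) ∧ ∀ i j, O' i j = ε (i / 2) * O i j) ∧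
        (∀ O, IsPfaffMap f g ((2 : ℂ) • t) S O → ∀ i j,
          skewIP (interval a b) f V t (pfun (polyQ S O i)) (pfun (polyQ S O j)) = J i j)) ∧
      -- the Pfaff flows
      (∀ (j : ℕ+) (I : Set ℂ), 0 ∈ I →
        (∀ s ∈ I, Admissible (interval a b) V ((2 : ℂ) • (t + Finsupp.single j s))) →
        (∀ k l, HasDerivWithinAt
          (fun s => skewMoment (interval a b) f V (t + Finsupp.single j s) k l)
          ((mul (pow shift j) (skewMoment (interval a b) f V t) +
            mul (skewMoment (interval a b) f V t) (tr (pow shift j))) k l) I 0) ∧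
        (∀ S O : ℂ → SMat,
          (∀ s ∈ I, IsTodaFactor (interval a b) V ((2 : ℂ) • (t + Finsupp.single j s)) (S s) ∧
            IsPfaffMap f g ((2 : ℂ) • (t + Finsupp.single j s)) (S s) (O s)) →
          (∀ n, ContinuousWithinAt (fun s => S s n n) I 0) →
          (∀ n, ContinuousWithinAt (fun s => O s n n) I 0) →
          ∀ k l, HasDerivWithinAt (fun s => matLtilde (S s) (O s) k l)
            (comm (-projK (pow (matLtilde (S 0) (O 0)) j)) (matLtilde (S 0) (O 0)) k l) I 0))) := by
  have hw : IsWeight a b f g V := ⟨hab, hf, hV, ha, hb⟩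
  have hEo := isOpen_interval a b
  have hE := hEo.measurableSet
  have hne := nonempty_interval hab
  have hVc := continuousOn_of_hasDerivAt hV
  refine ⟨fun t ht => ⟨herm_integral hE hVc ht, tau_pos hEo hne ht, fun hτ => ?_, fun S hS =>
    ⟨fun i j => ?_, fun n z hz => nOp_polyP hf hV hS.1 hS.2.1 n hz, matN_skew hw ht hS⟩,
    fun j I h0 hI => ⟨hasD_moment h0 hI, fun S hS hc => toda_lax h0 hI hS hc⟩⟩,
    fun t ht => ⟨fun z hz => rho_Vtilde_sq (hf z hz) t, hw.skewIP_integral ht, fun n => ?_,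
      fun htr n => ?_, fun S hS => ⟨hw.exists_pfaffMap ht hS,
        fun O O' => hw.pfaffMap_unique ht hS, fun O => hw.skew_orthonormal ht hS⟩,
      fun j I h0 hI => ⟨hw.hasD_skewMoment h0 hI,
        fun S O hSO hcS hcO => hw.pfaff_lax h0 hI hSO hcS hcO⟩⟩⟩
  · exact exists_cholesky moment_symm hτ
  · rw [symIP_pfun, hS.orthonormal ht]
  · obtain ⟨h1, h2⟩ := quat_integral hE (continuousOn_Vtilde hf hV)
      (integrableOn_pow_mul_rho_Vtilde_sq hw ht) n
    exact ⟨h1, by rw [hw.tauTilde_eq ht, h2]⟩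
  · rw [hw.tauTilde_eq ht]
    exact integral_vandermonde_four_pos hEo hne (integrableOn_pow_mul_rho_Vtilde_sq hw ht) htr n
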